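/- Let $\hat{\mathbb C}=\mathbb C\cup\{\infty\}$. For a Jordan curve $C\subset\hat{\mathbb C}$, one of the two components of $\hat{\mathbb C}\setminus C$ is chosen and called its interior; the other one is its exterior. A *marked T-Schottky group* on Möbius transformations $g_1,\dots,g_n$ is the group they generate, provided that there are $2n$ Jordan curves $C_i,C_i'$ ($1\le i\le n$) in $\hat{\mathbb C}$, with at most finitely many tangencies (that is, any two of the curves have at most finitely many common points) and with pairwise disjoint interiors, such that each $g_i$ maps the exterior of $C_i$ onto the interior of $C_i'$. It is *marked classical T-Schottky* on $g_1,\dots,g_n$ if there are such curves which are circles in $\hat{\mathbb C}$ (Euclidean circles, or straight lines together with $\infty$; for circles nothing is required on tangencies). A group of Möbius transformations is *T-Schottky* (respectively *classical T-Schottky*) if it is marked T-Schottky (respectively marked classical T-Schottky) on some finite family of generators. A T-Schottky group is *non-classical* if it is not classical T-Schottky, i.e. if it is classical on no set of generators. For $\lambda\in\mathbb C$ let $G_\lambda\subset PSL(2,\mathbb C)$ be the group of Möbius transformations generated by $S=\begin{pmatrix}1&0\\1&1\end{pmatrix}$ and $T_\lambda=\begin{pmatrix}1&2\lambda\\0&1\end{pmatrix}$,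 and let $K\subset\mathbb C$ be the convex hull of the circle $|z|=1$ and the points $\pm2$. **Theorem 7.2.** Suppose that $\lambda=x+iy$ lies in the closed first quadrant ($x,y\ge 0$), strictly below the classical T-Schottky parabola, i.e. $y<1-x^2/4$, and that $\lambda$ is not in the interior of $K$. Then $G_\lambda$ is a non-classical T-Schottky group: it is T-Schottky, and it is not classical T-Schottky on any set of generators. Moreover (Theorem 7.3, the T-Schottky condition in trace form): let $S,T\in SL(2,\mathbb C)$ with $\operatorname{tr}S=\operatorname{tr}T=2$, and let $w=\operatorname{tr}(ST)-2$. If $$|w|\ge 2\ \text{ and }\ \tfrac{\pi}{3}\le\operatorname{Arg}w\le\tfrac{\pi}{2},\qquad\text{or}\qquad \operatorname{Re}\bigl(w\,e^{-i\pi/3}\bigr)\ge 2\ \text{ and }\ 0\le\operatorname{Arg}w\le\tfrac{\pi}{3},$$ then the group of Möbius transformations generated by $S$ and $T$ is T-Schottky. -/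

import Mathlib

open scoped MatrixGroups

noncomputable section

namespace TSchottky

/-- The complex sphere: the one-point compactification of `ℂ`. -/
abbrev Sphere : Type := OnePoint ℂ

/-- The action of invertible `2 × 2` complex matrices on the complex sphere by
`z ↦ (a z + b) / (c z + d)`. -/
def moebius : GL (Fin 2) ℂ →* Equiv.Perm Sphere :=
  MulAction.toPermHom (GL (Fin 2) ℂ) Sphere

/-- The group of all Möbius transformations, `PSL(2, ℂ)`, realized as a group of permutations of
the complex sphere. -/
def moebiusGroup : Subgroup (Equiv.Perm Sphere) := moebius.range

/-- A Jordan curve on the complex sphere: an injective continuous image of the circle. -/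
def IsJordanCurve (C : Set Sphere) : Prop :=
  ∃ f : Circle → Sphere, Continuous f ∧ Function.Injective f ∧ Set.range f = C

/-- A circle on the complex sphere: a Euclidean circle of positive radius, or a straight line
together with `∞`. -/
def IsCircle (C : Set Sphere) : Prop :=
  (∃ (c : ℂ) (r : ℝ), 0 < r ∧ C = (fun z : ℂ => (z : Sphere)) '' Metric.sphere c r) ∨
  (∃ p v : ℂ, v ≠ 0 ∧
    C = insert OnePoint.infty (Set.range fun t : ℝ => ((p + t * v : ℂ) : Sphere)))

/-- `D` is one of the connected components of the complement of `C`. A curve on the sphere has no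
preferred side, so the side that is called its interior is a choice of such a component. -/
def IsSideOf (D C : Set Sphere) : Prop :=
  ∃ x ∈ Cᶜ, D = connectedComponentIn Cᶜ x

/-- The other side of a curve `C` of which the side `D` was chosen as interior. -/
def exteriorOf (C D : Set Sphere) : Set Sphere := (C ∪ D)ᶜ

/-- The `2n` curves `C (inl i)`, `C (inr i)` (classically written `C_i`, `C'_i`), with interiors
`D (inl i)`, `D (inr i)`, and the Möbius transformations `g i` form a side-pairing configuration:
the interiors of the `2n` curves are pairwise disjoint, and each `g i` maps the exterior of `C_i`
onto the interior of `C'_i`. The corresponding domain is the intersection of the exteriors. -/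
structure IsPairing {n : ℕ} (C D : Fin n ⊕ Fin n → Set Sphere) (g : Fin n → Equiv.Perm Sphere) :
    Prop where
  isSideOf : ∀ j, IsSideOf (D j) (C j)
  disjoint : ∀ j k, j ≠ k → Disjoint (D j) (D k)
  mem_moebiusGroup : ∀ i, g i ∈ moebiusGroup
  image_exterior : ∀ i, g i '' exteriorOf (C (Sum.inl i)) (D (Sum.inl i)) = D (Sum.inr i)

/-- The group generated by `g` is marked classical T-Schottky on the generators `g`. -/
def IsMarkedClassicalTSchottky {n : ℕ} (g : Fin n → Equiv.Perm Sphere) : Prop :=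
  ∃ C D : Fin n ⊕ Fin n → Set Sphere, (∀ j, IsCircle (C j)) ∧ IsPairing C D g

/-- The group generated by `g` is marked T-Schottky on the generators `g`: the curves are Jordan
curves with at most finitely many tangencies. As their interiors are disjoint, two of the curves
can only touch, never cross, so the tangencies are the common points of distinct curves. -/
def IsMarkedTSchottky {n : ℕ} (g : Fin n → Equiv.Perm Sphere) : Prop :=
  ∃ C D : Fin n ⊕ Fin n → Set Sphere, (∀ j, IsJordanCurve (C j)) ∧
    (∀ j k, j ≠ k → (C j ∩ C k).Finite) ∧ IsPairing C D g

/-- A group is classical T-Schottky if it is marked classical T-Schottky on some finite family of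
generators. -/
def IsClassicalTSchottky (G : Subgroup (Equiv.Perm Sphere)) : Prop :=
  ∃ (n : ℕ) (g : Fin n → Equiv.Perm Sphere),
    Subgroup.closure (Set.range g) = G ∧ IsMarkedClassicalTSchottky g

/-- A group is T-Schottky if it is marked T-Schottky on some finite family of generators. -/
def IsTSchottky (G : Subgroup (Equiv.Perm Sphere)) : Prop :=
  ∃ (n : ℕ) (g : Fin n → Equiv.Perm Sphere),
    Subgroup.closure (Set.range g) = G ∧ IsMarkedTSchottky g

/-- A T-Schottky group is non-classical if it is not classical on any set of generators. -/
def IsNonClassicalTSchottky (G : Subgroup (Equiv.Perm Sphere)) : Prop :=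
  IsTSchottky G ∧ ¬ IsClassicalTSchottky G

/-- The group of Möbius transformations generated by (the classes of) two matrices. -/
def twoGenerator (S T : SL(2, ℂ)) : Subgroup (Equiv.Perm Sphere) :=
  Subgroup.closure {moebius (S : GL (Fin 2) ℂ), moebius (T : GL (Fin 2) ℂ)}

/-- The parabolic matrix `S`. -/
def matS : SL(2, ℂ) := ⟨!![1, 0; 1, 1], by simp [Matrix.det_fin_two_of]⟩

/-- The matrix `T`, parabolic for `l ≠ 0`. -/
def matT (l : ℂ) : SL(2, ℂ) := ⟨!![1, 2 * l; 0, 1], by simp [Matrix.det_fin_two_of]⟩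

/-- The two-parabolic group with Lyndon–Ullman parameter `l`. -/
def groupG (l : ℂ) : Subgroup (Equiv.Perm Sphere) := twoGenerator matS (matT l)

/-- The Lyndon–Ullman region `K`: the convex hull of the unit circle and the points `2`, `-2`. -/
def regionK : Set ℂ := convexHull ℝ (Metric.sphere (0 : ℂ) 1 ∪ {2, -2})

end TSchottky

end

open scoped MatrixGroups
open Filter Topology Set

noncomputable section

namespace TSchottky

/-! ### Möbius transformations as homeomorphisms of the sphere -/

/-- The invertible matrix with the given entries. -/
def glMk (a b c d : ℂ) (h : a * d - b * c ≠ 0) : GL (Fin 2) ℂ :=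
  Matrix.GeneralLinearGroup.mkOfDetNeZero !![a, b; c, d] (by rwa [Matrix.det_fin_two_of])

lemma moebius_infty (g : GL (Fin 2) ℂ) :
    moebius g OnePoint.infty = if g 1 0 = 0 then OnePoint.infty else ((g 0 0 / g 1 0 : ℂ) : Sphere) := by
  change g • (OnePoint.infty : Sphere) = _
  convert OnePoint.smul_infty_eq_ite g

lemma moebius_coe (g : GL (Fin 2) ℂ) (z : ℂ) :
    moebius g (z : Sphere) = if g 1 0 * z + g 1 1 = 0 then OnePoint.infty
      else (((g 0 0 * z + g 0 1) / (g 1 0 * z + g 1 1) : ℂ) : Sphere) := by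
  change g • (z : Sphere) = _
  convert OnePoint.smul_some_eq_ite (g := g) (k := z)

lemma glMk_infty (a b c d : ℂ) (h : a * d - b * c ≠ 0) :
    moebius (glMk a b c d h) OnePoint.infty =
      if c = 0 then OnePoint.infty else ((a / c : ℂ) : Sphere) := by
  rw [moebius_infty]; simp [glMk]

lemma glMk_coe (a b c d : ℂ) (h : a * d - b * c ≠ 0) (z : ℂ) :
    moebius (glMk a b c d h) (z : Sphere) = if c * z + d = 0 then OnePoint.infty
      else (((a * z + b) / (c * z + d) : ℂ) : Sphere) := by
  rw [moebius_coe]; simp [glMk]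

/-- The matrix of `z ↦ a z + b`. -/
def affineGL (a b : ℂ) (h : a ≠ 0) : GL (Fin 2) ℂ := glMk a b 0 1 (by simpa using h)

lemma affineGL_infty (a b : ℂ) (h : a ≠ 0) :
    moebius (affineGL a b h) OnePoint.infty = OnePoint.infty := by
  simp [affineGL, glMk_infty]

lemma affineGL_coe (a b : ℂ) (h : a ≠ 0) (z : ℂ) :
    moebius (affineGL a b h) (z : Sphere) = ((a * z + b : ℂ) : Sphere) := by
  simp [affineGL, glMk_coe]

/-- The matrix of `z ↦ 1 / z`. -/
def swapGL : GL (Fin 2) ℂ := glMk 0 1 1 0 (by simp)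

lemma swapGL_infty : moebius swapGL OnePoint.infty = ((0 : ℂ) : Sphere) := by
  simp [swapGL, glMk_infty]

lemma swapGL_zero : moebius swapGL ((0 : ℂ) : Sphere) = OnePoint.infty := by
  simp [swapGL, glMk_coe]

lemma swapGL_coe {z : ℂ} (h : z ≠ 0) : moebius swapGL (z : Sphere) = ((z⁻¹ : ℂ) : Sphere) := by
  simp [swapGL, glMk_coe, h]

lemma continuous_affineGL (a b : ℂ) (h : a ≠ 0) : Continuous (moebius (affineGL a b h)) := by
  have : (moebius (affineGL a b h) : Sphere → Sphere) = OnePoint.map (fun z : ℂ => a * z + b) := by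
    funext z
    induction z using OnePoint.rec with
    | infty => simp [affineGL_infty]
    | coe z => simp [affineGL_coe]
  rw [this]
  refine OnePoint.continuous_map (by fun_prop) ?_
  have e : (fun z : ℂ => a * z + b) = (Homeomorph.mulLeft₀ a h).trans (Homeomorph.addRight b) := by
    funext z; simp
  rw [e]
  rw [coclosedCompact_eq_cocompact]
  exact (Homeomorph.isClosedEmbedding _).tendsto_cocompact

lemma tendsto_coe_infty_iff {ι : Type*} {l : Filter ι} {f : ι → ℂ} :
    Tendsto (fun i => (f i : Sphere)) l (𝓝 OnePoint.infty) ↔ Tendsto (fun i => ‖f i‖) l atTop := by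
  rw [tendsto_norm_atTop_iff_cobounded, Metric.cobounded_eq_cocompact,
    ← coclosedCompact_eq_cocompact, ← OnePoint.comap_coe_nhds_infty, tendsto_comap_iff]
  rfl

lemma continuous_swapGL : Continuous (moebius swapGL) := by
  rw [OnePoint.continuous_iff]
  have hE : ∀ᶠ z : ℂ in coclosedCompact ℂ, z ≠ 0 := by
    rw [coclosedCompact_eq_cocompact]
    exact (isCompact_singleton (x := (0 : ℂ))).compl_mem_cocompact
  constructor
  · rw [swapGL_infty]
    have h2 : Tendsto (fun z : ℂ => ((z⁻¹ : ℂ) : Sphere)) (coclosedCompact ℂ) (𝓝 ((0 : ℂ) : Sphere)) := by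
      refine (OnePoint.continuous_coe.tendsto 0).comp ?_
      rw [coclosedCompact_eq_cocompact]
      exact tendsto_inv₀_cobounded.mono_left (by rw [Metric.cobounded_eq_cocompact])
    refine h2.congr' ?_
    filter_upwards [hE] with z hz using (swapGL_coe hz).symm
  · rw [continuous_iff_continuousAt]
    intro z
    by_cases hz : z = 0
    · subst hz
      rw [continuousAt_iff_punctured_nhds, swapGL_zero]
      have h2 : Tendsto (fun z : ℂ => ((z⁻¹ : ℂ) : Sphere)) (𝓝[≠] 0) (𝓝 OnePoint.infty) := by
        rw [tendsto_coe_infty_iff, tendsto_norm_atTop_iff_cobounded]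
        exact tendsto_inv₀_nhdsNE_zero
      refine h2.congr' ?_
      filter_upwards [self_mem_nhdsWithin] with w hw using (swapGL_coe hw).symm
    · have h2 : ContinuousAt (fun z : ℂ => ((z⁻¹ : ℂ) : Sphere)) z :=
        OnePoint.continuous_coe.continuousAt.comp (continuousAt_inv₀ hz)
      refine h2.congr ?_
      filter_upwards [isOpen_ne.mem_nhds hz] with w hw using (swapGL_coe hw).symm

lemma continuous_moebius (g : GL (Fin 2) ℂ) : Continuous (moebius g) := by
  have hdet : g 0 0 * g 1 1 - g 0 1 * g 1 0 ≠ 0 := by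
    have := g.det_ne_zero
    rwa [Matrix.det_fin_two] at this
  by_cases hc : g 1 0 = 0
  · have hd : g 1 1 ≠ 0 := by rintro h; simp [hc, h] at hdet
    have ha : g 0 0 ≠ 0 := by rintro h; simp [hc, h] at hdet
    convert continuous_affineGL (g 0 0 / g 1 1) (g 0 1 / g 1 1) (div_ne_zero ha hd) using 1
    funext z
    induction z using OnePoint.rec with
    | infty => rw [affineGL_infty, moebius_infty, if_pos hc]
    | coe z =>
      rw [affineGL_coe, moebius_coe, hc, if_neg (by simpa using hd)]
      rw [zero_mul, zero_add]
      congr 1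
      field_simp
  · have h1 : g 0 1 - g 0 0 * g 1 1 / g 1 0 ≠ 0 := by
      intro h
      apply hdet
      field_simp at h
      linear_combination -h
    have : g = affineGL _ (g 0 0 / g 1 0) h1 * swapGL * affineGL (g 1 0) (g 1 1) hc := by
      ext i j
      fin_cases i <;> fin_cases j <;>
        simp [affineGL, swapGL, glMk, Matrix.mul_apply, Fin.sum_univ_two, hc]
      field_simp
      ring
    rw [this, map_mul, map_mul]
    exact ((continuous_affineGL _ _ _).comp continuous_swapGL).comp (continuous_affineGL _ _ _)

lemma continuous_of_mem {f : Equiv.Perm Sphere} (hf : f ∈ moebiusGroup) : Continuous f := by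
  obtain ⟨g, rfl⟩ := hf
  exact continuous_moebius g

/-- A Möbius transformation as a homeomorphism of the sphere. -/
def toHomeo (f : Equiv.Perm Sphere) (hf : f ∈ moebiusGroup) : Sphere ≃ₜ Sphere where
  toEquiv := f
  continuous_toFun := continuous_of_mem hf
  continuous_invFun := continuous_of_mem (f := f⁻¹) (inv_mem hf)

@[simp] lemma coe_toHomeo (f : Equiv.Perm Sphere) (hf : f ∈ moebiusGroup) :
    (toHomeo f hf : Sphere → Sphere) = f := rfl

lemma mem_moebiusGroup (g : GL (Fin 2) ℂ) : moebius g ∈ moebiusGroup := ⟨g, rfl⟩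

/-! ### Round discs -/

/-- The upper half-plane. -/
def upper : Set Sphere := (↑) '' {z : ℂ | 0 < z.im}

/-- The lower half-plane. -/
def lower : Set Sphere := (↑) '' {z : ℂ | z.im < 0}

/-- The extended real line. -/
def realLine : Set Sphere := insert OnePoint.infty ((↑) '' {z : ℂ | z.im = 0})

lemma coe_mem_upper {z : ℂ} : (z : Sphere) ∈ upper ↔ 0 < z.im := by simp [upper]
lemma coe_mem_lower {z : ℂ} : (z : Sphere) ∈ lower ↔ z.im < 0 := by simp [lower]
lemma coe_mem_realLine {z : ℂ} : (z : Sphere) ∈ realLine ↔ z.im = 0 := by simp [realLine]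
lemma infty_notMem_upper : OnePoint.infty ∉ upper := by simp [upper]
lemma infty_mem_realLine : OnePoint.infty ∈ realLine := by simp [realLine]

lemma mem_cases (z : Sphere) : z ∈ upper ∨ z ∈ lower ∨ z ∈ realLine := by
  induction z using OnePoint.rec with
  | infty => exact Or.inr (Or.inr infty_mem_realLine)
  | coe z =>
    rw [coe_mem_upper, coe_mem_lower, coe_mem_realLine]
    rcases lt_trichotomy z.im 0 with h | h | h <;> simp [h]

lemma isOpen_upper : IsOpen upper :=
  OnePoint.isOpen_image_coe.2 (isOpen_lt continuous_const Complex.continuous_im)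

lemma isOpen_lower : IsOpen lower :=
  OnePoint.isOpen_image_coe.2 (isOpen_lt Complex.continuous_im continuous_const)

lemma disjoint_upper_lower : Disjoint upper lower := by
  rw [Set.disjoint_left]
  rintro _ ⟨z, hz, rfl⟩ h
  rw [coe_mem_lower] at h
  exact lt_asymm hz h

lemma disjoint_upper_realLine : Disjoint upper realLine := by
  rw [Set.disjoint_left]
  rintro _ ⟨z, hz, rfl⟩ h
  rw [coe_mem_realLine] at h
  exact hz.ne' h

lemma disjoint_lower_realLine : Disjoint lower realLine := by
  rw [Set.disjoint_left]
  rintro _ ⟨z, hz, rfl⟩ h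
  rw [coe_mem_realLine] at h
  exact hz.ne h

lemma isPreconnected_upper : IsPreconnected upper :=
  (convex_halfSpace_im_gt 0).isPreconnected.image _ OnePoint.continuous_coe.continuousOn

lemma image_neg_upper : moebius (affineGL (-1) 0 (by simp)) '' upper = lower := by
  ext z
  constructor
  · rintro ⟨_, ⟨w, hw, rfl⟩, rfl⟩
    rw [affineGL_coe, coe_mem_lower]
    simpa using hw
  · rintro ⟨w, hw, rfl⟩
    refine ⟨((-w : ℂ) : Sphere), by rw [coe_mem_upper]; simpa using hw, ?_⟩
    rw [affineGL_coe]; simp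

lemma realLine_subset_closure_upper : realLine ⊆ closure upper := by
  have key : (closure upper) = closure ((↑) '' {z : ℂ | 0 < z.im}) := rfl
  rw [realLine, Set.insert_subset_iff]
  constructor
  · have h : Tendsto (fun n : ℕ => (((n + 1 : ℕ) * Complex.I : ℂ) : Sphere)) atTop
        (𝓝 OnePoint.infty) := by
      rw [tendsto_coe_infty_iff]
      simp only [norm_mul, Complex.norm_natCast, Complex.norm_I, mul_one]
      exact tendsto_natCast_atTop_atTop.comp (tendsto_add_atTop_nat 1)
    refine mem_closure_of_tendsto h (Eventually.of_forall fun n => ?_)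
    rw [coe_mem_upper]
    simp
    positivity
  · rintro _ ⟨z, hz, rfl⟩
    have hz' : z ∈ closure {z : ℂ | 0 < z.im} := by
      rw [Complex.closure_setOfPred_lt_im]
      exact (le_of_eq (Eq.symm hz) : (0 : ℝ) ≤ z.im)
    exact image_closure_subset_closure_image OnePoint.continuous_coe ⟨z, hz', rfl⟩

lemma closure_upper : closure upper = lowerᶜ := by
  apply Set.Subset.antisymm
  · exact closure_minimal (Set.subset_compl_iff_disjoint_right.2 disjoint_upper_lower)
      isOpen_lower.isClosed_compl
  · intro z hz
    rcases mem_cases z with h | h | h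
    · exact subset_closure h
    · exact absurd h hz
    · exact realLine_subset_closure_upper h

lemma frontier_upper : frontier upper = realLine := by
  rw [isOpen_upper.frontier_eq, closure_upper]
  ext z
  constructor
  · rintro ⟨h1, h2⟩
    rcases mem_cases z with h | h | h
    · exact absurd h h2
    · exact absurd h h1
    · exact h
  · intro h
    exact ⟨fun h' => Set.disjoint_left.1 disjoint_lower_realLine h' h,
      fun h' => Set.disjoint_left.1 disjoint_upper_realLine h' h⟩

/-- An open round disc on the sphere, i.e. a Möbius image of the upper half-plane. -/
def IsDisc (D : Set Sphere) : Prop := ∃ f ∈ moebiusGroup, f '' upper = D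

lemma image_closure_of_mem {f : Equiv.Perm Sphere} (hf : f ∈ moebiusGroup) (s : Set Sphere) :
    f '' closure s = closure (f '' s) := (toHomeo f hf).image_closure s

lemma image_frontier_of_mem {f : Equiv.Perm Sphere} (hf : f ∈ moebiusGroup) (s : Set Sphere) :
    f '' frontier s = frontier (f '' s) := (toHomeo f hf).image_frontier s

lemma isOpen_image_of_mem {f : Equiv.Perm Sphere} (hf : f ∈ moebiusGroup) {s : Set Sphere}
    (hs : IsOpen s) : IsOpen (f '' s) := (toHomeo f hf).isOpenMap s hs

namespace IsDisc

variable {D : Set Sphere}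

lemma image (h : IsDisc D) {f : Equiv.Perm Sphere} (hf : f ∈ moebiusGroup) : IsDisc (f '' D) := by
  obtain ⟨k, hk, rfl⟩ := h
  exact ⟨f * k, mul_mem hf hk, by rw [Equiv.Perm.coe_mul, Set.image_comp]⟩

lemma isOpen (h : IsDisc D) : IsOpen D := by
  obtain ⟨k, hk, rfl⟩ := h
  exact isOpen_image_of_mem hk isOpen_upper

lemma nonempty (h : IsDisc D) : D.Nonempty := by
  obtain ⟨k, hk, rfl⟩ := h
  exact ⟨_, _, (coe_mem_upper (z := Complex.I)).2 (by simp), rfl⟩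

lemma isPreconnected (h : IsDisc D) : IsPreconnected D := by
  obtain ⟨k, hk, rfl⟩ := h
  exact isPreconnected_upper.image _ (continuous_of_mem hk).continuousOn

lemma compl_closure (h : IsDisc D) : IsDisc (closure D)ᶜ := by
  obtain ⟨k, hk, rfl⟩ := h
  rw [← image_closure_of_mem hk, ← Set.image_compl_eq k.bijective, closure_upper, compl_compl,
    ← image_neg_upper]
  exact IsDisc.image ⟨_, mem_moebiusGroup _, rfl⟩ hk

lemma closure_compl_closure (h : IsDisc D) : closure (closure D)ᶜ = Dᶜ := by
  obtain ⟨k, hk, rfl⟩ := h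
  rw [← image_closure_of_mem hk, ← Set.image_compl_eq k.bijective, closure_upper, compl_compl,
    ← image_closure_of_mem hk, ← Set.image_compl_eq k.bijective]
  congr 1
  apply Set.Subset.antisymm
  · exact closure_minimal (Set.subset_compl_iff_disjoint_right.2 disjoint_upper_lower.symm)
      isOpen_upper.isClosed_compl
  · intro z hz
    rcases mem_cases z with h | h | h
    · exact absurd h hz
    · exact subset_closure h
    · rw [← image_neg_upper, ← image_closure_of_mem (mem_moebiusGroup _)]
      induction z using OnePoint.rec with
      | infty =>
        exact ⟨_, realLine_subset_closure_upper infty_mem_realLine, affineGL_infty _ _ _⟩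
      | coe z =>
        refine ⟨((-z : ℂ) : Sphere), realLine_subset_closure_upper ?_, ?_⟩
        · rw [coe_mem_realLine] at h ⊢; simpa using h
        · rw [affineGL_coe]; simp

end IsDisc

/-- Disjoint open sets, one of which is a disc: the other one misses the closed disc. -/
lemma disjoint_closure_of_isOpen {D E : Set Sphere} (hD : IsOpen D) (h : Disjoint D E) :
    D ⊆ (closure E)ᶜ := by
  rw [Set.subset_compl_iff_disjoint_right]
  exact h.closure_right hD

/-! ### Sides of curves -/

lemma isSideOf_of_isOpen {D C : Set Sphere} (hne : D.Nonempty) (ho : IsOpen D)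
    (hc : IsPreconnected D) (hdis : Disjoint D C) (hcl : closure D ⊆ C ∪ D) : IsSideOf D C := by
  obtain ⟨x, hx⟩ := hne
  have hDC : D ⊆ Cᶜ := Set.subset_compl_iff_disjoint_right.2 hdis
  refine ⟨x, hDC hx, Set.Subset.antisymm (hc.subset_connectedComponentIn hx hDC) ?_⟩
  have hpre : IsPreconnected (connectedComponentIn Cᶜ x) := isPreconnected_connectedComponentIn
  have hsub : connectedComponentIn Cᶜ x ⊆ D ∪ (closure D)ᶜ := by
    intro z hz
    by_cases h : z ∈ closure D
    · rcases hcl h with h' | h'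
      · exact absurd h' (connectedComponentIn_subset _ _ hz)
      · exact Or.inl h'
    · exact Or.inr h
  refine hpre.subset_left_of_subset_union ho isClosed_closure.isOpen_compl ?_ hsub
    ⟨x, mem_connectedComponentIn (hDC hx), hx⟩
  exact Set.disjoint_compl_right_iff_subset.2 subset_closure

lemma IsDisc.isSideOf {D : Set Sphere} (h : IsDisc D) : IsSideOf D (frontier D) := by
  refine isSideOf_of_isOpen h.nonempty h.isOpen h.isPreconnected ?_ ?_
  · rw [h.isOpen.frontier_eq]
    exact Set.disjoint_sdiff_right
  · rw [h.isOpen.frontier_eq]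
    intro z hz
    by_cases h : z ∈ D
    · exact Or.inr h
    · exact Or.inl ⟨hz, h⟩

lemma IsCircle.exists_image {C : Set Sphere} (hC : IsCircle C) :
    ∃ f ∈ moebiusGroup, f '' realLine = C := by
  rcases hC with ⟨c, r, hr, rfl⟩ | ⟨p, v, hv, rfl⟩
  · have hr' : (r : ℂ) ≠ 0 := by exact_mod_cast hr.ne'
    have hdet : (c + r) * Complex.I - (c * Complex.I - r * Complex.I) * 1 ≠ 0 := by
      have : (c + r) * Complex.I - (c * Complex.I - r * Complex.I) * 1 = 2 * r * Complex.I := by ring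
      rw [this]
      exact mul_ne_zero (mul_ne_zero two_ne_zero hr') Complex.I_ne_zero
    refine ⟨_, mem_moebiusGroup (glMk (c + r) (c * Complex.I - r * Complex.I) 1 Complex.I hdet), ?_⟩
    have hne : ∀ z : ℂ, z.im = 0 → z + Complex.I ≠ 0 := by
      intro z hz h
      have := congrArg Complex.im h
      simp [hz] at this
    ext w
    constructor
    · rintro ⟨z, hz, rfl⟩
      induction z using OnePoint.rec with
      | infty =>
        rw [glMk_infty]
        exact ⟨c + r, by simp [hr.le], by simp⟩
      | coe z =>
        rw [coe_mem_realLine] at hz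
        rw [glMk_coe, one_mul, if_neg (hne z hz)]
        refine ⟨_, ?_, rfl⟩
        have e : ((c + r) * z + (c * Complex.I - r * Complex.I)) / (z + Complex.I) - c =
            r * ((z - Complex.I) / (z + Complex.I)) := by
          have := hne z hz
          field_simp
          ring
        rw [mem_sphere_iff_norm, e, norm_mul, norm_div]
        have e2 : ‖z - Complex.I‖ = ‖z + Complex.I‖ := by
          rw [← Complex.norm_conj (z + Complex.I)]
          congr 1
          rw [map_add, Complex.conj_I, Complex.conj_eq_iff_im.2 hz]; rfl
        rw [e2, div_self (by simpa using hne z hz)]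
        simp [hr.le]
    · rintro ⟨w, hw, rfl⟩
      rw [mem_sphere_iff_norm] at hw
      by_cases h1 : w = c + r
      · refine ⟨OnePoint.infty, infty_mem_realLine, ?_⟩
        rw [glMk_infty]; simp [h1]
      · have h1' : c + r - w ≠ 0 := fun h => h1 (by linear_combination -h)
        refine ⟨((Complex.I * (w - c + r) / (c + r - w) : ℂ) : Sphere), ?_, ?_⟩
        · rw [coe_mem_realLine]
          obtain ⟨x, y⟩ := w
          obtain ⟨p, q⟩ := c
          have hw2 : (x - p) ^ 2 + (y - q) ^ 2 = r ^ 2 := by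
            rw [← hw, ← Complex.normSq_eq_norm_sq, Complex.normSq_apply]
            simp; ring
          rw [Complex.div_im]
          have hn : Complex.normSq ({ re := p, im := q } + (r : ℂ) - { re := x, im := y }) ≠ 0 := by
            simpa using h1'
          rw [← sub_div, div_eq_zero_iff]
          left
          simp
          nlinarith [hw2]
        · rw [glMk_coe, one_mul]
          have e : Complex.I * (w - c + r) / (c + r - w) + Complex.I =
              2 * r * Complex.I / (c + r - w) := by
            field_simp
            ring
          rw [if_neg (by
            rw [e]
            exact div_ne_zero (mul_ne_zero (mul_ne_zero two_ne_zero hr') Complex.I_ne_zero) h1'), e]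
          congr 1
          have := Complex.I_ne_zero
          field_simp
          ring
  · refine ⟨_, mem_moebiusGroup (affineGL v p hv), ?_⟩
    rw [realLine, Set.image_insert_eq, affineGL_infty]
    congr 1
    ext w
    constructor
    · rintro ⟨_, ⟨z, hz, rfl⟩, rfl⟩
      refine ⟨z.re, ?_⟩
      have : z = (z.re : ℂ) := Complex.ext rfl (by simpa using hz)
      rw [affineGL_coe]
      simp only
      rw [← this, mul_comm, add_comm]
    · rintro ⟨t, rfl⟩
      refine ⟨_, ⟨(t : ℂ), by simp, rfl⟩, ?_⟩
      rw [affineGL_coe]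
      congr 1; ring

/-- The sides of a circle are discs. -/
lemma IsSideOf.isDisc {D C : Set Sphere} (h : IsSideOf D C) (hC : IsCircle C) :
    IsDisc D ∧ frontier D = C := by
  obtain ⟨f, hf, rfl⟩ := hC.exists_image
  have hup : IsDisc (f '' upper) ∧ frontier (f '' upper) = f '' realLine :=
    ⟨⟨f, hf, rfl⟩, by rw [← image_frontier_of_mem hf, frontier_upper]⟩
  have hlow : IsDisc (f '' lower) ∧ frontier (f '' lower) = f '' realLine := by
    have hl : lower = (closure upper)ᶜ := by rw [closure_upper, compl_compl]
    have hd : IsDisc upper := ⟨1, one_mem _, by simp⟩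
    refine ⟨IsDisc.image (hl ▸ hd.compl_closure) hf, ?_⟩
    rw [← image_frontier_of_mem hf, hl, hd.compl_closure.isOpen.frontier_eq,
      hd.closure_compl_closure, ← frontier_upper, hd.isOpen.frontier_eq]
    congr 1
    ext z
    simp [and_comm]
  have key : ∀ {E : Set Sphere} {x : Sphere}, IsDisc E → frontier E = f '' realLine → x ∈ E →
      connectedComponentIn (f '' realLine)ᶜ x = E := by
    intro E x hE hfr hx
    obtain ⟨y, hy, rfl⟩ := hfr ▸ hE.isSideOf
    exact (connectedComponentIn_eq hx).symm
  obtain ⟨x, hx, rfl⟩ := h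
  rcases mem_cases (f.symm x) with h | h | h
  · have hx' : x ∈ f '' upper := ⟨_, h, by simp⟩
    rwa [key hup.1 hup.2 hx']
  · have hx' : x ∈ f '' lower := ⟨_, h, by simp⟩
    rwa [key hlow.1 hlow.2 hx']
  · exact absurd ⟨_, h, by simp⟩ hx

/-! ### Jordan curves and marked T-Schottky groups -/

lemma image_eq_of_mem_iff {X : Type*} (f : Equiv.Perm X) {A B : Set X}
    (h : ∀ z, f z ∈ B ↔ z ∈ A) : f '' A = B := by
  ext w
  constructor
  · rintro ⟨z, hz, rfl⟩
    exact (h z).2 hz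
  · intro hw
    refine ⟨f.symm w, (h _).1 (by simpa using hw), by simp⟩

lemma IsJordanCurve.image {C : Set Sphere} (h : IsJordanCurve C) (f : Sphere ≃ₜ Sphere) :
    IsJordanCurve (f '' C) := by
  obtain ⟨k, hk, hi, rfl⟩ := h
  exact ⟨f ∘ k, f.continuous.comp hk, f.injective.comp hi, Set.range_comp _ _⟩

lemma IsSideOf.image {D C : Set Sphere} (h : IsSideOf D C) (f : Sphere ≃ₜ Sphere) :
    IsSideOf (f '' D) (f '' C) := by
  obtain ⟨x, hx, rfl⟩ := h
  refine ⟨f x, by simpa using hx, ?_⟩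
  rw [f.image_connectedComponentIn hx, Set.image_compl_eq f.bijective]

lemma image_exteriorOf {X : Type*} (f : X ≃ X) (C D : Set X) :
    f '' (C ∪ D)ᶜ = (f '' C ∪ f '' D)ᶜ := by
  rw [Set.image_compl_eq f.bijective, Set.image_union]

lemma IsPairing.conj {n : ℕ} {C D : Fin n ⊕ Fin n → Set Sphere} {g : Fin n → Equiv.Perm Sphere}
    (h : IsPairing C D g) {f : Equiv.Perm Sphere} (hf : f ∈ moebiusGroup) :
    IsPairing (fun j => f '' C j) (fun j => f '' D j) (fun i => f * g i * f⁻¹) where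
  isSideOf j := (h.isSideOf j).image (toHomeo f hf)
  disjoint j k hjk := (Set.disjoint_image_iff f.injective).2 (h.disjoint j k hjk)
  mem_moebiusGroup i := mul_mem (mul_mem hf (h.mem_moebiusGroup i)) (inv_mem hf)
  image_exterior i := by
    have := h.image_exterior i
    unfold exteriorOf at *
    rw [← image_exteriorOf f, ← this]
    rw [← Set.image_comp, ← Set.image_comp]
    congr 1
    funext z
    simp

lemma IsMarkedTSchottky.conj {n : ℕ} {g : Fin n → Equiv.Perm Sphere} (h : IsMarkedTSchottky g)
    {f : Equiv.Perm Sphere} (hf : f ∈ moebiusGroup) :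
    IsMarkedTSchottky (fun i => f * g i * f⁻¹) := by
  obtain ⟨C, D, h1, h2, h3⟩ := h
  refine ⟨_, _, fun j => (h1 j).image (toHomeo f hf), fun j k hjk => ?_, h3.conj hf⟩
  rw [coe_toHomeo, ← Set.image_inter f.injective]
  exact (h2 j k hjk).image _

lemma isJordanCurve_sphere (c : ℂ) {r : ℝ} (hr : 0 < r) :
    IsJordanCurve ((fun z : ℂ => (z : Sphere)) '' Metric.sphere c r) := by
  have hr' : (r : ℂ) ≠ 0 := by exact_mod_cast hr.ne'
  refine ⟨fun z => ((c + r * z : ℂ) : Sphere), ?_, ?_, ?_⟩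
  · exact OnePoint.continuous_coe.comp (by fun_prop)
  · intro z w h
    have h1 : c + r * (z : ℂ) = c + r * w := OnePoint.coe_injective h
    exact Circle.coe_injective (mul_left_cancel₀ hr' (add_left_cancel h1))
  · ext w
    constructor
    · rintro ⟨z, rfl⟩
      exact ⟨_, by simp [abs_of_pos hr, show ‖(z : ℂ)‖ = 1 from Circle.norm_coe z], rfl⟩
    · rintro ⟨z, hz, rfl⟩
      rw [mem_sphere_iff_norm] at hz
      refine ⟨⟨(z - c) / r, ?_⟩, ?_⟩
      · change (z - c) / r ∈ Metric.sphere (0 : ℂ) 1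
        rw [mem_sphere_zero_iff_norm, norm_div, hz]
        simp [hr.ne', abs_of_pos hr]
      · simp only
        congr 1
        field_simp
        ring

lemma isJordanCurve_realLine : IsJordanCurve realLine := by
  obtain ⟨f, hf, h⟩ := IsCircle.exists_image (C := (fun z : ℂ => (z : Sphere)) '' Metric.sphere 0 1)
    (Or.inl ⟨0, 1, one_pos, rfl⟩)
  have := (isJordanCurve_sphere 0 one_pos).image (toHomeo f hf).symm
  rw [← h] at this
  convert this
  ext z
  simp [toHomeo]

lemma isSideOf_ball (c : ℂ) {r : ℝ} (hr : 0 < r) :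
    IsSideOf ((fun z : ℂ => (z : Sphere)) '' Metric.ball c r)
      ((fun z : ℂ => (z : Sphere)) '' Metric.sphere c r) := by
  refine isSideOf_of_isOpen ((Metric.nonempty_ball.2 hr).image _)
    (OnePoint.isOpen_image_coe.2 Metric.isOpen_ball)
    ((convex_ball c r).isPreconnected.image _ OnePoint.continuous_coe.continuousOn) ?_ ?_
  · rw [Set.disjoint_image_iff OnePoint.coe_injective]
    exact Metric.sphere_disjoint_ball.symm
  · rw [← Set.image_union, Set.union_comm, Metric.ball_union_sphere]
    refine closure_minimal (Set.image_mono Metric.ball_subset_closedBall) ?_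
    exact ((isCompact_closedBall c r).image OnePoint.continuous_coe).isClosed

/-- The translation `z ↦ z + t`. -/
def transl (t : ℂ) : Equiv.Perm Sphere := moebius (affineGL 1 t one_ne_zero)

/-- The parabolic transformation with fixed point `0` that adds `s` to `1 / z`. -/
def coTransl (s : ℂ) : Equiv.Perm Sphere := moebius (glMk 1 0 s 1 (by simp))

lemma transl_infty (t : ℂ) : transl t OnePoint.infty = OnePoint.infty := affineGL_infty _ _ _

lemma transl_coe (t z : ℂ) : transl t (z : Sphere) = ((z + t : ℂ) : Sphere) := by
  rw [transl, affineGL_coe, one_mul]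

/-! ### The bisector curve -/

section Bisector

variable (m : ℂ)

/-- Half the excess of `2 |z - p| ^ 2` over `2 |z - q| ^ 2`, where `p` is the point of `{1, -1}` and
`q` the point of `{2 m + 1, 2 m - 1}` closest to `z`. -/
def bisectorFun (z : ℂ) : ℝ :=
  2 * m.im * z.im + 2 * m.re * z.re - 2 * (m.re ^ 2 + m.im ^ 2) + |z.re - 2 * m.re| - |z.re|

lemma bisectorFun_reflect (z : ℂ) : bisectorFun m (2 * m - z) = -bisectorFun m z := by
  have h2 : |2 * m.re - z.re| = |z.re - 2 * m.re| := abs_sub_comm _ _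
  simp [bisectorFun, h2]
  ring

/-- The homeomorphism of the plane that straightens the bisector. -/
def bisectorHomeo (hm : 0 < m.im) : ℂ ≃ₜ ℂ where
  toFun z := ⟨z.re, bisectorFun m z⟩
  invFun w := ⟨w.re, (w.im - (2 * m.re * w.re - 2 * (m.re ^ 2 + m.im ^ 2) +
    |w.re - 2 * m.re| - |w.re|)) / (2 * m.im)⟩
  left_inv z := by
    apply Complex.ext
    · rfl
    · simp only [bisectorFun]
      field_simp
      ring
  right_inv z := by
    apply Complex.ext
    · rfl
    · simp only [bisectorFun]
      field_simp
      ring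
  continuous_toFun := by
    have : (fun z : ℂ => (⟨z.re, bisectorFun m z⟩ : ℂ)) =
        fun z : ℂ => (z.re : ℂ) + (bisectorFun m z : ℝ) * Complex.I := by
      funext z
      exact Complex.mk_eq_add_mul_I _ _
    rw [this]
    unfold bisectorFun
    fun_prop
  continuous_invFun := by
    have : (fun w : ℂ => (⟨w.re, (w.im - (2 * m.re * w.re - 2 * (m.re ^ 2 + m.im ^ 2) +
        |w.re - 2 * m.re| - |w.re|)) / (2 * m.im)⟩ : ℂ)) =
        fun w : ℂ => (w.re : ℂ) + ((w.im - (2 * m.re * w.re - 2 * (m.re ^ 2 + m.im ^ 2) +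
        |w.re - 2 * m.re| - |w.re|)) / (2 * m.im) : ℝ) * Complex.I := by
      funext z
      exact Complex.mk_eq_add_mul_I _ _
    rw [this]
    fun_prop

/-- The bisector of `{1, -1}` and `{2 m + 1, 2 m - 1}`, together with `∞`. -/
def bisector : Set Sphere := insert OnePoint.infty ((↑) '' {z : ℂ | bisectorFun m z = 0})

/-- The points closer to `{2 m + 1, 2 m - 1}` than to `{1, -1}`. -/
def aboveBisector : Set Sphere := (↑) '' {z : ℂ | 0 < bisectorFun m z}

variable {m}

lemma coe_mem_bisector {z : ℂ} : (z : Sphere) ∈ bisector m ↔ bisectorFun m z = 0 := by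
  simp [bisector]

lemma coe_mem_aboveBisector {z : ℂ} : (z : Sphere) ∈ aboveBisector m ↔ 0 < bisectorFun m z := by
  simp [aboveBisector]

lemma infty_mem_bisector : OnePoint.infty ∈ bisector m := by simp [bisector]

lemma infty_notMem_aboveBisector : OnePoint.infty ∉ aboveBisector m := by simp [aboveBisector]

lemma bisector_eq_image (hm : 0 < m.im) :
    bisector m = (bisectorHomeo m hm).onePointCongr.symm '' realLine := by
  ext z
  rw [Homeomorph.image_symm, Set.mem_preimage]
  induction z using OnePoint.rec with
  | infty => simp only [infty_mem_bisector, true_iff]; exact infty_mem_realLine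
  | coe z => rw [coe_mem_bisector]; exact (coe_mem_realLine (z := bisectorHomeo m hm z)).symm

lemma aboveBisector_eq_image (hm : 0 < m.im) :
    aboveBisector m = (bisectorHomeo m hm).onePointCongr.symm '' upper := by
  ext z
  rw [Homeomorph.image_symm, Set.mem_preimage]
  induction z using OnePoint.rec with
  | infty => simp only [infty_notMem_aboveBisector, false_iff]; exact infty_notMem_upper
  | coe z => rw [coe_mem_aboveBisector]; exact (coe_mem_upper (z := bisectorHomeo m hm z)).symm

lemma isJordanCurve_bisector (hm : 0 < m.im) : IsJordanCurve (bisector m) := by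
  rw [bisector_eq_image hm]
  exact isJordanCurve_realLine.image _

lemma isSideOf_bisector (hm : 0 < m.im) : IsSideOf (aboveBisector m) (bisector m) := by
  rw [bisector_eq_image hm, aboveBisector_eq_image hm]
  refine IsSideOf.image ?_ _
  rw [← frontier_upper]
  exact IsDisc.isSideOf ⟨1, one_mem _, by simp⟩

/-- The points near `±1` are below the bisector, with at most three exceptions on it. -/
lemma bisectorFun_neg_or (h0 : 0 ≤ m.re) (h1 : 1 ≤ m.re ^ 2 + m.im ^ 2)
    (h2 : 1 ≤ (m.re - 1) ^ 2 + m.im ^ 2) {z : ℂ} {e : ℝ} (he : e = 1 ∨ e = -1)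
    (hz : (z.re - e) ^ 2 + z.im ^ 2 ≤ 1) :
    bisectorFun m z < 0 ∨ (z ∈ ({m, m + 1, m - 1} : Set ℂ) ∧ (z.re - e) ^ 2 + z.im ^ 2 = 1 ∧
      bisectorFun m z = 0) := by
  by_cases hneg : bisectorFun m z < 0
  · exact Or.inl hneg
  right
  rw [not_lt] at hneg
  obtain ⟨e', he', hab⟩ : ∃ e' : ℝ, (e' = 1 ∨ e' = -1) ∧ |z.re - 2 * m.re| = e' * (z.re - 2 * m.re) := by
    rcases abs_cases (z.re - 2 * m.re) with h | h
    · exact ⟨1, Or.inl rfl, by linarith⟩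
    · exact ⟨-1, Or.inr rfl, by linarith⟩
  have hz1 : e * z.re ≤ |z.re| := by
    rcases he with rfl | rfl
    · simpa using le_abs_self z.re
    · simpa using neg_le_abs z.re
  have he2 : e ^ 2 = 1 := by rcases he with rfl | rfl <;> norm_num
  have he2' : e' ^ 2 = 1 := by rcases he' with rfl | rfl <;> norm_num
  have hdist : 4 ≤ (2 * m.re + e' - e) ^ 2 + (2 * m.im) ^ 2 := by
    rcases he with rfl | rfl <;> rcases he' with rfl | rfl <;> nlinarith
  have hq : (z.re - 2 * m.re - e') ^ 2 + (z.im - 2 * m.im) ^ 2 =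
      (z.re - e) ^ 2 + z.im ^ 2 - 2 * bisectorFun m z - 2 * (|z.re| - e * z.re) := by
    unfold bisectorFun
    rw [hab]
    linear_combination he2' - he2
  have hpar : (2 * z.re - (2 * m.re + e' + e)) ^ 2 + (2 * z.im - 2 * m.im) ^ 2 =
      2 * ((z.re - e) ^ 2 + z.im ^ 2) + 2 * ((z.re - 2 * m.re - e') ^ 2 + (z.im - 2 * m.im) ^ 2) -
      ((2 * m.re + e' - e) ^ 2 + (2 * m.im) ^ 2) := by ring
  have hre : 2 * z.re - (2 * m.re + e' + e) = 0 := by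
    apply pow_eq_zero_iff (two_ne_zero) |>.1
    nlinarith [sq_nonneg (2 * z.re - (2 * m.re + e' + e)), sq_nonneg (2 * z.im - 2 * m.im)]
  have him : 2 * z.im - 2 * m.im = 0 := by
    apply pow_eq_zero_iff (two_ne_zero) |>.1
    nlinarith [sq_nonneg (2 * z.re - (2 * m.re + e' + e)), sq_nonneg (2 * z.im - 2 * m.im)]
  rw [hre, him] at hpar
  refine ⟨?_, by linarith, by linarith⟩
  rcases he with rfl | rfl <;> rcases he' with rfl | rfl
  · right; left
    apply Complex.ext <;> simp <;> linarith
  · left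
    apply Complex.ext <;> linarith
  · left
    apply Complex.ext <;> linarith
  · right; right
    apply Complex.ext <;> simp <;> linarith

lemma bisectorFun_add_neg (h0 : 0 ≤ m.re) (h1 : 1 ≤ m.re ^ 2 + m.im ^ 2)
    (h2 : 1 ≤ (m.re - 1) ^ 2 + m.im ^ 2) (z : ℂ) : bisectorFun m z + bisectorFun m (-z) < 0 := by
  have e1 : |z.re - 2 * m.re| ≤ |z.re| + 2 * m.re := by
    have := abs_sub z.re (2 * m.re)
    rwa [abs_of_nonneg (by linarith : 0 ≤ 2 * m.re)] at this
  have e2 : |-z.re - 2 * m.re| ≤ |z.re| + 2 * m.re := by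
    have := abs_sub (-z.re) (2 * m.re)
    rwa [abs_of_nonneg (by linarith : 0 ≤ 2 * m.re), abs_neg] at this
  simp only [bisectorFun, Complex.neg_re, Complex.neg_im, abs_neg]
  nlinarith

end Bisector

lemma mem_ball_iff {z c : ℂ} {r : ℝ} (hr : 0 ≤ r) :
    z ∈ Metric.ball c r ↔ (z.re - c.re) ^ 2 + (z.im - c.im) ^ 2 < r ^ 2 := by
  rw [mem_ball_iff_norm, ← sq_lt_sq₀ (norm_nonneg _) hr, ← Complex.normSq_eq_norm_sq,
    Complex.normSq_apply]
  simp [sq]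

lemma mem_sphere_iff' {z c : ℂ} {r : ℝ} (hr : 0 ≤ r) :
    z ∈ Metric.sphere c r ↔ (z.re - c.re) ^ 2 + (z.im - c.im) ^ 2 = r ^ 2 := by
  rw [mem_sphere_iff_norm, ← sq_eq_sq₀ (norm_nonneg _) hr, ← Complex.normSq_eq_norm_sq,
    Complex.normSq_apply]
  simp [sq]

section Pairing

variable {m σ : ℂ}

/-- The curves for the pair `transl (2 * m)`, `coTransl σ`. -/
def hexCurve (m σ : ℂ) : Fin 2 ⊕ Fin 2 → Set Sphere
  | Sum.inl 0 => moebius (affineGL (-1) 0 (by simp)) '' bisector m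
  | Sum.inr 0 => bisector m
  | Sum.inl 1 => (fun z : ℂ => (z : Sphere)) '' Metric.sphere (-1) 1
  | Sum.inr 1 => (fun z : ℂ => (z : Sphere)) ''
      Metric.sphere (((2 * σ.re - 1)⁻¹ : ℝ) : ℂ) (2 * σ.re - 1)⁻¹

/-- The interiors of the curves for the pair `transl (2 * m)`, `coTransl σ`. -/
def hexSide (m σ : ℂ) : Fin 2 ⊕ Fin 2 → Set Sphere
  | Sum.inl 0 => moebius (affineGL (-1) 0 (by simp)) '' aboveBisector m
  | Sum.inr 0 => aboveBisector m
  | Sum.inl 1 => (fun z : ℂ => (z : Sphere)) '' Metric.ball (-1) 1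
  | Sum.inr 1 => (fun z : ℂ => (z : Sphere)) ''
      Metric.ball (((2 * σ.re - 1)⁻¹ : ℝ) : ℂ) (2 * σ.re - 1)⁻¹

lemma mem_image_neg_iff {A : Set Sphere} {z : ℂ} :
    (z : Sphere) ∈ moebius (affineGL (-1) 0 (by simp)) '' A ↔ ((-z : ℂ) : Sphere) ∈ A := by
  constructor
  · rintro ⟨w, hw, h⟩
    induction w using OnePoint.rec with
    | infty => rw [affineGL_infty] at h; exact absurd h (OnePoint.infty_ne_coe _)
    | coe w =>
      rw [affineGL_coe] at h
      have h' := OnePoint.coe_injective h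
      rw [← h']
      simpa using hw
  · intro h
    exact ⟨_, h, by rw [affineGL_coe]; simp⟩

lemma infty_mem_image_neg_iff {A : Set Sphere} :
    OnePoint.infty ∈ moebius (affineGL (-1) 0 (by simp)) '' A ↔ OnePoint.infty ∈ A := by
  constructor
  · rintro ⟨w, hw, h⟩
    induction w using OnePoint.rec with
    | infty => exact hw
    | coe w => rw [affineGL_coe] at h; exact absurd h (OnePoint.coe_ne_infty _)
  · intro h
    exact ⟨_, h, affineGL_infty _ _ _⟩

lemma smallBall_sub {r : ℝ} (h0 : 0 < r) (h1 : r ≤ 1) {z : ℂ}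
    (h : (z.re - r) ^ 2 + z.im ^ 2 ≤ r ^ 2) : (z.re - 1) ^ 2 + z.im ^ 2 ≤ 1 := by
  have : 0 ≤ z.re := by nlinarith [sq_nonneg z.re, sq_nonneg z.im]
  nlinarith

lemma smallBall_sub_lt {r : ℝ} (h0 : 0 < r) (h1 : r ≤ 1) {z : ℂ}
    (h : (z.re - r) ^ 2 + z.im ^ 2 < r ^ 2) : (z.re - 1) ^ 2 + z.im ^ 2 < 1 := by
  have : 0 ≤ z.re := by nlinarith [sq_nonneg z.re, sq_nonneg z.im]
  nlinarith

lemma image_transl_hex : transl (2 * m) ''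
    exteriorOf (hexCurve m σ (Sum.inl 0)) (hexSide m σ (Sum.inl 0)) = hexSide m σ (Sum.inr 0) := by
  apply image_eq_of_mem_iff
  intro z
  induction z using OnePoint.rec with
  | infty =>
    simp only [transl_infty, exteriorOf, hexCurve, hexSide, Set.mem_compl_iff, Set.mem_union,
      infty_mem_image_neg_iff, infty_notMem_aboveBisector, infty_mem_bisector]
    simp
  | coe z =>
    have h := bisectorFun_reflect m (-z)
    rw [show 2 * m - -z = z + 2 * m by ring] at h
    simp only [transl_coe, exteriorOf, hexCurve, hexSide, Set.mem_compl_iff, Set.mem_union,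
      mem_image_neg_iff, coe_mem_aboveBisector, coe_mem_bisector, h]
    constructor
    · rintro h1 (h2 | h2) <;> linarith
    · intro h1
      push Not at h1
      have := lt_of_le_of_ne h1.2 h1.1
      linarith

lemma coTransl_infty (s : ℂ) : coTransl s OnePoint.infty =
    if s = 0 then OnePoint.infty else ((s⁻¹ : ℂ) : Sphere) := by
  rw [coTransl, glMk_infty]; simp

lemma coTransl_coe (s z : ℂ) : coTransl s (z : Sphere) =
    if s * z + 1 = 0 then OnePoint.infty else ((z / (s * z + 1) : ℂ) : Sphere) := by
  rw [coTransl, glMk_coe]; simp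

lemma coe_mem_image_ball {z c : ℂ} {r : ℝ} (hr : 0 ≤ r) :
    (z : Sphere) ∈ (fun z : ℂ => (z : Sphere)) '' Metric.ball c r ↔
      (z.re - c.re) ^ 2 + (z.im - c.im) ^ 2 < r ^ 2 := by
  rw [← mem_ball_iff hr]; simp

lemma coe_mem_image_sphere {z c : ℂ} {r : ℝ} (hr : 0 ≤ r) :
    (z : Sphere) ∈ (fun z : ℂ => (z : Sphere)) '' Metric.sphere c r ↔
      (z.re - c.re) ^ 2 + (z.im - c.im) ^ 2 = r ^ 2 := by
  rw [← mem_sphere_iff' hr]; simp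

lemma mem_smallBall_iff {s : ℝ} (hs : 0 < s) {z w : ℂ} (hw : w ≠ 0) :
    ((z / w : ℂ) : Sphere) ∈ (fun z : ℂ => (z : Sphere)) '' Metric.ball ((s⁻¹ : ℝ) : ℂ) s⁻¹ ↔
      s * Complex.normSq z < 2 * (z.re * w.re + z.im * w.im) := by
  rw [coe_mem_image_ball (by positivity)]
  have hw' : 0 < Complex.normSq w := Complex.normSq_pos.2 hw
  have e1 : ((z / w).re - ((s⁻¹ : ℝ) : ℂ).re) ^ 2 + ((z / w).im - ((s⁻¹ : ℝ) : ℂ).im) ^ 2 - s⁻¹ ^ 2 =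
      Complex.normSq (z / w) - 2 * s⁻¹ * (z / w).re := by
    rw [Complex.normSq_apply]
    simp
    ring
  have e2 : Complex.normSq (z / w) - 2 * s⁻¹ * (z / w).re =
      (s * Complex.normSq z - 2 * (z.re * w.re + z.im * w.im)) / (s * Complex.normSq w) := by
    rw [Complex.normSq_div, Complex.div_re]
    field_simp
  rw [← sub_neg, e1, e2, div_neg_iff]
  have : 0 < s * Complex.normSq w := by positivity
  constructor
  · rintro (⟨_, h⟩ | ⟨h, _⟩) <;> linarith
  · intro h
    exact Or.inr ⟨by linarith, this⟩

lemma image_coTransl_hex (hσ : 1 ≤ σ.re) : coTransl σ ''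
    exteriorOf (hexCurve m σ (Sum.inl 1)) (hexSide m σ (Sum.inl 1)) = hexSide m σ (Sum.inr 1) := by
  have hs : 0 < 2 * σ.re - 1 := by linarith
  have hσ0 : σ ≠ 0 := by rintro rfl; norm_num at hσ
  apply image_eq_of_mem_iff
  intro z
  induction z using OnePoint.rec with
  | infty =>
    rw [coTransl_infty, if_neg hσ0, inv_eq_one_div]
    simp only [exteriorOf, hexCurve, hexSide]
    rw [mem_smallBall_iff hs hσ0]
    simp
  | coe z =>
    simp only [exteriorOf, hexCurve, hexSide, Set.mem_compl_iff, Set.mem_union]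
    rw [coe_mem_image_ball zero_le_one, coe_mem_image_sphere zero_le_one, coTransl_coe]
    split_ifs with h
    · have h1 := congrArg Complex.re h
      have h2 := congrArg Complex.im h
      simp at h1 h2
      simp only [Set.mem_image, OnePoint.coe_ne_infty, and_false, exists_false, false_iff, not_not]
      right
      simp
      have h3 : σ.re * (z.re ^ 2 + z.im ^ 2) = -z.re := by
        linear_combination z.re * h1 + z.im * h2
      have h4 : 0 < z.re ^ 2 + z.im ^ 2 := by
        rcases eq_or_ne z 0 with rfl | hz
        · simp at h1
        · have := Complex.normSq_pos.2 hz
          rw [Complex.normSq_apply] at this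
          linarith
      nlinarith
    · rw [mem_smallBall_iff hs h]
      simp [Complex.normSq_apply]
      constructor
      · intro h1
        constructor <;> nlinarith
      · rintro ⟨h1, h2⟩
        have := lt_of_le_of_ne h2 (Ne.symm h1)
        nlinarith

lemma isMarkedTSchottky_hex (hm : 0 < m.im) (h0 : 0 ≤ m.re) (h1 : 1 ≤ m.re ^ 2 + m.im ^ 2)
    (h2 : 1 ≤ (m.re - 1) ^ 2 + m.im ^ 2) (hσ : 1 ≤ σ.re) :
    IsMarkedTSchottky ![transl (2 * m), coTransl σ] := by
  have hs : 0 < 2 * σ.re - 1 := by linarith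
  have hr : 0 < (2 * σ.re - 1)⁻¹ := inv_pos.2 hs
  have hr1 : (2 * σ.re - 1)⁻¹ ≤ 1 := inv_le_one_of_one_le₀ (by linarith)
  have fin3 : ((fun z : ℂ => (z : Sphere)) '' {m, m + 1, m - 1}).Finite := (by simp : Set.Finite _).image _
  have fin3' : ((fun z : ℂ => (z : Sphere)) '' {-m, -(m + 1), -(m - 1)}).Finite :=
    (by simp : Set.Finite _).image _
  have negmem : ∀ z : ℂ, -z ∈ ({m, m + 1, m - 1} : Set ℂ) → z ∈ ({-m, -(m + 1), -(m - 1)} : Set ℂ) := by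
    intro z hz
    simp only [Set.mem_insert_iff, Set.mem_singleton_iff, neg_eq_iff_eq_neg] at hz ⊢
    exact hz
  refine ⟨hexCurve m σ, hexSide m σ, ?_, ?_, ?_, ?_, ?_, ?_⟩
  · rintro (j | j) <;> fin_cases j
    · exact (isJordanCurve_bisector hm).image (toHomeo _ (mem_moebiusGroup _))
    · exact isJordanCurve_sphere _ one_pos
    · exact isJordanCurve_bisector hm
    · exact isJordanCurve_sphere _ hr
  · have key : ∀ j k : Fin 2 ⊕ Fin 2, (hexCurve m σ j ∩ hexCurve m σ k).Finite →
        (hexCurve m σ k ∩ hexCurve m σ j).Finite := fun j k h => by rwa [Set.inter_comm]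
    have a01 : (hexCurve m σ (Sum.inl 0) ∩ hexCurve m σ (Sum.inr 0)).Finite := by
      refine (Set.finite_singleton OnePoint.infty).subset ?_
      rintro z ⟨hz1, hz2⟩
      induction z using OnePoint.rec with
      | infty => rfl
      | coe z =>
        simp only [hexCurve, mem_image_neg_iff, coe_mem_bisector] at hz1 hz2
        linarith [bisectorFun_add_neg h0 h1 h2 z]
    have a11 : (hexCurve m σ (Sum.inl 1) ∩ hexCurve m σ (Sum.inr 1)).Finite := by
      refine (Set.finite_singleton ((0 : ℂ) : Sphere)).subset ?_
      rintro _ ⟨⟨z, hz1, rfl⟩, hz2⟩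
      simp only [hexCurve] at hz2
      rw [coe_mem_image_sphere hr.le] at hz2
      rw [mem_sphere_iff' zero_le_one] at hz1
      simp at hz1
      simp only [Complex.ofReal_re, Complex.ofReal_im, sub_zero] at hz2
      have hb := smallBall_sub hr hr1 hz2.le
      have hre : z.im ^ 2 = 0 := by nlinarith [sq_nonneg z.re, sq_nonneg z.im]
      have hre' : z.re = 0 := by nlinarith [sq_nonneg z.re, sq_nonneg z.im]
      have : z = 0 := Complex.ext hre' (by simpa using hre)
      rw [this]; rfl
    have b1 : ∀ {z : ℂ} {e : ℝ}, (e = 1 ∨ e = -1) → (z.re - e) ^ 2 + z.im ^ 2 ≤ 1 →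
        bisectorFun m z = 0 → z ∈ ({m, m + 1, m - 1} : Set ℂ) := by
      intro z e he hz hb
      rcases bisectorFun_neg_or h0 h1 h2 he hz with h | h
      · linarith
      · exact h.1
    have b2 : ∀ {z : ℂ} {e : ℝ}, (e = 1 ∨ e = -1) → (z.re - e) ^ 2 + z.im ^ 2 ≤ 1 →
        bisectorFun m (-z) = 0 → z ∈ ({-m, -(m + 1), -(m - 1)} : Set ℂ) := by
      intro z e he hz hb
      refine negmem z (b1 (e := -e) (by rcases he with rfl | rfl <;> simp) ?_ hb)
      simp
      nlinarith
    have a2 : (hexCurve m σ (Sum.inl 1) ∩ hexCurve m σ (Sum.inr 0)).Finite := by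
      refine fin3.subset ?_
      rintro _ ⟨⟨z, hz1, rfl⟩, hz2⟩
      rw [mem_sphere_iff' zero_le_one] at hz1
      refine ⟨z, b1 (Or.inr rfl) (by simpa using hz1.le) (coe_mem_bisector.1 hz2), rfl⟩
    have a3 : (hexCurve m σ (Sum.inr 1) ∩ hexCurve m σ (Sum.inr 0)).Finite := by
      refine fin3.subset ?_
      rintro _ ⟨⟨z, hz1, rfl⟩, hz2⟩
      rw [mem_sphere_iff' hr.le] at hz1
      refine ⟨z, b1 (Or.inl rfl) (smallBall_sub hr hr1 (by
        simpa only [Complex.ofReal_re, Complex.ofReal_im, sub_zero] using hz1.le))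
        (coe_mem_bisector.1 hz2), rfl⟩
    have a4 : (hexCurve m σ (Sum.inl 1) ∩ hexCurve m σ (Sum.inl 0)).Finite := by
      refine fin3'.subset ?_
      rintro _ ⟨⟨z, hz1, rfl⟩, hz2⟩
      rw [mem_sphere_iff' zero_le_one] at hz1
      refine ⟨z, b2 (Or.inr rfl) (by simpa using hz1.le)
        (coe_mem_bisector.1 (mem_image_neg_iff.1 hz2)), rfl⟩
    have a5 : (hexCurve m σ (Sum.inr 1) ∩ hexCurve m σ (Sum.inl 0)).Finite := by
      refine fin3'.subset ?_
      rintro _ ⟨⟨z, hz1, rfl⟩, hz2⟩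
      rw [mem_sphere_iff' hr.le] at hz1
      refine ⟨z, b2 (Or.inl rfl) (smallBall_sub hr hr1 (by
        simpa only [Complex.ofReal_re, Complex.ofReal_im, sub_zero] using hz1.le))
        (coe_mem_bisector.1 (mem_image_neg_iff.1 hz2)), rfl⟩
    rintro (j | j) (k | k) hjk <;> fin_cases j <;> fin_cases k <;>
      first
      | exact absurd rfl hjk
      | assumption
      | exact key _ _ (by assumption)
  · rintro (j | j) <;> fin_cases j
    · exact (isSideOf_bisector hm).image (toHomeo _ (mem_moebiusGroup _))
    · exact isSideOf_ball _ one_pos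
    · exact isSideOf_bisector hm
    · exact isSideOf_ball _ hr
  · have a01 : Disjoint (hexSide m σ (Sum.inl 0)) (hexSide m σ (Sum.inr 0)) := by
      rw [Set.disjoint_right]
      rintro _ ⟨z, hz1, rfl⟩ hz2
      simp only [hexSide, mem_image_neg_iff, coe_mem_aboveBisector] at hz2
      have : 0 < bisectorFun m z := hz1
      linarith [bisectorFun_add_neg h0 h1 h2 z]
    have a11 : Disjoint (hexSide m σ (Sum.inl 1)) (hexSide m σ (Sum.inr 1)) := by
      rw [Set.disjoint_left]
      rintro _ ⟨z, hz1, rfl⟩ hz2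
      simp only [hexSide] at hz2
      rw [coe_mem_image_ball hr.le] at hz2
      rw [mem_ball_iff zero_le_one] at hz1
      simp at hz1
      simp only [Complex.ofReal_re, Complex.ofReal_im, sub_zero] at hz2
      have hb := smallBall_sub_lt hr hr1 hz2
      nlinarith [sq_nonneg z.re, sq_nonneg z.im]
    have b1 : ∀ {z : ℂ} {e : ℝ}, (e = 1 ∨ e = -1) → (z.re - e) ^ 2 + z.im ^ 2 < 1 →
        ¬ 0 < bisectorFun m z := by
      intro z e he hz hb
      rcases bisectorFun_neg_or h0 h1 h2 he hz.le with h | h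
      · linarith
      · linarith [h.2.2]
    have b2 : ∀ {z : ℂ} {e : ℝ}, (e = 1 ∨ e = -1) → (z.re - e) ^ 2 + z.im ^ 2 < 1 →
        ¬ 0 < bisectorFun m (-z) := by
      intro z e he hz hb
      refine b1 (e := -e) (by rcases he with rfl | rfl <;> simp) ?_ hb
      simp
      nlinarith
    have a2 : Disjoint (hexSide m σ (Sum.inl 1)) (hexSide m σ (Sum.inr 0)) := by
      rw [Set.disjoint_left]
      rintro _ ⟨z, hz1, rfl⟩ hz2
      rw [mem_ball_iff zero_le_one] at hz1
      exact b1 (Or.inr rfl) (by simpa using hz1) (coe_mem_aboveBisector.1 hz2)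
    have a3 : Disjoint (hexSide m σ (Sum.inr 1)) (hexSide m σ (Sum.inr 0)) := by
      rw [Set.disjoint_left]
      rintro _ ⟨z, hz1, rfl⟩ hz2
      rw [mem_ball_iff hr.le] at hz1
      exact b1 (Or.inl rfl) (smallBall_sub_lt hr hr1 (by
        simpa only [Complex.ofReal_re, Complex.ofReal_im, sub_zero] using hz1))
        (coe_mem_aboveBisector.1 hz2)
    have a4 : Disjoint (hexSide m σ (Sum.inl 1)) (hexSide m σ (Sum.inl 0)) := by
      rw [Set.disjoint_left]
      rintro _ ⟨z, hz1, rfl⟩ hz2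
      rw [mem_ball_iff zero_le_one] at hz1
      exact b2 (Or.inr rfl) (by simpa using hz1)
        (coe_mem_aboveBisector.1 (mem_image_neg_iff.1 hz2))
    have a5 : Disjoint (hexSide m σ (Sum.inr 1)) (hexSide m σ (Sum.inl 0)) := by
      rw [Set.disjoint_left]
      rintro _ ⟨z, hz1, rfl⟩ hz2
      rw [mem_ball_iff hr.le] at hz1
      exact b2 (Or.inl rfl) (smallBall_sub_lt hr hr1 (by
        simpa only [Complex.ofReal_re, Complex.ofReal_im, sub_zero] using hz1))
        (coe_mem_aboveBisector.1 (mem_image_neg_iff.1 hz2))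
    rintro (j | j) (k | k) hjk <;> fin_cases j <;> fin_cases k <;>
      first
      | exact absurd rfl hjk
      | assumption
      | exact Disjoint.symm (by assumption)
  · intro i
    fin_cases i
    · exact mem_moebiusGroup _
    · exact mem_moebiusGroup _
  · intro i
    fin_cases i
    · exact image_transl_hex
    · exact image_coTransl_hex hσ

end Pairing

/-! ### The two-generator groups are T-Schottky -/

lemma exists_kernel_vector {N : Matrix (Fin 2) (Fin 2) ℂ} (htr : N.trace = 0) (hdet : N.det = 0)
    (hN : N ≠ 0) : ∃ a b : ℂ, (a ≠ 0 ∨ b ≠ 0) ∧ N 0 0 * a + N 0 1 * b = 0 ∧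
      N 1 0 * a + N 1 1 * b = 0 := by
  rw [Matrix.trace_fin_two] at htr
  rw [Matrix.det_fin_two] at hdet
  have h11 : N 1 1 = -N 0 0 := by linear_combination htr
  by_cases h : N 0 0 = 0 ∧ N 1 0 = 0
  · have h01 : N 0 1 ≠ 0 := by
      intro h01
      apply hN
      ext i j
      fin_cases i <;> fin_cases j <;> simp [h, h01, h11]
    exact ⟨N 0 1, N 1 1, Or.inl h01, by rw [h11, h.1]; ring, by rw [h11, h.1, h.2]; ring⟩
  · refine ⟨N 0 0, N 1 0, by tauto, ?_, ?_⟩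
    · rw [h11] at hdet; linear_combination -hdet
    · rw [h11]; ring

lemma exists_conj_normalForm (S T : SL(2, ℂ)) (hS : (S : Matrix (Fin 2) (Fin 2) ℂ).trace = 2)
    (hT : (T : Matrix (Fin 2) (Fin 2) ℂ).trace = 2) {τ σ : ℂ} (hτ : τ ≠ 0) (hσ : σ ≠ 0)
    (hw : τ * σ = ((S * T : SL(2, ℂ)) : Matrix (Fin 2) (Fin 2) ℂ).trace - 2) :
    ∃ H : GL (Fin 2) ℂ,
      moebius (T : GL (Fin 2) ℂ) = moebius H * transl τ * (moebius H)⁻¹ ∧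
      moebius (S : GL (Fin 2) ℂ) = moebius H * coTransl σ * (moebius H)⁻¹ := by
  set s : Matrix (Fin 2) (Fin 2) ℂ := S.1 with hs
  set t : Matrix (Fin 2) (Fin 2) ℂ := T.1 with ht
  have hw' : τ * σ = s 0 0 * t 0 0 + s 0 1 * t 1 0 + (s 1 0 * t 0 1 + s 1 1 * t 1 1) - 2 := by
    rw [hw, Matrix.SpecialLinearGroup.coe_mul, Matrix.trace_fin_two, Matrix.mul_apply,
      Matrix.mul_apply, Fin.sum_univ_two, Fin.sum_univ_two]
  have hsd : s 0 0 * s 1 1 - s 0 1 * s 1 0 = 1 := by rw [← Matrix.det_fin_two]; exact S.2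
  have htd : t 0 0 * t 1 1 - t 0 1 * t 1 0 = 1 := by rw [← Matrix.det_fin_two]; exact T.2
  rw [Matrix.trace_fin_two] at hS hT
  have hs1 : s 1 1 = 2 - s 0 0 := by linear_combination hS
  have ht1 : t 1 1 = 2 - t 0 0 := by linear_combination hT
  rw [hs1] at hsd hw'
  rw [ht1] at htd hw'
  have hN : s - 1 ≠ 0 := by
    intro h
    have h' : s = 1 := sub_eq_zero.1 h
    have e : τ * σ = 0 := by
      rw [hw', h']
      simp
      ring
    exact mul_ne_zero hτ hσ e
  obtain ⟨a, b, hab, h1, h2⟩ := exists_kernel_vector (N := s - 1)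
    (by simp [Matrix.trace_fin_two, hs1])
    (by simp [Matrix.det_fin_two, hs1]; linear_combination hsd) hN
  simp [hs1] at h1 h2
  set p := τ⁻¹ * ((t 0 0 - 1) * a + t 0 1 * b) with hp
  set q := τ⁻¹ * (t 1 0 * a + (1 - t 0 0) * b) with hq
  have hp' : τ * p = (t 0 0 - 1) * a + t 0 1 * b := by rw [hp]; field_simp
  have hq' : τ * q = t 1 0 * a + (1 - t 0 0) * b := by rw [hq]; field_simp
  have hT1 : t 0 0 * p + t 0 1 * q = p := by
    apply mul_left_cancel₀ hτ
    linear_combination (t 0 0 - 1) * hp' + t 0 1 * hq' - a * htd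
  have hT2 : t 1 0 * p + (2 - t 0 0) * q = q := by
    apply mul_left_cancel₀ hτ
    linear_combination t 1 0 * hp' + (1 - t 0 0) * hq' - b * htd
  have hS1 : s 0 0 * p + s 0 1 * q = p + σ * a := by
    apply mul_left_cancel₀ hτ
    linear_combination (s 0 0 - 1) * hp' + s 0 1 * hq' - a * hw' - t 0 1 * h2 - (t 0 0 - 1) * h1
  have hS2 : s 1 0 * p + (2 - s 0 0) * q = q + σ * b := by
    apply mul_left_cancel₀ hτ
    linear_combination s 1 0 * hp' + (1 - s 0 0) * hq' - b * hw' + (t 0 0 - 1) * h2 - t 1 0 * h1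
  have hdet : p * b - a * q ≠ 0 := by
    intro h
    have ha : σ * a ^ 2 = 0 := by linear_combination -a * hS1 + p * h1 - s 0 1 * h
    have hb : σ * b ^ 2 = 0 := by linear_combination -b * hS2 + q * h2 + s 1 0 * h
    rcases hab with h' | h'
    · exact mul_ne_zero hσ (pow_ne_zero 2 h') ha
    · exact mul_ne_zero hσ (pow_ne_zero 2 h') hb
  refine ⟨glMk p a q b hdet, ?_, ?_⟩
  · rw [transl, ← map_mul, ← map_inv, ← map_mul]
    congr 1
    rw [eq_mul_inv_iff_mul_eq]
    ext i j
    fin_cases i <;> fin_cases j <;>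
      simp [glMk, affineGL, Matrix.mul_apply, Fin.sum_univ_two, ← ht, ht1]
    · exact hT1
    · linear_combination -hp'
    · exact hT2
    · linear_combination -hq'
  · rw [coTransl, ← map_mul, ← map_inv, ← map_mul]
    congr 1
    rw [eq_mul_inv_iff_mul_eq]
    ext i j
    fin_cases i <;> fin_cases j <;>
      simp [glMk, Matrix.mul_apply, Fin.sum_univ_two, ← hs, hs1]
    · linear_combination hS1
    · linear_combination h1
    · linear_combination hS2
    · linear_combination h2

/-- The pairs `(transl (2 m), coTransl σ)` to which the bisector construction applies, in terms of
the product `w` of the translation lengths. -/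
lemma exists_hex_parameters {w : ℂ}
    (hw : (2 ≤ ‖w‖ ∧ Real.pi / 3 ≤ w.arg ∧ w.arg ≤ Real.pi / 2) ∨
      (2 ≤ (w * Complex.exp (-(Real.pi / 3 * Complex.I))).re ∧ 0 ≤ w.arg ∧ w.arg ≤ Real.pi / 3)) :
    ∃ m σ : ℂ, 2 * m * σ = w ∧ 0 < m.im ∧ 0 ≤ m.re ∧ 1 ≤ m.re ^ 2 + m.im ^ 2 ∧
      1 ≤ (m.re - 1) ^ 2 + m.im ^ 2 ∧ 1 ≤ σ.re := by
  have h3 : (Real.sqrt 3) ^ 2 = 3 := Real.sq_sqrt (by norm_num)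
  rcases hw with ⟨h1, h2, h3'⟩ | ⟨h1, -, -⟩
  · have hpi := Real.pi_pos
    have hre : w.re = ‖w‖ * Real.cos w.arg := (Complex.norm_mul_cos_arg w).symm
    have him : w.im = ‖w‖ * Real.sin w.arg := (Complex.norm_mul_sin_arg w).symm
    have hc0 : 0 ≤ Real.cos w.arg := Real.cos_nonneg_of_mem_Icc ⟨by linarith, h3'⟩
    have hc1 : Real.cos w.arg ≤ 1 / 2 := by
      rw [← Real.cos_pi_div_three]
      exact Real.cos_le_cos_of_nonneg_of_le_pi (by linarith) (by linarith) h2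
    have hs : 0 < Real.sin w.arg := Real.sin_pos_of_pos_of_lt_pi (by linarith) (by linarith)
    have hn : w.re ^ 2 + w.im ^ 2 = ‖w‖ ^ 2 := by
      rw [← Complex.normSq_eq_norm_sq, Complex.normSq_apply]; ring
    have hm : (w / 2).re = w.re / 2 ∧ (w / 2).im = w.im / 2 := by
      constructor <;> simp
    refine ⟨w / 2, 1, by ring, ?_, ?_, ?_, ?_, by simp⟩
    · rw [hm.2, him]; positivity
    · rw [hm.1, hre]; positivity
    · rw [hm.1, hm.2]; nlinarith
    · rw [hm.1, hm.2]
      have : w.re ≤ ‖w‖ / 2 := by rw [hre]; nlinarith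
      nlinarith
  · set m : ℂ := ⟨1 / 2, Real.sqrt 3 / 2⟩ with hm
    have hexp : Complex.exp (-(Real.pi / 3 * Complex.I)) = ⟨1 / 2, -(Real.sqrt 3 / 2)⟩ := by
      have : -(Real.pi / 3 * Complex.I) = ((-(Real.pi / 3) : ℝ) : ℂ) * Complex.I := by
        push_cast; ring
      rw [this]
      apply Complex.ext
      · rw [Complex.exp_ofReal_mul_I_re, Real.cos_neg, Real.cos_pi_div_three]
      · rw [Complex.exp_ofReal_mul_I_im, Real.sin_neg, Real.sin_pi_div_three]
    refine ⟨m, w * Complex.exp (-(Real.pi / 3 * Complex.I)) / 2, ?_, ?_, ?_, ?_, ?_, ?_⟩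
    · rw [hexp]
      apply Complex.ext
      · simp [hm]; linear_combination (1 / 4) * w.re * h3
      · simp [hm]; linear_combination (1 / 4) * w.im * h3
    · simp only [hm]; positivity
    · simp only [hm]; positivity
    · simp only [hm]; nlinarith
    · simp only [hm]; nlinarith
    · have : (w * Complex.exp (-(Real.pi / 3 * Complex.I)) / 2).re =
          (w * Complex.exp (-(Real.pi / 3 * Complex.I))).re / 2 := by
        simp
      rw [this]; linarith

lemma isTSchottky_of_parameters (S T : SL(2, ℂ))
    (hS : (S : Matrix (Fin 2) (Fin 2) ℂ).trace = 2) (hT : (T : Matrix (Fin 2) (Fin 2) ℂ).trace = 2)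
    {m σ : ℂ} (hmσ : 2 * m * σ = ((S * T : SL(2, ℂ)) : Matrix (Fin 2) (Fin 2) ℂ).trace - 2)
    (h1 : 0 < m.im) (h2 : 0 ≤ m.re) (h3 : 1 ≤ m.re ^ 2 + m.im ^ 2)
    (h4 : 1 ≤ (m.re - 1) ^ 2 + m.im ^ 2) (h5 : 1 ≤ σ.re) : IsTSchottky (twoGenerator S T) := by
  have hm : 2 * m ≠ 0 := by
    refine mul_ne_zero two_ne_zero ?_
    rintro rfl
    simp at h1
  have hσ : σ ≠ 0 := by rintro rfl; norm_num at h5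
  obtain ⟨H, hHT, hHS⟩ := exists_conj_normalForm S T hS hT hm hσ hmσ
  refine ⟨2, _, ?_, (isMarkedTSchottky_hex h1 h2 h3 h4 h5).conj (mem_moebiusGroup H)⟩
  rw [twoGenerator, hHT, hHS]
  congr 1
  ext f
  simp [eq_comm, or_comm]

/-- The T-Schottky condition in trace form. -/
lemma isTSchottky_twoGenerator (S T : SL(2, ℂ))
    (hS : (S : Matrix (Fin 2) (Fin 2) ℂ).trace = 2) (hT : (T : Matrix (Fin 2) (Fin 2) ℂ).trace = 2)
    {w : ℂ} (hw : w = ((S * T : SL(2, ℂ)) : Matrix (Fin 2) (Fin 2) ℂ).trace - 2)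
    (h : (2 ≤ ‖w‖ ∧ Real.pi / 3 ≤ w.arg ∧ w.arg ≤ Real.pi / 2) ∨
      (2 ≤ (w * Complex.exp (-(Real.pi / 3 * Complex.I))).re ∧ 0 ≤ w.arg ∧
        w.arg ≤ Real.pi / 3)) :
    IsTSchottky (twoGenerator S T) := by
  obtain ⟨m, σ, hmσ, h1, h2, h3, h4, h5⟩ := exists_hex_parameters h
  exact isTSchottky_of_parameters S T hS hT (hmσ.trans hw) h1 h2 h3 h4 h5

lemma mem_interior_regionK_of_norm_lt {l : ℂ} (h : ‖l‖ < 1) : l ∈ interior regionK := by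
  have hb : Metric.ball (0 : ℂ) 1 ⊆ regionK := by
    refine Metric.ball_subset_closedBall.trans ?_
    rw [← convexHull_sphere_eq_closedBall (0 : ℂ) zero_le_one]
    exact convexHull_mono Set.subset_union_left
  exact interior_maximal hb Metric.isOpen_ball (by simpa using h)

lemma mem_interior_regionK_of_triangle {l : ℂ} (h0 : 1 / 2 < l.re)
    (h1 : l.re + Real.sqrt 3 * l.im < 2) (h2 : l.re - Real.sqrt 3 * l.im < 2) :
    l ∈ interior regionK := by
  have h3 : (Real.sqrt 3) ^ 2 = 3 := Real.sq_sqrt (by norm_num)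
  refine interior_maximal (t := {z : ℂ | 1 / 2 < z.re ∧ z.re + Real.sqrt 3 * z.im < 2 ∧
    z.re - Real.sqrt 3 * z.im < 2}) ?_ ?_ ⟨h0, h1, h2⟩
  · rintro z ⟨h0, h1, h2⟩
    have hconv : Convex ℝ regionK := convex_convexHull _ _
    have hv : ∀ s : ℝ, s ^ 2 = 3 → (⟨1 / 2, s / 2⟩ : ℂ) ∈ regionK := by
      intro s hs
      refine subset_convexHull ℝ _ (Or.inl ?_)
      rw [mem_sphere_iff' zero_le_one]
      simp only [Complex.zero_re, Complex.zero_im]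
      linear_combination (1 / 4) * hs
    have h2K : (2 : ℂ) ∈ regionK := subset_convexHull ℝ _ (Or.inr (by simp))
    have key := hconv.sum_mem (t := (Finset.univ : Finset (Fin 3)))
      (w := ![(2 * z.re - 1) / 3, (2 - z.re + Real.sqrt 3 * z.im) / 3,
        (2 - z.re - Real.sqrt 3 * z.im) / 3])
      (z := ![2, ⟨1 / 2, Real.sqrt 3 / 2⟩, ⟨1 / 2, -Real.sqrt 3 / 2⟩])
      (by intro i _; fin_cases i <;> simp <;> linarith)
      (by simp [Fin.sum_univ_three]; ring)
      (by
        intro i _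
        fin_cases i
        · exact h2K
        · exact hv _ h3
        · exact hv _ (by linear_combination h3))
    convert key using 1
    rw [Fin.sum_univ_three]
    apply Complex.ext
    · simp; ring
    · simp; linear_combination (-1 / 3 * z.im) * h3
  · exact (isOpen_lt continuous_const Complex.continuous_re).inter
      ((isOpen_lt (f := fun z : ℂ => z.re + Real.sqrt 3 * z.im) (g := fun _ => 2)
        (by fun_prop) continuous_const).inter
      (isOpen_lt (f := fun z : ℂ => z.re - Real.sqrt 3 * z.im) (g := fun _ => 2)
        (by fun_prop) continuous_const))

lemma isTSchottky_groupG {l : ℂ} (hre : 0 ≤ l.re) (him : 0 ≤ l.im)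
    (hK : l ∉ interior regionK) : IsTSchottky (groupG l) := by
  have h3 : (Real.sqrt 3) ^ 2 = 3 := Real.sq_sqrt (by norm_num)
  have h3' : 0 < Real.sqrt 3 := by positivity
  have hS : (matS : Matrix (Fin 2) (Fin 2) ℂ).trace = 2 := by
    simp [matS, Matrix.trace_fin_two]; norm_num
  have hT : (matT l : Matrix (Fin 2) (Fin 2) ℂ).trace = 2 := by
    simp [matT, Matrix.trace_fin_two]; norm_num
  have htr : ((matS * matT l : SL(2, ℂ)) : Matrix (Fin 2) (Fin 2) ℂ).trace - 2 = 2 * l := by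
    rw [Matrix.SpecialLinearGroup.coe_mul]
    simp [matS, matT, Matrix.trace_fin_two]
    ring
  have hn : 1 ≤ l.re ^ 2 + l.im ^ 2 := by
    by_contra h
    refine hK (mem_interior_regionK_of_norm_lt ?_)
    have : ‖l‖ ^ 2 < 1 := by
      rw [← Complex.normSq_eq_norm_sq, Complex.normSq_apply]; nlinarith
    nlinarith [norm_nonneg l]
  by_cases hA : 0 < l.im ∧ 1 ≤ (l.re - 1) ^ 2 + l.im ^ 2
  · exact isTSchottky_of_parameters _ _ hS hT (m := l) (σ := 1) (by rw [htr]; ring) hA.1 hre hn hA.2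
      (by simp)
  · have hre2 : 1 / 2 < l.re := by
      by_cases h : 0 < l.im
      · have := not_le.1 fun h' => hA ⟨h, h'⟩
        nlinarith
      · have : l.im = 0 := le_antisymm (not_lt.1 h) him
        rw [this] at hn
        nlinarith
    have hbig : 2 ≤ l.re + Real.sqrt 3 * l.im := by
      by_contra h
      rw [not_le] at h
      exact hK (mem_interior_regionK_of_triangle hre2 h (by nlinarith))
    refine isTSchottky_of_parameters _ _ hS hT (m := ⟨1 / 2, Real.sqrt 3 / 2⟩)
      (σ := l * ⟨1 / 2, -(Real.sqrt 3 / 2)⟩) ?_ ?_ ?_ ?_ ?_ ?_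
    · rw [htr]
      apply Complex.ext
      · simp; linear_combination (1 / 2) * l.re * h3
      · simp; linear_combination (1 / 2) * l.im * h3
    · simp only; positivity
    · simp only; positivity
    · simp only; nlinarith
    · simp only; nlinarith
    · simp; linarith

/-! ### Parabolic dynamics -/

/-- All forward and backward orbits of `f` converge to `p`. -/
def IsParabolicAt (f : Equiv.Perm Sphere) (p : Sphere) : Prop :=
  (∀ z, Tendsto (fun n : ℕ => (f ^ n) z) atTop (𝓝 p)) ∧
    ∀ z, Tendsto (fun n : ℕ => (f⁻¹ ^ n) z) atTop (𝓝 p)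

namespace IsParabolicAt

variable {f h : Equiv.Perm Sphere} {p q : Sphere}

lemma inv (hf : IsParabolicAt f p) : IsParabolicAt f⁻¹ p := ⟨hf.2, by simpa using hf.1⟩

lemma conj (hf : IsParabolicAt f p) (hh : h ∈ moebiusGroup) :
    IsParabolicAt (h * f * h⁻¹) (h p) := by
  constructor
  · intro z
    simp only [conj_pow, Equiv.Perm.mul_apply]
    exact ((continuous_of_mem hh).tendsto p).comp (hf.1 (h⁻¹ z))
  · intro z
    simp only [conj_inv, conj_pow, Equiv.Perm.mul_apply]
    exact ((continuous_of_mem hh).tendsto p).comp (hf.2 (h⁻¹ z))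

lemma unique (hf : IsParabolicAt f p) (hf' : IsParabolicAt f q) : p = q :=
  tendsto_nhds_unique (hf.1 OnePoint.infty) (hf'.1 OnePoint.infty)

lemma mem_closure (hf : IsParabolicAt f p) {D : Set Sphere} (hne : D.Nonempty)
    (hD : f '' D ⊆ D) : p ∈ closure D := by
  obtain ⟨z, hz⟩ := hne
  refine mem_closure_of_tendsto (hf.1 z) (Eventually.of_forall fun n => ?_)
  induction n with
  | zero => simpa using hz
  | succ n ih =>
    rw [pow_succ', Equiv.Perm.mul_apply]
    exact hD ⟨_, ih, rfl⟩

end IsParabolicAt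

lemma transl_pow_coe (t z : ℂ) (n : ℕ) : (transl t ^ n) (z : Sphere) = ((z + n * t : ℂ) : Sphere) := by
  induction n with
  | zero => simp
  | succ n ih =>
    rw [pow_succ', Equiv.Perm.mul_apply, ih, transl_coe]
    congr 1; push_cast; ring

lemma transl_inv (t : ℂ) : (transl t)⁻¹ = transl (-t) := by
  rw [inv_eq_iff_mul_eq_one]
  ext1 z
  induction z using OnePoint.rec with
  | infty => simp [transl_infty]
  | coe z => simp [transl_coe]

lemma transl_mem (t : ℂ) : transl t ∈ moebiusGroup := mem_moebiusGroup _

lemma tendsto_transl_pow {t : ℂ} (ht : t ≠ 0) (z : Sphere) :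
    Tendsto (fun n : ℕ => (transl t ^ n) z) atTop (𝓝 OnePoint.infty) := by
  induction z using OnePoint.rec with
  | infty =>
    have : ∀ n : ℕ, (transl t ^ n) OnePoint.infty = OnePoint.infty := by
      intro n
      induction n with
      | zero => simp
      | succ n ih => rw [pow_succ', Equiv.Perm.mul_apply, ih, transl_infty]
    simp only [this]
    exact tendsto_const_nhds
  | coe z =>
    simp only [transl_pow_coe]
    rw [tendsto_coe_infty_iff]
    have h1 : Tendsto (fun n : ℕ => (n : ℝ) * ‖t‖ - ‖z‖) atTop atTop :=
      tendsto_atTop_add_const_right _ _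
        (tendsto_natCast_atTop_atTop.atTop_mul_const (norm_pos_iff.2 ht))
    refine tendsto_atTop_mono (fun n => ?_) h1
    have := norm_sub_le (z + n * t) z
    rw [add_sub_cancel_left, norm_mul, Complex.norm_natCast] at this
    linarith

lemma isParabolicAt_transl {t : ℂ} (ht : t ≠ 0) : IsParabolicAt (transl t) OnePoint.infty := by
  refine ⟨tendsto_transl_pow ht, ?_⟩
  rw [transl_inv]
  exact tendsto_transl_pow (neg_ne_zero.2 ht)

/-- The inversion `z ↦ 1 / z`. -/
def swap : Equiv.Perm Sphere := moebius swapGL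

lemma swap_mem : swap ∈ moebiusGroup := mem_moebiusGroup _

lemma swap_inv : swap⁻¹ = swap := by
  rw [inv_eq_iff_mul_eq_one]
  ext1 z
  induction z using OnePoint.rec with
  | infty => simp [swap, swapGL_infty, swapGL_zero]
  | coe z =>
    by_cases hz : z = 0
    · subst hz; simp [swap, swapGL_infty, swapGL_zero]
    · simp [swap, swapGL_coe hz, swapGL_coe (inv_ne_zero hz)]

lemma coTransl_eq (s : ℂ) : coTransl s = swap * transl s * swap⁻¹ := by
  rw [eq_mul_inv_iff_mul_eq, coTransl, swap, transl, ← map_mul, ← map_mul]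
  congr 1
  ext i j
  fin_cases i <;> fin_cases j <;> simp [glMk, affineGL, swapGL, Matrix.mul_apply, Fin.sum_univ_two]

lemma transl_eq (s : ℂ) : transl s = swap * coTransl s * swap⁻¹ := by
  rw [coTransl_eq, swap_inv]
  simp only [mul_assoc]
  have : swap * swap = 1 := by
    have := mul_inv_cancel swap
    rwa [swap_inv] at this
  rw [this, mul_one, ← mul_assoc, this, one_mul]

lemma isParabolicAt_coTransl {s : ℂ} (hs : s ≠ 0) :
    IsParabolicAt (coTransl s) ((0 : ℂ) : Sphere) := by
  rw [coTransl_eq, ← swapGL_infty]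
  exact (isParabolicAt_transl hs).conj swap_mem

/-! ### Half-planes and tangent discs -/

/-- The real inner product on `ℂ`. -/
def dot (n z : ℂ) : ℝ := n.re * z.re + n.im * z.im

lemma dot_add (n z w : ℂ) : dot n (z + w) = dot n z + dot n w := by simp [dot]; ring

lemma dot_smul (n z : ℂ) (t : ℝ) : dot n (t * z) = t * dot n z := by simp [dot]; ring

lemma dot_self (n : ℂ) : dot n n = ‖n‖ ^ 2 := by
  rw [← Complex.normSq_eq_norm_sq, Complex.normSq_apply]; rfl

/-- The half-plane with inner normal `n`. -/
def halfPlane (n : ℂ) (k : ℝ) : Set Sphere := (↑) '' {z : ℂ | k < dot n z}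

lemma coe_mem_halfPlane {n z : ℂ} {k : ℝ} : (z : Sphere) ∈ halfPlane n k ↔ k < dot n z := by
  simp [halfPlane]

lemma infty_notMem_halfPlane {n : ℂ} {k : ℝ} : OnePoint.infty ∉ halfPlane n k := by
  simp [halfPlane]

lemma exists_realMoebius {q : Sphere} (hq : q ∈ realLine) :
    ∃ r ∈ moebiusGroup, r OnePoint.infty = q ∧ r '' upper = upper := by
  induction q using OnePoint.rec with
  | infty => exact ⟨1, one_mem _, rfl, by simp⟩
  | coe t =>
    rw [coe_mem_realLine] at hq
    refine ⟨_, mem_moebiusGroup (glMk t (-1) 1 0 (by simp)), by rw [glMk_infty]; simp, ?_⟩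
    apply image_eq_of_mem_iff
    intro z
    induction z using OnePoint.rec with
    | infty => rw [glMk_infty]; simp [coe_mem_upper, infty_notMem_upper, hq]
    | coe z =>
      rw [glMk_coe, one_mul, add_zero]
      split_ifs with hz
      · simp [hz, coe_mem_upper, infty_notMem_upper]
      · rw [coe_mem_upper, coe_mem_upper]
        have e : ((t * z + -1) / z).im = z.im / Complex.normSq z := by
          rw [show (t * z + -1) / z = t - z⁻¹ by field_simp; ring]
          simp [hq, Complex.inv_im, neg_div]
        rw [e]
        exact div_pos_iff_of_pos_right (Complex.normSq_pos.2 hz)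

lemma IsDisc.eq_halfPlane {D : Set Sphere} (hD : IsDisc D) (h1 : OnePoint.infty ∈ closure D)
    (h2 : OnePoint.infty ∉ D) : ∃ (n : ℂ) (k : ℝ), ‖n‖ = 1 ∧ D = halfPlane n k := by
  have hfr : OnePoint.infty ∈ frontier D := by rw [hD.isOpen.frontier_eq]; exact ⟨h1, h2⟩
  obtain ⟨f, hf, rfl⟩ := hD
  rw [← image_frontier_of_mem hf, frontier_upper] at hfr
  obtain ⟨q, hq, hfq⟩ := hfr
  obtain ⟨r, hr, hrq, hru⟩ := exists_realMoebius hq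
  obtain ⟨g, hg⟩ := mul_mem hf hr
  have hginf : moebius g OnePoint.infty = OnePoint.infty := by
    rw [hg, Equiv.Perm.mul_apply, hrq, hfq]
  have himg : f '' upper = moebius g '' upper := by
    rw [hg, Equiv.Perm.coe_mul, Set.image_comp, hru]
  have hc : g 1 0 = 0 := by
    by_contra hc
    rw [moebius_infty, if_neg hc] at hginf
    exact OnePoint.coe_ne_infty _ hginf
  have hdet := g.det_ne_zero
  rw [Matrix.det_fin_two, hc, mul_zero, sub_zero] at hdet
  have ha : g 0 0 ≠ 0 := left_ne_zero_of_mul hdet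
  have hd : g 1 1 ≠ 0 := right_ne_zero_of_mul hdet
  set A := g 0 0 / g 1 1 with hA
  set B := g 0 1 / g 1 1 with hB
  have hA0 : A ≠ 0 := div_ne_zero ha hd
  have hg' : ∀ z : ℂ, moebius g (z : Sphere) = ((A * z + B : ℂ) : Sphere) := by
    intro z
    rw [moebius_coe, hc, zero_mul, zero_add, if_neg hd]
    congr 1
    rw [hA, hB]
    field_simp
  have hAn : 0 < ‖A‖ := norm_pos_iff.2 hA0
  refine ⟨((‖A‖⁻¹ : ℝ) : ℂ) * (Complex.I * A), dot (((‖A‖⁻¹ : ℝ) : ℂ) * (Complex.I * A)) B, ?_, ?_⟩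
  · rw [norm_mul, norm_mul, Complex.norm_I, one_mul, Complex.norm_real, norm_inv, norm_norm]
    exact inv_mul_cancel₀ hAn.ne'
  · rw [himg]
    apply image_eq_of_mem_iff
    intro z
    induction z using OnePoint.rec with
    | infty => rw [hginf]; simp [infty_notMem_upper, infty_notMem_halfPlane]
    | coe z =>
      rw [hg', coe_mem_halfPlane, coe_mem_upper, dot_add, lt_add_iff_pos_left]
      have : dot (((‖A‖⁻¹ : ℝ) : ℂ) * (Complex.I * A)) (A * z) = ‖A‖⁻¹ * (dot A A) * z.im := by
        simp [dot]; ring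
      rw [this, dot_self]
      have h3 : 0 < ‖A‖⁻¹ * ‖A‖ ^ 2 := by positivity
      exact mul_pos_iff_of_pos_left h3

lemma exists_moebius_infty (p : Sphere) : ∃ f ∈ moebiusGroup, f p = OnePoint.infty := by
  induction p using OnePoint.rec with
  | infty => exact ⟨1, one_mem _, rfl⟩
  | coe z =>
    refine ⟨swap * transl (-z), mul_mem swap_mem (transl_mem _), ?_⟩
    rw [Equiv.Perm.mul_apply, transl_coe, add_neg_cancel]
    exact swapGL_zero

/-- Disjoint half-planes have opposite normals. -/
lemma eq_neg_of_disjoint_halfPlane {n m : ℂ} {k l : ℝ} (hn : ‖n‖ = 1) (hm : ‖m‖ = 1)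
    (h : Disjoint (halfPlane n k) (halfPlane m l)) : m = -n ∧ 0 ≤ k + l := by
  have hnm : m = -n := by
    by_contra hne
    have hpos : 0 < 1 + dot n m := by
      have h1 : 0 < ‖m + n‖ ^ 2 := by
        have : m + n ≠ 0 := fun h' => hne (eq_neg_of_add_eq_zero_left h')
        positivity
      rw [← dot_self] at h1
      have h2 : dot (m + n) (m + n) = dot n n + dot m m + 2 * dot n m := by simp [dot]; ring
      rw [h2, dot_self, dot_self, hn, hm] at h1
      linarith
    have hmn : dot m n = dot n m := by simp [dot]; ring
    obtain ⟨t, ht⟩ := exists_gt (max (k / (1 + dot n m)) (l / (1 + dot n m)))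
    have h1 := lt_of_le_of_lt (le_max_left _ _) ht
    have h2 := lt_of_le_of_lt (le_max_right _ _) ht
    rw [div_lt_iff₀ hpos] at h1 h2
    have h' := Set.disjoint_left.1 h
    refine @h' ((t * (n + m) : ℂ) : Sphere) ?_ ?_
    · rw [coe_mem_halfPlane, dot_smul, dot_add, dot_self, hn]; linarith
    · rw [coe_mem_halfPlane, dot_smul, dot_add, dot_self, hm, hmn]; linarith
  refine ⟨hnm, ?_⟩
  by_contra hlt
  rw [not_le] at hlt
  have h' := Set.disjoint_left.1 h
  refine @h' ((((k - l) / 2 : ℝ) * n : ℂ) : Sphere) ?_ ?_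
  · rw [coe_mem_halfPlane, dot_smul, dot_self, hn]; linarith
  · have : dot (-n) n = -dot n n := by simp [dot]; ring
    rw [coe_mem_halfPlane, dot_smul, hnm, this, dot_self, hn]; linarith

section Tangent

variable {D₁ D₂ D₃ : Set Sphere} {p q : Sphere}

lemma notMem_of_mem_closure {D E : Set Sphere} (hD : IsOpen D) (h : Disjoint D E) (hp : p ∈ closure E) :
    p ∉ D := fun hpD => disjoint_closure_of_isOpen hD h hpD hp

lemma no_triple_tangency (h1 : IsDisc D₁) (h2 : IsDisc D₂) (h3 : IsDisc D₃)
    (h12 : Disjoint D₁ D₂) (h13 : Disjoint D₁ D₃) (h23 : Disjoint D₂ D₃)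
    (p1 : p ∈ closure D₁) (p2 : p ∈ closure D₂) (p3 : p ∈ closure D₃) : False := by
  obtain ⟨f, hf, hfp⟩ := exists_moebius_infty p
  have key : ∀ {D E : Set Sphere}, IsDisc D → Disjoint D E → p ∈ closure D → p ∈ closure E →
      ∃ (n : ℂ) (k : ℝ), ‖n‖ = 1 ∧ f '' D = halfPlane n k := by
    intro D E hD hDE hpD hpE
    refine (hD.image hf).eq_halfPlane ?_ ?_
    · rw [← image_closure_of_mem hf, ← hfp]
      exact Set.mem_image_of_mem _ hpD
    · rw [← hfp, f.injective.mem_set_image]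
      exact notMem_of_mem_closure hD.isOpen hDE hpE
  obtain ⟨n₁, k₁, hn₁, e₁⟩ := key h1 h12 p1 p2
  obtain ⟨n₂, k₂, hn₂, e₂⟩ := key h2 h12.symm p2 p1
  obtain ⟨n₃, k₃, hn₃, e₃⟩ := key h3 h13.symm p3 p1
  have d : ∀ {D E : Set Sphere}, Disjoint D E → Disjoint (f '' D) (f '' E) :=
    fun h => (Set.disjoint_image_iff f.injective).2 h
  have d12 := d h12
  have d13 := d h13
  have d23 := d h23
  rw [e₁, e₂] at d12
  rw [e₁, e₃] at d13
  rw [e₂, e₃] at d23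
  have a := (eq_neg_of_disjoint_halfPlane hn₁ hn₂ d12).1
  have b := (eq_neg_of_disjoint_halfPlane hn₁ hn₃ d13).1
  have c := (eq_neg_of_disjoint_halfPlane hn₂ hn₃ d23).1
  rw [a, b, neg_neg, neg_eq_iff_add_eq_zero, ← two_mul] at c
  have : n₁ = 0 := by simpa using c
  simp [this] at hn₁

lemma closure_halfPlane_subset (n : ℂ) (k : ℝ) :
    closure (halfPlane n k) ⊆ insert OnePoint.infty ((↑) '' {z : ℂ | k ≤ dot n z}) := by
  refine closure_minimal ?_ ?_
  · rintro _ ⟨z, hz, rfl⟩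
    have hz' : k < dot n z := hz
    exact Or.inr ⟨z, hz'.le, rfl⟩
  · rw [← isOpen_compl_iff]
    have : (insert OnePoint.infty ((↑) '' {z : ℂ | k ≤ dot n z}) : Set Sphere)ᶜ =
        (↑) '' {z : ℂ | dot n z < k} := by
      ext z
      induction z using OnePoint.rec with
      | infty => simp
      | coe z => simp
    rw [this, OnePoint.isOpen_image_coe]
    unfold dot
    exact isOpen_lt (by fun_prop) continuous_const

lemma tangency_unique (h1 : IsDisc D₁) (h2 : IsDisc D₂) (h3 : D₃.Nonempty)
    (h12 : Disjoint D₁ D₂) (h13 : Disjoint D₁ D₃) (h23 : Disjoint D₂ D₃) (ho3 : IsOpen D₃)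
    (p1 : p ∈ closure D₁) (p2 : p ∈ closure D₂) (q1 : q ∈ closure D₁) (q2 : q ∈ closure D₂) :
    p = q := by
  by_contra hpq
  obtain ⟨f, hf, hfp⟩ := exists_moebius_infty p
  have key : ∀ {D E : Set Sphere}, IsDisc D → Disjoint D E → p ∈ closure D → p ∈ closure E →
      ∃ (n : ℂ) (k : ℝ), ‖n‖ = 1 ∧ f '' D = halfPlane n k := by
    intro D E hD hDE hpD hpE
    refine (hD.image hf).eq_halfPlane ?_ ?_
    · rw [← image_closure_of_mem hf, ← hfp]
      exact Set.mem_image_of_mem _ hpD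
    · rw [← hfp, f.injective.mem_set_image]
      exact notMem_of_mem_closure hD.isOpen hDE hpE
  obtain ⟨n₁, k₁, hn₁, e₁⟩ := key h1 h12 p1 p2
  obtain ⟨n₂, k₂, hn₂, e₂⟩ := key h2 h12.symm p2 p1
  have d12 := (Set.disjoint_image_iff f.injective).2 h12
  rw [e₁, e₂] at d12
  obtain ⟨rfl, hk⟩ := eq_neg_of_disjoint_halfPlane hn₁ hn₂ d12
  have hfq : f q ≠ OnePoint.infty := fun h => hpq (f.injective (hfp.trans h.symm))
  obtain ⟨w, hw⟩ := OnePoint.ne_infty_iff_exists.1 hfq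
  have neg_dot : ∀ z, dot (-n₁) z = -dot n₁ z := fun z => by simp [dot]; ring
  have c1 : k₁ ≤ dot n₁ w := by
    have := closure_halfPlane_subset _ _ (e₁ ▸ image_closure_of_mem hf D₁ ▸
      Set.mem_image_of_mem f q1)
    rw [← hw] at this
    simpa using this
  have c2 : k₂ ≤ dot (-n₁) w := by
    have := closure_halfPlane_subset _ _ (e₂ ▸ image_closure_of_mem hf D₂ ▸
      Set.mem_image_of_mem f q2)
    rw [← hw] at this
    simpa using this
  rw [neg_dot] at c2
  have hkk : k₂ = -k₁ := by linarith
  obtain ⟨z, hz⟩ := h3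
  have hcov : f z ∈ closure (f '' D₁) ∪ closure (f '' D₂) := by
    rw [e₁, e₂]
    have hinf : OnePoint.infty ∈ closure (halfPlane n₁ k₁) := by
      rw [← e₁, ← image_closure_of_mem hf, ← hfp]
      exact Set.mem_image_of_mem _ p1
    induction hfz : f z using OnePoint.rec with
    | infty => exact Or.inl hinf
    | coe v =>
      rcases lt_trichotomy k₁ (dot n₁ v) with h | h | h
      · exact Or.inl (subset_closure (coe_mem_halfPlane.2 h))
      · left
        have ht : Tendsto (fun n : ℕ => ((v + (1 / ((n : ℝ) + 1) : ℝ) * n₁ : ℂ) : Sphere)) atTop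
            (𝓝 (v : Sphere)) := by
          refine (OnePoint.continuous_coe.tendsto v).comp ?_
          have h0 : Tendsto (fun n : ℕ => ((1 / ((n : ℝ) + 1) : ℝ) : ℂ)) atTop (𝓝 ((0 : ℝ) : ℂ)) :=
            (Complex.continuous_ofReal.tendsto 0).comp tendsto_one_div_add_atTop_nhds_zero_nat
          have := (h0.mul_const n₁).const_add v
          simpa using this
        refine mem_closure_of_tendsto ht (Eventually.of_forall fun n => ?_)
        rw [coe_mem_halfPlane, dot_add, dot_smul, dot_self, hn₁, ← h]
        have : (0 : ℝ) < 1 / ((n : ℝ) + 1) := by positivity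
        linarith
      · right
        refine subset_closure (coe_mem_halfPlane.2 ?_)
        rw [neg_dot]; linarith
  rw [← image_closure_of_mem hf, ← image_closure_of_mem hf, Set.mem_union,
    f.injective.mem_set_image, f.injective.mem_set_image] at hcov
  rcases hcov with h | h
  · exact notMem_of_mem_closure ho3 h13.symm h hz
  · exact notMem_of_mem_closure ho3 h23.symm h hz

end Tangent

/-! ### Words read off bi-infinite sequences of letters -/

section Words

variable {α H K : Type*} [Group H] [Group K]

/-- The inverse letter. -/
def linv (x : α × Bool) : α × Bool := (x.1, !x.2)

@[simp] lemma linv_linv (x : α × Bool) : linv (linv x) = x := by simp [linv]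

lemma linv_ne (x : α × Bool) : linv x ≠ x := by
  intro h
  have := congrArg Prod.snd h
  simp [linv] at this

lemma linv_inj {x y : α × Bool} : linv x = linv y ↔ x = y :=
  ⟨fun h => by rw [← linv_linv x, h, linv_linv], fun h => by rw [h]⟩

/-- The group element of a letter. -/
def letter (g : α → H) (x : α × Bool) : H := bif x.2 then g x.1 else (g x.1)⁻¹

@[simp] lemma letter_linv (g : α → H) (x : α × Bool) : letter g (linv x) = (letter g x)⁻¹ := by
  obtain ⟨i, b⟩ := x
  cases b <;> simp [letter, linv]

lemma map_letter (f : H →* K) (g : α → H) (x : α × Bool) :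
    f (letter g x) = letter (fun i => f (g i)) x := by
  obtain ⟨i, b⟩ := x
  cases b <;> simp [letter]

/-- The product of the `k` letters of the sequence `x` starting at position `i`. -/
def window (g : α → H) (x : ℤ → α × Bool) : ℤ → ℕ → H
  | _, 0 => 1
  | i, k + 1 => letter g (x i) * window g x (i + 1) k

lemma window_succ (g : α → H) (x : ℤ → α × Bool) (i : ℤ) (k : ℕ) :
    window g x i (k + 1) = letter g (x i) * window g x (i + 1) k := rfl

lemma window_succ' (g : α → H) (x : ℤ → α × Bool) (i : ℤ) (k : ℕ) :
    window g x i (k + 1) = window g x i k * letter g (x (i + k)) := by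
  induction k generalizing i with
  | zero => simp [window]
  | succ k ih =>
    rw [window_succ, ih, window_succ, mul_assoc]
    congr 4
    push_cast; ring

lemma map_window (f : H →* K) (g : α → H) (x : ℤ → α × Bool) (i : ℤ) (k : ℕ) :
    f (window g x i k) = window (fun i => f (g i)) x i k := by
  induction k generalizing i with
  | zero => simp [window]
  | succ k ih => rw [window_succ, map_mul, ih, map_letter, window_succ]

end Words

/-! ### Classical ping-pong configurations -/

/-- Pairwise disjoint discs `D x`, indexed by the letters of a free group, such that the letter `x`
maps the exterior of `D x⁻¹` onto `D x`. -/
structure PingPong {α : Type*} (g : α → Equiv.Perm Sphere) (D : α × Bool → Set Sphere) : Prop where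
  isDisc : ∀ x, IsDisc (D x)
  disjoint : ∀ x y, x ≠ y → Disjoint (D x) (D y)
  mem : ∀ i, g i ∈ moebiusGroup
  image : ∀ x, ⇑(letter g x) '' (closure (D (linv x)))ᶜ = D x

lemma IsMarkedClassicalTSchottky.exists_pingPong {n : ℕ} {g : Fin n → Equiv.Perm Sphere}
    (h : IsMarkedClassicalTSchottky g) : ∃ D, PingPong g D := by
  obtain ⟨C, D, hC, hp⟩ := h
  have hd := fun j => (hp.isSideOf j).isDisc (hC j)
  have hcl : ∀ j, exteriorOf (C j) (D j) = (closure (D j))ᶜ := by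
    intro j
    rw [exteriorOf, ← (hd j).2, (hd j).1.isOpen.frontier_eq, Set.sdiff_union_of_subset subset_closure]
  refine ⟨fun x => D (bif x.2 then Sum.inr x.1 else Sum.inl x.1), fun x => (hd _).1, ?_,
    hp.mem_moebiusGroup, ?_⟩
  · rintro ⟨i, b⟩ ⟨j, c⟩ hne
    apply hp.disjoint
    cases b <;> cases c <;> simp at hne ⊢ <;> exact hne
  · rintro ⟨i, b⟩
    have him := hp.image_exterior i
    rw [hcl] at him
    cases b
    · simp only [letter, linv, cond_false, Bool.not_false, cond_true]
      rw [← him, ← image_closure_of_mem (hp.mem_moebiusGroup i), (hd _).1.closure_compl_closure,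
        ← Set.image_compl_eq (g i).bijective, compl_compl, ← Set.image_comp]
      simp
    · simpa [letter, linv] using him

namespace PingPong

variable {α : Type*} {g : α → Equiv.Perm Sphere} {D : α × Bool → Set Sphere}

lemma letter_mem (h : PingPong g D) (x : α × Bool) : letter g x ∈ moebiusGroup := by
  obtain ⟨i, b⟩ := x
  cases b
  · exact inv_mem (h.mem i)
  · exact h.mem i

lemma subset_exterior (h : PingPong g D) {x y : α × Bool} (hxy : y ≠ x) :
    D y ⊆ (closure (D x))ᶜ :=
  disjoint_closure_of_isOpen (h.isDisc y).isOpen (h.disjoint _ _ hxy)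

lemma letter_image_subset (h : PingPong g D) {x y : α × Bool} (hxy : y ≠ linv x) :
    ⇑(letter g x) '' D y ⊆ D x := by
  rw [← h.image x]
  exact Set.image_mono (h.subset_exterior hxy)

lemma window_image_subset (h : PingPong g D) {x : ℤ → α × Bool}
    (hx : ∀ i, x (i + 1) ≠ linv (x i)) (k : ℕ) (i : ℤ) {y : α × Bool}
    (hy : y ≠ linv (x (i + k))) : ⇑(window g x i (k + 1)) '' D y ⊆ D (x i) := by
  induction k generalizing i with
  | zero => simpa [window] using h.letter_image_subset (by simpa using hy)
  | succ k ih =>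
    rw [window_succ, Equiv.Perm.coe_mul, Set.image_comp]
    refine (Set.image_mono (ih (i + 1) ?_)).trans (h.letter_image_subset (hx i))
    convert hy using 3
    push_cast; ring

lemma window_inv_image_subset (h : PingPong g D) {x : ℤ → α × Bool}
    (hx : ∀ i, x (i + 1) ≠ linv (x i)) (k : ℕ) (i : ℤ) {y : α × Bool}
    (hy : y ≠ x i) : ⇑(window g x i (k + 1))⁻¹ '' D y ⊆ D (linv (x (i + k))) := by
  induction k with
  | zero =>
    have := h.letter_image_subset (x := linv (x i)) (y := y) (by simpa using hy)
    simpa [window] using this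
  | succ k ih =>
    rw [window_succ', mul_inv_rev, Equiv.Perm.coe_mul, Set.image_comp, ← letter_linv]
    refine (Set.image_mono ih).trans (h.letter_image_subset ?_)
    rw [linv_linv]
    intro h'
    apply hx (i + k)
    rw [h']
    congr 1
    push_cast; ring

end PingPong

/-! ### Itineraries of parabolic fixed points -/

/-- The periodic itinerary of a parabolic cyclic word: `p i` is the point of tangency of the discs
`D (x i)` and `D (x (i - 1))⁻¹`. -/
structure Itinerary {α : Type*} (g : α → Equiv.Perm Sphere) (D : α × Bool → Set Sphere) (k : ℕ)
    (x : ℤ → α × Bool) (p : ℤ → Sphere) : Prop where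
  pos : 0 < k
  reduced : ∀ i, x (i + 1) ≠ linv (x i)
  periodic : ∀ i, x (i + k) = x i
  step : ∀ i, p (i + 1) = (letter g (x i))⁻¹ (p i)
  mem_closure : ∀ i, p i ∈ closure (D (x i))
  mem_closure' : ∀ i, p i ∈ closure (D (linv (x (i - 1))))

section Itineraries

variable {α : Type*} {g : α → Equiv.Perm Sphere} {D : α × Bool → Set Sphere}

lemma PingPong.exists_itinerary (h : PingPong g D) {x : ℤ → α × Bool} {k : ℕ} (hk : 0 < k)
    (hx : ∀ i, x (i + 1) ≠ linv (x i)) (hper : ∀ i, x (i + k) = x i) {q : Sphere}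
    (hq : IsParabolicAt (window g x 0 k) q) : ∃ p, p 0 = q ∧ Itinerary g D k x p := by
  have hconj : ∀ i, window g x (i + 1) k = (letter g (x i))⁻¹ * window g x i k * letter g (x i) := by
    intro i
    have := window_succ' g x i k
    rw [window_succ, hper] at this
    rw [mul_assoc, ← this, inv_mul_cancel_left]
  have hup : ∀ i p, IsParabolicAt (window g x i k) p →
      IsParabolicAt (window g x (i + 1) k) ((letter g (x i))⁻¹ p) := by
    intro i p hp
    have := hp.conj (inv_mem (h.letter_mem (x i)))
    rwa [inv_inv, ← hconj] at this
  have hdown : ∀ i p, IsParabolicAt (window g x (i + 1) k) p →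
      IsParabolicAt (window g x i k) (letter g (x i) p) := by
    intro i p hp
    have := hp.conj (h.letter_mem (x i))
    rwa [hconj, mul_assoc, mul_assoc, mul_inv_cancel, mul_one, mul_inv_cancel_left] at this
  have hex : ∀ i : ℤ, ∃ p, IsParabolicAt (window g x i k) p := by
    intro i
    induction i using Int.induction_on with
    | zero => exact ⟨q, hq⟩
    | succ i ih =>
      obtain ⟨p, hp⟩ := ih
      exact ⟨_, hup _ _ hp⟩
    | pred i ih =>
      obtain ⟨p, hp⟩ := ih
      exact ⟨_, hdown (-i - 1) p (by rwa [sub_add_cancel])⟩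
  choose p hp using hex
  obtain ⟨l, rfl⟩ : ∃ l, k = l + 1 := ⟨k - 1, by omega⟩
  have hlast : ∀ i : ℤ, x (i + l) = x (i - 1) := by
    intro i
    rw [← hper (i - 1)]
    congr 1; push_cast; ring
  refine ⟨p, (hp 0).unique hq, hk, hx, hper, fun i => (hp _).unique (hup _ _ (hp i)), ?_, ?_⟩
  · intro i
    refine (hp i).mem_closure (h.isDisc _).nonempty (h.window_image_subset hx l i ?_)
    rw [hlast]
    have := hx (i - 1)
    rwa [sub_add_cancel] at this
  · intro i
    rw [← hlast]
    refine (hp i).inv.mem_closure (h.isDisc _).nonempty (h.window_inv_image_subset hx l i ?_)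
    rw [hlast]
    have := hx (i - 1)
    rw [sub_add_cancel] at this
    exact this.symm

lemma Itinerary.reverse {k : ℕ} {x : ℤ → α × Bool} {p : ℤ → Sphere} (h : Itinerary g D k x p) :
    Itinerary g D k (fun i => linv (x (-1 - i))) (fun i => p (-i)) where
  pos := h.pos
  reduced i := by
    rw [ne_eq, linv_inj]
    have := h.reduced (-1 - (i + 1))
    rw [show -1 - (i + 1) + 1 = -1 - i by ring] at this
    intro h'
    apply this
    rw [h', linv_linv]
  periodic i := by
    rw [← h.periodic (-1 - (i + k))]
    congr 2; ring
  step i := by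
    have := h.step (-(i + 1))
    rw [show -(i + 1) + 1 = -i by ring] at this
    rw [this, letter_linv, inv_inv, show -1 - i = -(i + 1) by ring]
    simp
  mem_closure i := by
    have := h.mem_closure' (-i)
    rwa [show -i - 1 = -1 - i by ring] at this
  mem_closure' i := by
    rw [linv_linv, show -1 - (i - 1) = -i by ring]
    exact h.mem_closure (-i)

lemma exists_third_letter [Nontrivial α] (x y : α × Bool) : ∃ z : α × Bool, z ≠ x ∧ z ≠ y := by
  obtain ⟨i, hi⟩ := exists_ne x.1
  by_cases h : (i, true) = y
  · refine ⟨(i, false), fun h' => hi (by rw [← h']), ?_⟩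
    rw [← h]; simp
  · exact ⟨(i, true), fun h' => hi (by rw [← h']), h⟩

lemma Itinerary.eq_of_eq [Nontrivial α] (hD : PingPong g D) {k l : ℕ} {x y : ℤ → α × Bool}
    {p q : ℤ → Sphere} (hx : Itinerary g D k x p) (hy : Itinerary g D l y q) {i j : ℤ}
    (h1 : x i = y j) (h2 : x (i - 1) = y (j - 1)) (m : ℕ) : x (i + m) = y (j + m) := by
  have hne : ∀ i, x i ≠ linv (x (i - 1)) := by
    intro i
    have := hx.reduced (i - 1)
    rwa [sub_add_cancel] at this
  have hpq : p i = q j := by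
    obtain ⟨z, hz1, hz2⟩ := exists_third_letter (x i) (linv (x (i - 1)))
    refine tangency_unique (hD.isDisc _) (hD.isDisc _) (hD.isDisc z).nonempty
      (hD.disjoint _ _ (hne i)) (hD.disjoint _ _ hz1.symm) (hD.disjoint _ _ hz2.symm)
      (hD.isDisc z).isOpen (hx.mem_closure i) (hx.mem_closure' i) ?_ ?_
    · rw [h1]; exact hy.mem_closure j
    · rw [h2]; exact hy.mem_closure' j
  suffices h : p (i + m) = q (j + m) ∧ x (i + m) = y (j + m) from h.2
  induction m with
  | zero => simpa using ⟨hpq, h1⟩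
  | succ m ih =>
    obtain ⟨ih1, ih2⟩ := ih
    have e1 : p (i + (m + 1 : ℕ)) = q (j + (m + 1 : ℕ)) := by
      have a := hx.step (i + m)
      have b := hy.step (j + m)
      rw [ih1, ih2, ← b] at a
      convert a using 2 <;> push_cast <;> ring
    refine ⟨e1, ?_⟩
    by_contra hne'
    have c1 : linv (x (i + (m + 1 : ℕ) - 1)) = linv (x (i + m)) := by
      congr 2; push_cast; ring
    have c2 : linv (y (j + (m + 1 : ℕ) - 1)) = linv (x (i + m)) := by
      rw [ih2]; congr 2; push_cast; ring
    have d1 := hx.mem_closure' (i + (m + 1 : ℕ))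
    have n1 := hne (i + (m + 1 : ℕ))
    have n2 : y (j + (m + 1 : ℕ)) ≠ linv (y (j + (m + 1 : ℕ) - 1)) := by
      have := hy.reduced (j + (m + 1 : ℕ) - 1)
      rwa [sub_add_cancel] at this
    rw [c1] at d1 n1
    rw [c2] at n2
    have d3 := hy.mem_closure (j + (m + 1 : ℕ))
    rw [← e1] at d3
    exact no_triple_tangency (hD.isDisc _) (hD.isDisc _) (hD.isDisc _) (hD.disjoint _ _ hne')
      (hD.disjoint _ _ n1) (hD.disjoint _ _ n2) (hx.mem_closure _) d3 d1

end Itineraries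

/-! ### Free groups: cyclic reduction and exponents -/

section FreeGroupLemmas

variable {α : Type*}

lemma letter_of (x : α × Bool) : letter FreeGroup.of x = FreeGroup.mk [x] := by
  obtain ⟨i, b⟩ := x
  cases b
  · simp [letter, FreeGroup.of, FreeGroup.invRev]
  · simp [letter, FreeGroup.of]

lemma window_of_eq_mk (x : ℤ → α × Bool) (L : List (α × Bool)) (i : ℤ)
    (h : ∀ (j : ℕ) (hj : j < L.length), x (i + j) = L[j]) :
    window FreeGroup.of x i L.length = FreeGroup.mk L := by
  induction L generalizing i with
  | nil => rfl
  | cons a L ih =>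
    rw [List.length_cons, window_succ, ih]
    · have h0 := h 0 (by simp)
      simp only [Nat.cast_zero, add_zero, List.getElem_cons_zero] at h0
      rw [h0, letter_of, FreeGroup.mul_mk, List.singleton_append]
    · intro j hj
      have := h (j + 1) (by simpa using hj)
      simp only [List.getElem_cons_succ] at this
      rw [← this]
      congr 1; push_cast; ring

/-- Every nontrivial element of a free group is conjugate to a period of a periodic sequence of
letters without cancellation. -/
lemma exists_conj_window (s : FreeGroup α) (hs : s ≠ 1) :
    ∃ (h : FreeGroup α) (k : ℕ) (x : ℤ → α × Bool), 0 < k ∧ (∀ i, x (i + 1) ≠ linv (x i)) ∧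
      (∀ i, x (i + k) = x i) ∧ s = h * window FreeGroup.of x 0 k * h⁻¹ := by
  classical
  set L := FreeGroup.reduceCyclically s.toWord with hL
  set c := FreeGroup.reduceCyclically.conjugator s.toWord with hc
  have hconj := FreeGroup.reduceCyclically.conj_conjugator_reduceCyclically s.toWord
  rw [← hL, ← hc] at hconj
  have hcyc : FreeGroup.IsCyclicallyReduced L :=
    FreeGroup.reduceCyclically.isCyclicallyReduced FreeGroup.isReduced_toWord
  have hs' : s = FreeGroup.mk c * FreeGroup.mk L * (FreeGroup.mk c)⁻¹ := by
    rw [FreeGroup.inv_mk, FreeGroup.mul_mk, FreeGroup.mul_mk, hconj, FreeGroup.mk_toWord]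
  have hLne : L ≠ [] := by
    intro h
    rw [h] at hs'
    apply hs
    rw [hs', ← FreeGroup.one_eq_mk, mul_one, mul_inv_cancel]
  have hpos : 0 < L.length := List.length_pos_iff.2 hLne
  have hpos' : (0 : ℤ) < L.length := by exact_mod_cast hpos
  have hlt : ∀ i : ℤ, (i % (L.length : ℤ)).toNat < L.length := by
    intro i
    have := Int.emod_lt_of_pos i hpos'
    have := Int.emod_nonneg i hpos'.ne'
    omega
  refine ⟨FreeGroup.mk c, L.length, fun i => L[(i % (L.length : ℤ)).toNat]'(hlt i), hpos, ?_, ?_, ?_⟩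
  · intro i h
    have h0 := Int.emod_nonneg i hpos'.ne'
    have h1 := Int.emod_lt_of_pos i hpos'
    have key : ∀ a b : α × Bool, (a.1 = b.1 → a.2 = b.2) → b ≠ linv a := by
      rintro ⟨a, e⟩ b hab rfl
      have := hab rfl
      simp [linv] at this
    have hmod : (i + 1) % (L.length : ℤ) = (i % L.length + 1) % L.length := by simp
    by_cases hend : i % (L.length : ℤ) + 1 = L.length
    · have e2 : ((i + 1) % (L.length : ℤ)).toNat = 0 := by rw [hmod, hend]; simp
      have e1 : (i % (L.length : ℤ)).toNat = L.length - 1 := by omega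
      refine key _ _ (hcyc.2 _ ?_ _ ?_) h
      · rw [List.getLast?_eq_getElem?]
        simp only [e1, Option.mem_def]
        exact List.getElem?_eq_getElem _
      · rw [List.head?_eq_getElem?]
        simp only [e2, Option.mem_def]
        exact List.getElem?_eq_getElem _
    · have e2 : ((i + 1) % (L.length : ℤ)).toNat = (i % (L.length : ℤ)).toNat + 1 := by
        rw [hmod, Int.emod_eq_of_lt (by omega) (by omega)]
        omega
      refine key _ _ ?_ h
      have := List.isChain_iff_getElem.1 hcyc.1 (i % (L.length : ℤ)).toNat (by omega)
      simpa only [e2] using this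
  · intro i
    simp
  · rw [window_of_eq_mk _ L 0]
    · exact hs'
    · intro j hj
      congr 1
      rw [zero_add, Int.emod_eq_of_lt (by omega) (by exact_mod_cast hj)]
      simp

/-- The exponent vector. -/
def expo : FreeGroup (Fin 2) →* Multiplicative (Fin 2 → ℤ) :=
  FreeGroup.lift fun i => Multiplicative.ofAdd (Pi.single i 1)

/-- The exponent of a letter at a generator. -/
def lexp (x : Fin 2 × Bool) (a : Fin 2) : ℤ := if x.1 = a then (if x.2 then 1 else -1) else 0

lemma expo_letter (x : Fin 2 × Bool) (a : Fin 2) :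
    (expo (letter FreeGroup.of x)).toAdd a = lexp x a := by
  obtain ⟨i, b⟩ := x
  cases b <;> by_cases h : i = a <;> simp [letter, expo, lexp, h]

/-- The exponent at `a` of the `k` letters starting at position `i`. -/
def wexp (x : ℤ → Fin 2 × Bool) (a : Fin 2) (i : ℤ) (k : ℕ) : ℤ :=
  ∑ j ∈ Finset.range k, lexp (x (i + j)) a

lemma expo_window (x : ℤ → Fin 2 × Bool) (a : Fin 2) (i : ℤ) (k : ℕ) :
    (expo (window FreeGroup.of x i k)).toAdd a = wexp x a i k := by
  induction k with
  | zero => simp [window, wexp]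
  | succ k ih =>
    rw [window_succ', map_mul, toAdd_mul, Pi.add_apply, ih, expo_letter, wexp, wexp,
      Finset.sum_range_succ]

lemma expo_conj (h s : FreeGroup (Fin 2)) : expo (h * s * h⁻¹) = expo s := by
  rw [map_mul, map_mul, map_inv, mul_right_comm, mul_inv_cancel, one_mul]

/-- The determinant of the exponents of a generating pair is invertible. -/
lemma exists_det_mul_eq_one {s t : FreeGroup (Fin 2)} (h : Subgroup.closure {s, t} = ⊤) :
    ∃ d : ℤ, d * ((expo s).toAdd 0 * (expo t).toAdd 1 - (expo s).toAdd 1 * (expo t).toAdd 0) = 1 := by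
  have key : ∀ u : FreeGroup (Fin 2), ∃ m n : ℤ, ∀ a,
      (expo u).toAdd a = m * (expo s).toAdd a + n * (expo t).toAdd a := by
    intro u
    have hu : expo u ∈ Subgroup.closure {expo s, expo t} := by
      have : u ∈ Subgroup.closure {s, t} := by rw [h]; trivial
      have h2 := Subgroup.mem_map_of_mem expo this
      rwa [MonoidHom.map_closure, Set.image_pair] at h2
    obtain ⟨m, n, hmn⟩ := Subgroup.mem_closure_pair.1 hu
    refine ⟨m, n, fun a => ?_⟩
    rw [← hmn]
    simp
  obtain ⟨a, b, h0⟩ := key (FreeGroup.of 0)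
  obtain ⟨c, d, h1⟩ := key (FreeGroup.of 1)
  have h00 := h0 0
  have h01 := h0 1
  have h10 := h1 0
  have h11 := h1 1
  simp [expo] at h00 h01 h10 h11
  refine ⟨a * d - b * c, ?_⟩
  simp only [expo]
  generalize (Multiplicative.toAdd (FreeGroup.lift _ s) : Fin 2 → ℤ) 0 = s0 at *
  generalize (Multiplicative.toAdd (FreeGroup.lift _ s) : Fin 2 → ℤ) 1 = s1 at *
  generalize (Multiplicative.toAdd (FreeGroup.lift _ t) : Fin 2 → ℤ) 0 = t0 at *
  generalize (Multiplicative.toAdd (FreeGroup.lift _ t) : Fin 2 → ℤ) 1 = t1 at *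
  linear_combination -(c * s1 + d * t1) * h00 - h11 + (c * s0 + d * t0) * h01

lemma wexp_succ (x : ℤ → Fin 2 × Bool) (a : Fin 2) (i : ℤ) (k : ℕ) :
    wexp x a i (k + 1) = wexp x a i k + lexp (x (i + k)) a := Finset.sum_range_succ _ _

lemma wexp_succ' (x : ℤ → Fin 2 × Bool) (a : Fin 2) (i : ℤ) (k : ℕ) :
    wexp x a i (k + 1) = wexp x a (i + 1) k + lexp (x i) a := by
  rw [wexp, Finset.sum_range_succ']
  congr 1
  · refine Finset.sum_congr rfl fun j _ => ?_
    congr 2; push_cast; ring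
  · simp

lemma wexp_eq_of_periodic {x : ℤ → Fin 2 × Bool} {k : ℕ} (hx : ∀ i, x (i + k) = x i) (a : Fin 2)
    (i : ℤ) : wexp x a i k = wexp x a 0 k := by
  have step : ∀ i, wexp x a (i + 1) k = wexp x a i k := by
    intro i
    have h1 := wexp_succ x a i k
    rw [wexp_succ', hx] at h1
    linarith
  induction i using Int.induction_on with
  | zero => rfl
  | succ i ih => rw [step, ih]
  | pred i ih => rw [← ih, ← step, sub_add_cancel]

lemma wexp_mul {x : ℤ → Fin 2 × Bool} {k : ℕ} (hx : ∀ i, x (i + k) = x i) (a : Fin 2)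
    (i : ℤ) (n : ℕ) : wexp x a i (n * k) = n * wexp x a 0 k := by
  induction n with
  | zero => simp [wexp]
  | succ n ih =>
    have : wexp x a i ((n + 1) * k) = wexp x a i (n * k) + wexp x a (i + (n * k : ℕ)) k := by
      rw [add_mul, one_mul, wexp, Finset.sum_range_add, wexp, wexp]
      congr 1
      refine Finset.sum_congr rfl fun j _ => ?_
      congr 2; push_cast; ring
    rw [this, ih, wexp_eq_of_periodic hx a (i + _)]
    push_cast; ring

lemma lexp_linv (x : Fin 2 × Bool) (a : Fin 2) : lexp (linv x) a = -lexp x a := by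
  obtain ⟨i, b⟩ := x
  cases b <;> by_cases h : i = a <;> simp [lexp, linv, h]

/-- A free group generated by two elements has rank at most two. -/
lemma rank_le_two {n : ℕ} {s t : FreeGroup (Fin n)} (h : Subgroup.closure {s, t} = ⊤) : n ≤ 2 := by
  let f : FreeGroup (Fin n) →* Multiplicative (Fin n → ℚ) :=
    FreeGroup.lift fun i => Multiplicative.ofAdd (Pi.single i 1)
  have key : ∀ u : FreeGroup (Fin n),
      (f u).toAdd ∈ Submodule.span ℚ {(f s).toAdd, (f t).toAdd} := by
    intro u
    have hu : f u ∈ Subgroup.closure {f s, f t} := by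
      have : u ∈ Subgroup.closure {s, t} := by rw [h]; trivial
      have h2 := Subgroup.mem_map_of_mem f this
      rwa [MonoidHom.map_closure, Set.image_pair] at h2
    obtain ⟨a, b, hab⟩ := Subgroup.mem_closure_pair.1 hu
    rw [← hab, toAdd_mul, toAdd_zpow, toAdd_zpow]
    exact add_mem (zsmul_mem (Submodule.subset_span (by simp)) _)
      (zsmul_mem (Submodule.subset_span (by simp)) _)
  have htop : Submodule.span ℚ {(f s).toAdd, (f t).toAdd} = ⊤ := by
    rw [eq_top_iff, ← (Pi.basisFun ℚ (Fin n)).span_eq, Submodule.span_le]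
    rintro _ ⟨i, rfl⟩
    have := key (FreeGroup.of i)
    simpa [f] using this
  have hcard := finrank_span_finset_le_card (R := ℚ) ({(f s).toAdd, (f t).toAdd} : Finset (Fin n → ℚ))
  rw [Finset.coe_pair, Set.finrank, htop, finrank_top, Module.finrank_fin_fun] at hcard
  exact hcard.trans Finset.card_le_two

/-! ### Bases of a free group of rank two containing a generator -/

/-- The reduced word of `f` is nonempty, starts with a letter of type `p` and ends with a letter of
type `q`. -/
def StartsEnds (p q : Fin 2) (f : FreeGroup (Fin 2)) : Prop :=
  (∃ x ∈ f.toWord.head?, x.1 = p) ∧ ∃ x ∈ f.toWord.getLast?, x.1 = q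

lemma StartsEnds.toWord_mul {p q r s : Fin 2} {f g : FreeGroup (Fin 2)} (hf : StartsEnds p q f)
    (hg : StartsEnds r s g) (h : q ≠ r) : (f * g).toWord = f.toWord ++ g.toWord := by
  rw [FreeGroup.toWord_mul, ← FreeGroup.isReduced_iff_reduce_eq, FreeGroup.IsReduced,
    List.isChain_append]
  refine ⟨FreeGroup.isReduced_toWord, FreeGroup.isReduced_toWord, ?_⟩
  obtain ⟨-, x, hx, rfl⟩ := hf
  obtain ⟨⟨y, hy, rfl⟩, -⟩ := hg
  intro a ha b hb hab
  rw [Option.mem_def] at hx hy ha hb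
  rw [hx] at ha
  rw [hy] at hb
  cases ha; cases hb
  exact absurd hab h

lemma StartsEnds.mul {p q r s : Fin 2} {f g : FreeGroup (Fin 2)} (hf : StartsEnds p q f)
    (hg : StartsEnds r s g) (h : q ≠ r) : StartsEnds p s (f * g) := by
  rw [StartsEnds, hf.toWord_mul hg h]
  obtain ⟨⟨x, hx, hxp⟩, -⟩ := hf
  obtain ⟨-, y, hy, hyq⟩ := hg
  refine ⟨⟨x, List.mem_head?_append_of_mem_head? hx, hxp⟩,
    ⟨y, List.mem_getLast?_append_of_mem_getLast? hy, hyq⟩⟩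

lemma StartsEnds.inv {p q : Fin 2} {f : FreeGroup (Fin 2)} (hf : StartsEnds p q f) :
    StartsEnds q p f⁻¹ := by
  obtain ⟨⟨x, hx, hxp⟩, y, hy, hyq⟩ := hf
  rw [Option.mem_def] at hx hy
  rw [StartsEnds, FreeGroup.toWord_inv]
  refine ⟨⟨linv y, ?_, hyq⟩, linv x, ?_, hxp⟩
  · simp [FreeGroup.invRev, linv, hy]
  · simp [FreeGroup.invRev, linv, hx]

lemma StartsEnds.pow {p q : Fin 2} {f : FreeGroup (Fin 2)} (hf : StartsEnds p q f) (n : ℕ) :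
    StartsEnds p q (f ^ (n + 1)) := by
  set c := FreeGroup.reduceCyclically.conjugator f.toWord with hc
  set L := FreeGroup.reduceCyclically f.toWord with hL
  have hconj := FreeGroup.reduceCyclically.conj_conjugator_reduceCyclically f.toWord
  rw [← hL, ← hc] at hconj
  have hw : (f ^ (n + 1)).toWord = c ++ (List.replicate (n + 1) L).flatten ++ FreeGroup.invRev c := by
    rw [FreeGroup.toWord_pow,
      FreeGroup.reduceCyclically.reduce_flatten_replicate_succ FreeGroup.isReduced_toWord]
  have hLne : L ≠ [] := by
    intro h
    have hf1 : f = 1 := by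
      rw [← FreeGroup.mk_toWord (x := f), ← hconj, h, List.append_nil, ← FreeGroup.mul_mk,
        ← FreeGroup.inv_mk, mul_inv_cancel]
    obtain ⟨⟨x, hx, -⟩, -⟩ := hf
    rw [hf1] at hx
    simp at hx
  have h1 : (f ^ (n + 1)).toWord.head? = f.toWord.head? := by
    rw [hw, ← hconj, List.append_assoc, List.append_assoc, List.head?_append, List.head?_append,
      List.head?_append, List.head?_append, List.head?_flatten_replicate (by simp)]
  have h2 : (f ^ (n + 1)).toWord.getLast? = f.toWord.getLast? := by
    rw [hw, ← hconj, List.getLast?_append, List.getLast?_append, List.getLast?_append,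
      List.getLast?_append, List.getLast?_flatten_replicate (by simp)]
  rw [StartsEnds, h1, h2]
  exact hf

lemma StartsEnds.zpow {p : Fin 2} {f : FreeGroup (Fin 2)} (hf : StartsEnds p p f) {n : ℤ}
    (hn : n ≠ 0) : StartsEnds p p (f ^ n) := by
  obtain ⟨m, rfl | rfl⟩ := n.eq_nat_or_neg
  · obtain ⟨l, rfl⟩ := Nat.exists_eq_succ_of_ne_zero (n := m) (by simpa using hn)
    rw [zpow_natCast]
    exact hf.pow l
  · obtain ⟨l, rfl⟩ := Nat.exists_eq_succ_of_ne_zero (n := m) (by simpa using hn)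
    rw [zpow_neg, zpow_natCast]
    exact (hf.pow l).inv

lemma startsEnds_of (i : Fin 2) : StartsEnds i i (FreeGroup.of i) := by
  simp [StartsEnds]

lemma mk_eq_zpow {i : Fin 2} (L : List (Fin 2 × Bool)) (h : ∀ x ∈ L, x.1 = i) :
    ∃ m : ℤ, FreeGroup.mk L = FreeGroup.of i ^ m := by
  induction L with
  | nil => exact ⟨0, rfl⟩
  | cons x L ih =>
    obtain ⟨m, hm⟩ := ih fun y hy => h y (List.mem_cons_of_mem _ hy)
    obtain ⟨e, he⟩ : ∃ e : ℤ, FreeGroup.mk [x] = FreeGroup.of i ^ e := by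
      obtain ⟨j, b⟩ := x
      have : j = i := h (j, b) (by simp)
      subst this
      rw [← letter_of]
      cases b
      · exact ⟨-1, by simp [letter]⟩
      · exact ⟨1, by simp [letter]⟩
    refine ⟨e + m, ?_⟩
    rw [zpow_add, ← he, ← hm, FreeGroup.mul_mk, List.singleton_append]

/-- Stripping powers of the generator `i` from both ends. -/
lemma exists_strip {i j : Fin 2} (hij : i ≠ j) (t : FreeGroup (Fin 2)) :
    (∃ m : ℤ, t = FreeGroup.of i ^ m) ∨ ∃ (m n : ℤ) (u : FreeGroup (Fin 2)),
      t = FreeGroup.of i ^ m * u * FreeGroup.of i ^ n ∧ StartsEnds j j u := by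
  have hj : ∀ a : Fin 2, a ≠ i → a = j := by omega
  set w := t.toWord with hw
  set A := w.takeWhile (fun x => decide (x.1 = i)) with hA
  set R := w.dropWhile (fun x => decide (x.1 = i)) with hR
  set M := R.rdropWhile (fun x => decide (x.1 = i)) with hM
  set B := R.rtakeWhile (fun x => decide (x.1 = i)) with hB
  have hAR : A ++ R = w := List.takeWhile_append_dropWhile
  have hMB : M ++ B = R := List.rdropWhile_append_rtakeWhile ..
  obtain ⟨m, hm⟩ := mk_eq_zpow (i := i) A fun x hx => by simpa using List.mem_takeWhile_imp hx
  obtain ⟨n, hn⟩ := mk_eq_zpow (i := i) B fun x hx => by simpa using List.mem_rtakeWhile_imp hx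
  have ht : t = FreeGroup.of i ^ m * FreeGroup.mk M * FreeGroup.of i ^ n := by
    rw [← hm, ← hn, FreeGroup.mul_mk, FreeGroup.mul_mk, List.append_assoc, hMB, hAR,
      FreeGroup.mk_toWord]
  by_cases hMe : M = []
  · left
    refine ⟨m + n, ?_⟩
    rw [ht, hMe, ← FreeGroup.one_eq_mk, mul_one, zpow_add]
  · right
    refine ⟨m, n, _, ht, ?_⟩
    have hMr : FreeGroup.IsReduced M :=
      (FreeGroup.isReduced_toWord (x := t)).infix ⟨A, B, by rw [List.append_assoc, hMB, hAR]⟩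
    rw [StartsEnds, FreeGroup.toWord_mk, hMr.reduce_eq]
    constructor
    · refine ⟨M.head hMe, List.head_mem_head? hMe, hj _ ?_⟩
      have hRne : R ≠ [] := by
        intro h
        rw [h] at hMB
        exact hMe (List.append_eq_nil_iff.1 hMB).1
      have hh : M.head hMe = R.head hRne := by
        have : R.head? = M.head? := by
          rw [← hMB, List.head?_append_of_ne_nil _ hMe]
        rw [List.head?_eq_some_head hMe, List.head?_eq_some_head hRne] at this
        exact (Option.some.inj this).symm
      have := List.head_dropWhile_not (fun x : Fin 2 × Bool => decide (x.1 = i)) hRne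
      rw [hh]
      simpa using this
    · refine ⟨M.getLast hMe, List.getLast_mem_getLast? hMe, hj _ ?_⟩
      have := List.rdropWhile_last_not (fun x : Fin 2 × Bool => decide (x.1 = i)) R hMe
      simpa using this

/-- If a generator `a = of i` and `t` generate the free group on `a, b`, then
`t = a ^ m * b ^ (± 1) * a ^ n`. -/
lemma exists_eq_of_closure_eq_top {i j : Fin 2} (hij : i ≠ j) {t : FreeGroup (Fin 2)}
    (h : Subgroup.closure {FreeGroup.of i, t} = ⊤) :
    ∃ (m n : ℤ) (b : Bool), t = FreeGroup.of i ^ m * letter FreeGroup.of (j, b) *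
      FreeGroup.of i ^ n := by
  have hj : ∀ a : Fin 2, a ≠ i → a = j := by omega
  have hexpi : (expo (FreeGroup.of i)).toAdd j = 0 := by simp [expo, hij.symm]
  have hexpj : (expo (FreeGroup.of j)).toAdd j = 1 := by simp [expo]
  rcases exists_strip hij t with ⟨m, rfl⟩ | ⟨m, n, u, rfl, hu⟩
  · exfalso
    have : FreeGroup.of j ∈ Subgroup.closure {FreeGroup.of i, FreeGroup.of i ^ m} := by
      rw [h]; trivial
    have hle : Subgroup.closure {FreeGroup.of i, FreeGroup.of i ^ m} ≤
        Subgroup.zpowers (FreeGroup.of i) := by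
      rw [Subgroup.closure_le, Set.pair_subset_iff]
      exact ⟨Subgroup.mem_zpowers _, Subgroup.zpow_mem_zpowers _ _⟩
    obtain ⟨k, hk⟩ := Subgroup.mem_zpowers_iff.1 (hle this)
    have := congrArg (fun f => (expo f).toAdd j) hk
    simp only [map_zpow, toAdd_zpow, Pi.smul_apply, hexpi, hexpj] at this
    simp at this
  · let v : Fin 2 → FreeGroup (Fin 2) := fun p => if p = i then FreeGroup.of i else u
    let ψ : ∀ _ : Fin 2, Multiplicative ℤ →* FreeGroup (Fin 2) := fun p => zpowersHom _ (v p)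
    have hv : ∀ p, StartsEnds p p (v p) := by
      intro p
      by_cases hp : p = i
      · subst hp
        simp only [v, if_true]
        exact startsEnds_of _
      · simp only [v, if_neg hp]
        rw [hj p hp]
        exact hu
    have hmem : FreeGroup.of j ∈ (Monoid.CoprodI.lift ψ).range := by
      have hi : FreeGroup.of i ∈ (Monoid.CoprodI.lift ψ).range :=
        ⟨Monoid.CoprodI.of (i := i) (Multiplicative.ofAdd 1), by simp [ψ, v]⟩
      have hu' : u ∈ (Monoid.CoprodI.lift ψ).range :=
        ⟨Monoid.CoprodI.of (i := j) (Multiplicative.ofAdd 1), by simp [ψ, v, hij.symm]⟩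
      have : Subgroup.closure {FreeGroup.of i, FreeGroup.of i ^ m * u * FreeGroup.of i ^ n} ≤
          (Monoid.CoprodI.lift ψ).range := by
        rw [Subgroup.closure_le, Set.pair_subset_iff]
        exact ⟨hi, mul_mem (mul_mem (zpow_mem hi _) hu') (zpow_mem hi _)⟩
      rw [h] at this
      exact this trivial
    obtain ⟨c, hc⟩ := hmem
    have key : ∀ {p q : Fin 2} (w : Monoid.CoprodI.NeWord (fun _ : Fin 2 => Multiplicative ℤ) p q),
        StartsEnds p q (Monoid.CoprodI.lift ψ w.prod) ∧
        (2 ≤ (Monoid.CoprodI.lift ψ w.prod).toWord.length ∨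
          ∃ k : ℤ, Monoid.CoprodI.lift ψ w.prod = v p ^ k) := by
      intro p q w
      induction w with
      | @singleton p x hx =>
        have hl : Monoid.CoprodI.lift ψ (Monoid.CoprodI.NeWord.singleton
            (M := fun _ : Fin 2 => Multiplicative ℤ) (i := p) x hx).prod =
            v p ^ x.toAdd := by
          simp [ψ, Monoid.CoprodI.NeWord.prod_singleton, zpowersHom_apply]
        rw [hl]
        exact ⟨(hv p).zpow (by simpa using hx), Or.inr ⟨_, rfl⟩⟩
      | append w₁ hne w₂ ih₁ ih₂ =>
        rw [Monoid.CoprodI.NeWord.append_prod, map_mul]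
        refine ⟨ih₁.1.mul ih₂.1 hne, Or.inl ?_⟩
        rw [ih₁.1.toWord_mul ih₂.1 hne, List.length_append]
        have l : ∀ {p q : Fin 2} {f : FreeGroup (Fin 2)}, StartsEnds p q f → 1 ≤ f.toWord.length := by
          rintro p q f ⟨⟨x, hx, -⟩, -⟩
          rw [Nat.one_le_iff_ne_zero, Ne, List.length_eq_zero_iff]
          intro h0
          simp [h0] at hx
        have := l ih₁.1
        have := l ih₂.1
        omega
    have hw : Monoid.CoprodI.Word.equiv c ≠ Monoid.CoprodI.Word.empty := by
      intro h0
      have hc1 : c = 1 := by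
        have := congrArg Monoid.CoprodI.Word.equiv.symm h0
        rw [Equiv.symm_apply_apply] at this
        rw [this]
        rfl
      rw [hc1, map_one] at hc
      exact FreeGroup.one_ne_of j hc
    obtain ⟨p, q, w, hwc⟩ := Monoid.CoprodI.NeWord.of_word _ hw
    have hcw : w.prod = c := by
      have := congrArg Monoid.CoprodI.Word.equiv.symm hwc
      rw [Equiv.symm_apply_apply] at this
      exact this
    obtain ⟨⟨⟨x, hx, hxp⟩, -⟩, hor⟩ := key w
    rw [hcw, hc] at hor hx
    simp only [FreeGroup.toWord_of, List.head?_cons, Option.mem_def, Option.some.injEq] at hx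
    subst hx
    simp only at hxp
    subst hxp
    rcases hor with h2 | ⟨k, hk⟩
    · simp at h2
    · simp only [v, if_neg hij.symm] at hk
      have he := congrArg (fun f => (expo f).toAdd j) hk
      simp only [map_zpow, toAdd_zpow, Pi.smul_apply, hexpj, smul_eq_mul] at he
      rcases Int.eq_one_or_neg_one_of_mul_eq_one he.symm with rfl | rfl
      · exact ⟨m, n, true, by rw [zpow_one] at hk; simp [letter, hk]⟩
      · exact ⟨m, n, false, by rw [zpow_neg, zpow_one] at hk; simp [letter, hk]⟩

end FreeGroupLemmas

/-! ### Parabolic bases of classical T-Schottky groups -/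

lemma PingPong.lift_injective {α : Type*} [Nontrivial α] {g : α → Equiv.Perm Sphere}
    {D : α × Bool → Set Sphere} (hD : PingPong g D) : Function.Injective (FreeGroup.lift g) := by
  rw [injective_iff_map_eq_one]
  intro s hs
  by_contra hne
  obtain ⟨h, k, x, hk, hx, -, rfl⟩ := exists_conj_window s hne
  have hw : window g x 0 k = 1 := by
    have e : (fun i => FreeGroup.lift g (FreeGroup.of i)) = g := by funext i; simp
    rw [map_mul, map_mul, map_inv, conj_eq_one_iff, map_window, e] at hs
    exact hs
  obtain ⟨l, rfl⟩ : ∃ l, k = l + 1 := ⟨k - 1, by omega⟩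
  obtain ⟨y, hy0, hyl⟩ := exists_third_letter (x 0) (linv (x (0 + l)))
  have hsub := hD.window_image_subset hx l 0 hyl
  rw [hw] at hsub
  obtain ⟨z, hz⟩ := (hD.isDisc y).nonempty
  exact Set.disjoint_left.1 (hD.disjoint _ _ hy0) hz (hsub ⟨z, hz, rfl⟩)

/-- A numbering of the four letters, in which inversion flips the last bit. -/
def code (x : Fin 2 × Bool) : ℕ := 2 * x.1 + x.2.toNat

/-- The unordered pair of discs whose tangency lies between consecutive letters `b`, `a`. -/
def edgeMask (a b : ℕ) : ℕ := 2 ^ a + 2 ^ (b ^^^ 1)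

set_option synthInstance.maxHeartbeats 400000 in
set_option synthInstance.maxSize 100000 in
lemma edgeMask_eq : ∀ a b c d : Fin 2 × Bool, a ≠ linv b → c ≠ linv d →
    edgeMask (code a) (code b) = edgeMask (code c) (code d) →
    (a = c ∧ b = d) ∨ (a = linv d ∧ c = linv b) := by
  unfold edgeMask code linv
  decide

lemma edgeMask_mem : ∀ a b : Fin 2 × Bool, a ≠ linv b →
    edgeMask (code a) (code b) ∈ ({3, 5, 6, 9, 10, 12} : Finset ℕ) := by
  unfold edgeMask code linv
  decide

/-- The tangency between positions `i - 1` and `i` of a sequence of letters. -/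
def edgeAt (x : ℤ → Fin 2 × Bool) (i : ℤ) : ℕ := edgeMask (code (x i)) (code (x (i - 1)))

section Edges

variable {g : Fin 2 → Equiv.Perm Sphere} {D : Fin 2 × Bool → Set Sphere} {k l : ℕ}
  {x y : ℤ → Fin 2 × Bool} {p q : ℤ → Sphere}

lemma Itinerary.ne_linv {α : Type*} {g : α → Equiv.Perm Sphere} {D : α × Bool → Set Sphere}
    {x : ℤ → α × Bool} (hx : Itinerary g D k x p) (i : ℤ) : x i ≠ linv (x (i - 1)) := by
  have := hx.reduced (i - 1)
  rwa [sub_add_cancel] at this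

lemma wexp_reverse {x : ℤ → Fin 2 × Bool} (hx : ∀ i, x (i + k) = x i) (a : Fin 2) :
    wexp (fun i => linv (x (-1 - i))) a 0 k = -wexp x a 0 k := by
  rw [← wexp_eq_of_periodic hx a (-k), wexp, wexp, ← Finset.sum_neg_distrib,
    ← Finset.sum_range_reflect]
  refine Finset.sum_congr rfl fun j hj => ?_
  rw [Finset.mem_range] at hj
  rw [lexp_linv]
  congr 3
  omega

/-- Itineraries that share a tangency have proportional exponents. -/
lemma Itinerary.wexp_of_edgeAt_eq (hD : PingPong g D) (hx : Itinerary g D k x p)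
    (hy : Itinerary g D l y q) {i j : ℤ} (h : edgeAt x i = edgeAt y j) :
    ((∀ m : ℕ, x (i + m) = y (j + m)) ∧ ∀ a, l * wexp x a 0 k = k * wexp y a 0 l) ∨
      ∀ a, l * wexp x a 0 k = -(k * wexp y a 0 l) := by
  have key : ∀ {y : ℤ → Fin 2 × Bool} {q : ℤ → Sphere} {j : ℤ}, Itinerary g D l y q → x i = y j →
      x (i - 1) = y (j - 1) → ∀ a, l * wexp x a 0 k = k * wexp y a 0 l := by
    intro y q j hy h1 h2 a
    have hm := hx.eq_of_eq hD hy h1 h2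
    rw [← wexp_mul hx.periodic a i l, ← wexp_mul hy.periodic a j k, mul_comm k l]
    exact Finset.sum_congr rfl fun m _ => by rw [hm]
  rcases edgeMask_eq _ _ _ _ (hx.ne_linv i) (hy.ne_linv j) h with ⟨h1, h2⟩ | ⟨h1, h2⟩
  · exact Or.inl ⟨hx.eq_of_eq hD hy h1 h2, key hy h1 h2⟩
  · right
    intro a
    have := key (j := -j) hy.reverse (by rw [h1]; congr 2; ring)
      (by rw [← linv_linv (x (i - 1)), ← h2]; congr 2; ring) a
    rw [wexp_reverse hy.periodic] at this
    rw [this]; ring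

lemma Itinerary.edgeAt_ne (hD : PingPong g D) (hx : Itinerary g D k x p)
    (hy : Itinerary g D l y q)
    (hdet : wexp x 0 0 k * wexp y 1 0 l - wexp x 1 0 k * wexp y 0 0 l ≠ 0) (i j : ℤ) :
    edgeAt x i ≠ edgeAt y j := by
  intro h
  have hl : (l : ℤ) ≠ 0 := by exact_mod_cast hy.pos.ne'
  apply hdet
  apply mul_left_cancel₀ hl
  rcases hx.wexp_of_edgeAt_eq hD hy h with ⟨-, h⟩ | h
  · linear_combination wexp y 1 0 l * h 0 - wexp y 0 0 l * h 1
  · linear_combination wexp y 1 0 l * h 0 - wexp y 0 0 l * h 1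

lemma Itinerary.edgeAt_injOn (hD : PingPong g D) (hx : Itinerary g D k x p) {a b d : ℤ}
    (hdet : d * (wexp x 0 0 k * b - wexp x 1 0 k * a) = 1) {i j : ℤ} (hij : i < j)
    (hjk : j < i + k) : edgeAt x i ≠ edgeAt x j := by
  intro h
  have hk : (k : ℤ) ≠ 0 := by exact_mod_cast hx.pos.ne'
  rcases hx.wexp_of_edgeAt_eq hD hx h with ⟨hm, -⟩ | h
  · obtain ⟨e, he⟩ : ∃ e : ℕ, j = i + e := ⟨(j - i).toNat, by omega⟩
    subst he
    have hper : ∀ (n : ℤ) (N : ℕ), x (n + N * k) = x n := by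
      intro n N
      induction N with
      | zero => simp
      | succ N ih =>
        rw [← ih, ← hx.periodic (n + N * k)]
        congr 1; push_cast; ring
    have hper' : ∀ n : ℤ, x (n + e) = x n := by
      intro n
      set N := (i - n).toNat
      have hN : i ≤ n + N * k := by
        have h1 : i - n ≤ N := Int.self_le_toNat _
        have h2 : (1 : ℤ) ≤ k := by have := hx.pos; omega
        nlinarith
      obtain ⟨m, hm'⟩ : ∃ m : ℕ, n + N * k = i + m := ⟨(n + N * k - i).toNat, by omega⟩
      rw [← hper n N, hm', hm m, ← hper (n + e) N]
      congr 1
      linear_combination hm'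
    have hs : ∀ c, e * wexp x c 0 k = k * wexp x c 0 e := by
      intro c
      rw [← wexp_mul hx.periodic c i e, ← wexp_mul hper' c i k, mul_comm k e]
    have hdvd : (k : ℤ) ∣ e :=
      ⟨d * (wexp x 0 0 e * b - wexp x 1 0 e * a), by
        linear_combination -e * hdet + d * b * hs 0 - d * a * hs 1⟩
    have := Int.le_of_dvd (by omega) hdvd
    omega
  · have h0 : ∀ c, wexp x c 0 k = 0 := by
      intro c
      have := h c
      have h2 : (k : ℤ) * (2 * wexp x c 0 k) = 0 := by linear_combination this
      have := (mul_eq_zero.1 h2).resolve_left hk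
      linarith
    rw [h0, h0] at hdet
    simp at hdet

/-! ### The enumeration of short pairs of words -/

/-- All words of length `n` in the codes of the letters. -/
def codeWords : ℕ → List (List ℕ)
  | 0 => [[]]
  | n + 1 => (codeWords n).flatMap fun u => [0 :: u, 1 :: u, 2 :: u, 3 :: u]

/-- The tangencies of a cyclic word. -/
def codeEdges (u : List ℕ) : List ℕ := List.zipWith edgeMask u (u.getLastD 0 :: u)

/-- The exponent of the first generator. -/
def codeExp (u : List ℕ) : ℤ := (u.map fun c => if c = 1 then 1 else if c = 0 then -1 else 0).sum

/-- The exponent of the second generator. -/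
def codeExp' (u : List ℕ) : ℤ := (u.map fun c => if c = 3 then 1 else if c = 2 then -1 else 0).sum

/-- The cyclically reduced words of length two to four without repeated tangencies. -/
def goodWords : List (List ℕ) :=
  (codeWords 2 ++ codeWords 3 ++ codeWords 4).filter fun u =>
    (codeEdges u).all (fun e => [3, 5, 6, 9, 10, 12].contains e) && decide (codeEdges u).Nodup

lemma goodWords_check : (goodWords.all fun u => goodWords.all fun v =>
    !((codeExp u * codeExp' v - codeExp' u * codeExp v).natAbs == 1) ||
      !decide ((codeEdges u ++ codeEdges v).Nodup)) = true := by
  decide +kernel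

lemma mem_codeWords : ∀ {n : ℕ} {u : List ℕ}, u.length = n → (∀ c ∈ u, c < 4) → u ∈ codeWords n
  | 0, u, h, _ => by simp [codeWords, List.length_eq_zero_iff.1 h]
  | n + 1, [], h, _ => by simp at h
  | n + 1, c :: u, h, hc => by
    rw [codeWords, List.mem_flatMap]
    refine ⟨u, mem_codeWords (by simpa using h) fun d hd => hc d (List.mem_cons_of_mem _ hd), ?_⟩
    have : c < 4 := hc c (by simp)
    interval_cases c <;> simp

/-- The code of a period of a sequence. -/
def codeOf (x : ℤ → Fin 2 × Bool) (k : ℕ) : List ℕ := (List.range k).map fun j : ℕ => code (x j)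

lemma codeEdges_codeOf (hx : ∀ i, x (i + k) = x i) :
    codeEdges (codeOf x k) = (List.range k).map fun j : ℕ => edgeAt x j := by
  apply List.ext_getElem
  · simp [codeEdges, codeOf]
  · intro j h1 h2
    have hj : j < k := by simpa using h2
    simp only [codeEdges, List.getElem_zipWith]
    rcases j with _ | j
    · obtain ⟨m, rfl⟩ : ∃ m, k = m + 1 := ⟨k - 1, by omega⟩
      simp only [codeOf, List.getElem_map, List.getElem_range, List.getElem_cons_zero, edgeAt]
      congr 1
      rw [List.range_succ, List.map_append, List.map_singleton, List.getLastD_concat]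
      rw [← hx (((0 : ℕ) : ℤ) - 1)]
      congr 2; push_cast; ring
    · simp only [codeOf, List.getElem_map, List.getElem_range, List.getElem_cons_succ, edgeAt]
      congr 3; push_cast; ring

lemma sum_map_range_eq (f : ℕ → ℤ) (k : ℕ) :
    ((List.range k).map f).sum = ∑ j ∈ Finset.range k, f j := by
  induction k with
  | zero => rfl
  | succ k ih => rw [List.range_succ, Finset.sum_range_succ, List.map_append, List.sum_append, ih]; simp

lemma codeExp_codeOf : codeExp (codeOf x k) = wexp x 0 0 k := by
  rw [codeExp, codeOf, List.map_map, sum_map_range_eq, wexp]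
  refine Finset.sum_congr rfl fun j _ => ?_
  rw [zero_add]
  have key : ∀ c : Fin 2 × Bool,
      (if code c = 1 then (1 : ℤ) else if code c = 0 then -1 else 0) = lexp c 0 := by
    unfold code lexp
    decide
  exact key _

lemma codeExp'_codeOf : codeExp' (codeOf x k) = wexp x 1 0 k := by
  rw [codeExp', codeOf, List.map_map, sum_map_range_eq, wexp]
  refine Finset.sum_congr rfl fun j _ => ?_
  rw [zero_add]
  have key : ∀ c : Fin 2 × Bool,
      (if code c = 3 then (1 : ℤ) else if code c = 2 then -1 else 0) = lexp c 1 := by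
    unfold code lexp
    decide
  exact key _

/-- One of two parabolic itineraries with unimodular exponents consists of a single letter. -/
lemma Itinerary.length_eq_one (hD : PingPong g D) (hx : Itinerary g D k x p)
    (hy : Itinerary g D l y q) {d : ℤ}
    (hdet : d * (wexp x 0 0 k * wexp y 1 0 l - wexp x 1 0 k * wexp y 0 0 l) = 1) :
    k = 1 ∨ l = 1 := by
  by_contra hkl
  push Not at hkl
  have hne : wexp x 0 0 k * wexp y 1 0 l - wexp x 1 0 k * wexp y 0 0 l ≠ 0 := by
    intro h; rw [h] at hdet; simp at hdet
  have nodup1 : ∀ {x : ℤ → Fin 2 × Bool} {k : ℕ} {p : ℤ → Sphere} {a b d : ℤ},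
      Itinerary g D k x p → d * (wexp x 0 0 k * b - wexp x 1 0 k * a) = 1 →
      (codeEdges (codeOf x k)).Nodup := by
    intro x k p a b d hx hdet
    rw [codeEdges_codeOf hx.periodic]
    refine List.Nodup.map_on ?_ List.nodup_range
    intro i hi j hj hij
    rw [List.mem_range] at hi hj
    by_contra hne
    rcases lt_or_gt_of_ne hne with h | h
    · exact hx.edgeAt_injOn hD hdet (i := i) (j := j) (by omega) (by omega) hij
    · exact hx.edgeAt_injOn hD hdet (i := j) (j := i) (by omega) (by omega) hij.symm
  have n1 := nodup1 hx hdet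
  have n2 := nodup1 (a := -wexp x 0 0 k) (b := -wexp x 1 0 k) (d := d) hy
    (by linear_combination hdet)
  have hdisj : (codeEdges (codeOf x k) ++ codeEdges (codeOf y l)).Nodup := by
    refine List.Nodup.append n1 n2 ?_
    rw [codeEdges_codeOf hx.periodic, codeEdges_codeOf hy.periodic]
    intro e he he'
    obtain ⟨i, -, rfl⟩ := List.mem_map.1 he
    obtain ⟨j, -, hj⟩ := List.mem_map.1 he'
    exact hx.edgeAt_ne hD hy hne i j hj.symm
  have mem1 : ∀ {x : ℤ → Fin 2 × Bool} {k : ℕ} {p : ℤ → Sphere}, Itinerary g D k x p →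
      ∀ e ∈ codeEdges (codeOf x k), e ∈ ({3, 5, 6, 9, 10, 12} : Finset ℕ) := by
    intro x k p hx e he
    rw [codeEdges_codeOf hx.periodic] at he
    obtain ⟨i, -, rfl⟩ := List.mem_map.1 he
    exact edgeMask_mem _ _ (hx.ne_linv i)
  have hlen : k + l ≤ 6 := by
    have h1 : (codeEdges (codeOf x k) ++ codeEdges (codeOf y l)).toFinset ⊆
        ({3, 5, 6, 9, 10, 12} : Finset ℕ) := by
      intro e he
      rw [List.mem_toFinset, List.mem_append] at he
      exact he.elim (mem1 hx e) (mem1 hy e)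
    have h2 := Finset.card_le_card h1
    rw [List.toFinset_card_of_nodup hdisj, List.length_append, codeEdges_codeOf hx.periodic,
      codeEdges_codeOf hy.periodic] at h2
    simpa using h2
  have hxp := hx.pos
  have hyp := hy.pos
  have good : ∀ {x : ℤ → Fin 2 × Bool} {k : ℕ} {p : ℤ → Sphere}, Itinerary g D k x p →
      (codeEdges (codeOf x k)).Nodup → 2 ≤ k → k ≤ 4 → codeOf x k ∈ goodWords := by
    intro x k p hx hn h2 h4
    rw [goodWords, List.mem_filter, Bool.and_eq_true, List.all_eq_true, decide_eq_true_iff]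
    refine ⟨?_, ?_, hn⟩
    · have : codeOf x k ∈ codeWords k := by
        refine mem_codeWords (by simp [codeOf]) ?_
        intro c hc
        obtain ⟨j, -, rfl⟩ := List.mem_map.1 hc
        generalize x j = c
        revert c
        unfold code
        decide
      have : k = 2 ∨ k = 3 ∨ k = 4 := by omega
      rcases this with rfl | rfl | rfl <;> simp [*]
    · intro e he
      have := mem1 hx e he
      simpa using this
  have g1 := good hx n1 (by omega) (by omega)
  have g2 := good hy n2 (by omega) (by omega)
  have hcheck := List.all_eq_true.1 (List.all_eq_true.1 goodWords_check _ g1) _ g2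
  rw [Bool.or_eq_true, Bool.not_eq_true', Bool.not_eq_true', codeExp_codeOf, codeExp_codeOf,
    codeExp'_codeOf, codeExp'_codeOf, decide_eq_false_iff_not, beq_eq_false_iff_ne] at hcheck
  rcases hcheck with h | h
  · apply h
    rw [mul_comm] at hdet
    exact Int.isUnit_iff_natAbs_eq.1 (IsUnit.of_mul_eq_one _ hdet)
  · exact h hdisj

end Edges

/-! ### Metric consequences of a classical configuration -/

section Metric

variable {D E : Set Sphere} {m n σ τ : ℂ} {k l : ℝ}

lemma dot_neg_left (n z : ℂ) : dot (-n) z = -dot n z := by simp [dot]; ring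

lemma add_le_dot_of_transl (hn : ‖n‖ = 1)
    (h : transl τ '' (closure (halfPlane (-n) l))ᶜ = halfPlane n k) : k + l ≤ dot n τ := by
  by_contra hlt
  push Not at hlt
  set t : ℝ := k - dot n τ with ht
  have hdot : dot n (t * n) = t := by rw [dot_smul, dot_self, hn]; simp
  have hmem : ((t * n : ℂ) : Sphere) ∈ (closure (halfPlane (-n) l))ᶜ := by
    intro hc
    rcases closure_halfPlane_subset _ _ hc with h' | ⟨z, hz, hz'⟩
    · exact OnePoint.coe_ne_infty _ h'
    · rw [OnePoint.coe_eq_coe] at hz'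
      rw [hz'] at hz
      change l ≤ dot (-n) (t * n) at hz
      rw [dot_neg_left, hdot] at hz
      linarith
  have := h ▸ Set.mem_image_of_mem (transl τ) hmem
  rw [transl_coe, coe_mem_halfPlane, dot_add, hdot] at this
  linarith

lemma image_swap_of_coTransl (h : coTransl σ '' (closure D)ᶜ = E) :
    transl σ '' (closure (swap '' D))ᶜ = swap '' E := by
  rw [← image_closure_of_mem swap_mem, ← Set.image_compl_eq swap.bijective, transl_eq, ← h,
    ← Set.image_comp, ← Set.image_comp]
  congr 1
  funext z
  simp

lemma coe_mem_iff_of_swap (h : swap '' E = halfPlane m l) {z : ℂ} (hz : z ≠ 0) :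
    (z : Sphere) ∈ E ↔ l < dot m z⁻¹ := by
  rw [← coe_mem_halfPlane, ← h, ← swapGL_coe hz]
  exact (swap.injective.mem_set_image (a := (z : Sphere))).symm

lemma exists_swap_halfPlane (hE : IsDisc E) (h0 : ((0 : ℂ) : Sphere) ∈ closure E)
    (h0' : ((0 : ℂ) : Sphere) ∉ E) (hi : OnePoint.infty ∉ E) :
    ∃ (m : ℂ) (l : ℝ), ‖m‖ = 1 ∧ 0 ≤ l ∧ swap '' E = halfPlane m l := by
  obtain ⟨m, l, hm, h⟩ := (hE.image swap_mem).eq_halfPlane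
    (by rw [← image_closure_of_mem swap_mem]; exact ⟨_, h0, swapGL_zero⟩)
    (by
      rintro ⟨z, hz, hz'⟩
      rw [swap.injective (hz'.trans swapGL_zero.symm)] at hz
      exact h0' hz)
  refine ⟨m, l, hm, ?_, h⟩
  by_contra hl
  push Not at hl
  have : ((0 : ℂ) : Sphere) ∈ swap '' E := by
    rw [h, coe_mem_halfPlane]; simpa [dot] using hl
  obtain ⟨z, hz, hz'⟩ := this
  rw [swap.injective (hz'.trans swapGL_infty.symm)] at hz
  exact hi hz

lemma dot_inv (m z : ℂ) : dot m z⁻¹ = (m * z).re / Complex.normSq z := by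
  simp [dot, Complex.inv_re, Complex.inv_im]; ring

/-- A disc that is tangent to a line at `0` and is contained in a half-plane has bounded size. -/
lemma one_add_re_le (h : swap '' E = halfPlane m l) (hl : 0 ≤ l) (hm : ‖m‖ = 1) (hn : ‖n‖ = 1)
    (hk : 0 ≤ k) (hE : ∀ z : ℂ, (z : Sphere) ∈ E → dot n z ≤ k) : 1 + (n * m).re ≤ 2 * l * k := by
  by_cases hc : 1 + (n * m).re ≤ 0
  · exact hc.trans (by positivity)
  push Not at hc
  have hm' : m.re * m.re + m.im * m.im = 1 := by
    rw [← Complex.normSq_apply, Complex.normSq_eq_norm_sq, hm]; norm_num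
  have hn' : n.re * n.re + n.im * n.im = 1 := by
    rw [← Complex.normSq_apply, Complex.normSq_eq_norm_sq, hn]; norm_num
  have key : ∀ L : ℝ, l < L → 1 + (n * m).re ≤ 2 * L * k := by
    intro L hL
    have hL0 : 0 < L := by linarith
    set z : ℂ := ((1 / (2 * L) : ℝ) : ℂ) * (starRingEnd ℂ m + n) with hz
    have hre : z.re = (m.re + n.re) / (2 * L) := by simp only [hz, Complex.re_ofReal_mul]; simp; ring
    have him : z.im = (-m.im + n.im) / (2 * L) := by simp only [hz, Complex.im_ofReal_mul]; simp; ring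
    have hcc : (n * m).re = n.re * m.re - n.im * m.im := Complex.mul_re _ _
    have hns : Complex.normSq z = 2 * (1 + (n * m).re) / (2 * L) ^ 2 := by
      rw [Complex.normSq_apply, hre, him, hcc]
      field_simp
      linear_combination hm' + hn'
    have hmz : (m * z).re = (1 + (n * m).re) / (2 * L) := by
      rw [Complex.mul_re, hre, him, hcc]
      field_simp
      linear_combination hm'
    have hnz : dot n z = (1 + (n * m).re) / (2 * L) := by
      rw [dot, hre, him, hcc]
      field_simp
      linear_combination hn'
    have hz0 : z ≠ 0 := by
      intro h0
      rw [h0, map_zero] at hns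
      have : 0 < 2 * (1 + (n * m).re) / (2 * L) ^ 2 := by positivity
      linarith
    have hmem : (z : Sphere) ∈ E := by
      rw [coe_mem_iff_of_swap h hz0, dot_inv, hns, hmz]
      have : (1 + (n * m).re) / (2 * L) / (2 * (1 + (n * m).re) / (2 * L) ^ 2) = L := by
        field_simp
      rwa [this]
    have := hE z hmem
    rw [hnz, div_le_iff₀ (by positivity)] at this
    linarith
  by_contra hlt
  push Not at hlt
  rcases hk.eq_or_lt with rfl | hk
  · have := key (l + 1) (by linarith)
    linarith
  · have := key (((1 + (n * m).re) / (2 * k) + l) / 2) (by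
      have : l < (1 + (n * m).re) / (2 * k) := by
        rw [lt_div_iff₀ (by positivity)]; linarith
      linarith)
    have h2 : (1 + (n * m).re) / (2 * k) * (2 * k) = 1 + (n * m).re := by field_simp
    nlinarith

lemma ball_subset_of_swap (h : swap '' E = halfPlane m l) (hl : 0 < l) (hm : ‖m‖ = 1) :
    (fun z : ℂ => (z : Sphere)) '' Metric.ball (((1 / (2 * l) : ℝ) : ℂ) * starRingEnd ℂ m)
      (1 / (2 * l)) ⊆ E := by
  rintro _ ⟨z, hz, rfl⟩
  have hm' : m.re * m.re + m.im * m.im = 1 := by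
    rw [← Complex.normSq_apply, Complex.normSq_eq_norm_sq, hm]; norm_num
  have hlt : z.re * z.re + z.im * z.im < (m * z).re / l := by
    rw [Metric.mem_ball, dist_eq_norm] at hz
    have h1 : ‖z - ((1 / (2 * l) : ℝ) : ℂ) * starRingEnd ℂ m‖ ^ 2 < (1 / (2 * l)) ^ 2 := by
      gcongr
    rw [← Complex.normSq_eq_norm_sq, Complex.normSq_apply, Complex.sub_re, Complex.sub_im,
      Complex.re_ofReal_mul, Complex.im_ofReal_mul, Complex.conj_re, Complex.conj_im] at h1
    have h2 : (m * z).re / l = 2 * (1 / (2 * l)) * (m.re * z.re - m.im * z.im) := by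
      rw [Complex.mul_re]; field_simp
    rw [h2]
    linear_combination h1 - (1 / (2 * l)) ^ 2 * hm'
  have hz0 : z ≠ 0 := by
    rintro rfl
    simp at hlt
  change (z : Sphere) ∈ E
  have hp : 0 < Complex.normSq z := Complex.normSq_pos.2 hz0
  rw [coe_mem_iff_of_swap h hz0, dot_inv, lt_div_iff₀ hp, Complex.normSq_apply]
  rw [lt_div_iff₀ hl] at hlt
  linarith

end Metric

/-! ### The parabola inequality -/

lemma norm_add_abs_im_of_dot_mul_dot {τ σ n m : ℂ} (hn : ‖n‖ = 1) (hm : ‖m‖ = 1)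
    (h : 2 * (1 + |(n * m).re|) ≤ dot n τ * dot m σ) : 4 ≤ ‖τ * σ‖ + |(τ * σ).im| := by
  by_contra hlt
  push Not at hlt
  have hX := Complex.abs_re_le_norm (τ * σ)
  set w := τ * σ with hw
  have hN : ‖n * m‖ = 1 := by rw [norm_mul, hn, hm, one_mul]
  have hd : |(n * m).im| ≤ 1 := hN ▸ Complex.abs_im_le_norm _
  have h1 : 2 * (dot n τ * dot m σ) ≤ ‖w‖ + dot (n * m) w := by
    set T := starRingEnd ℂ n * τ with hT
    set S := starRingEnd ℂ m * σ with hS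
    have e1 : dot n τ = T.re := by simp [dot, hT]
    have e2 : dot m σ = S.re := by simp [dot, hS]
    have e3 : dot (n * m) w = T.re * S.re - T.im * S.im := by
      simp [dot, hT, hS, hw]; ring
    have e4 : ‖w‖ = ‖T‖ * ‖S‖ := by simp [hT, hS, hw, hn, hm]
    have e5 : T.re * S.re + T.im * S.im ≤ ‖T‖ * ‖S‖ := by
      have := Complex.re_le_norm (starRingEnd ℂ T * S)
      rw [norm_mul, RCLike.norm_conj] at this
      simpa using this
    rw [e1, e2, e3, e4]
    linarith
  have h2 : dot (n * m) w ≤ |(n * m).re| * |w.re| + |w.im| := by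
    rw [dot]
    have a1 : (n * m).re * w.re ≤ |(n * m).re| * |w.re| := by
      rw [← abs_mul]; exact le_abs_self _
    have a2 : (n * m).im * w.im ≤ |(n * m).im| * |w.im| := by
      rw [← abs_mul]; exact le_abs_self _
    have a3 : |(n * m).im| * |w.im| ≤ 1 * |w.im| := by gcongr
    linarith
  have h3 : |(n * m).re| * |w.re| ≤ |(n * m).re| * 4 := by
    gcongr
    linarith [abs_nonneg w.im]
  linarith

lemma norm_add_abs_im_of_tangent {T S : ℂ} (hT : 0 < T.re) (h1 : 2 ≤ T.re * S.re)
    (h2 : 4 * T.re ≤ Complex.normSq T * S.re) : 4 ≤ ‖T * S‖ + |(T * S).im| := by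
  by_contra hlt
  push Not at hlt
  have hX := Complex.abs_re_le_norm (T * S)
  have hY := Complex.abs_im_le_norm (T * S)
  set w := T * S with hw
  have e : Complex.normSq T * S.re = T.re * w.re + T.im * w.im := by
    rw [Complex.normSq_apply, hw, Complex.mul_re, Complex.mul_im]; ring
  have h3 : Complex.normSq T * S.re ≤ T.re * |w.re| + |T.im| * |w.im| := by
    rw [e, ← abs_mul T.im]
    have := mul_le_mul_of_nonneg_left (le_abs_self w.re) hT.le
    linarith [le_abs_self (T.im * w.im)]
  have h4 : T.re * |w.re| < T.re * (4 - |w.im|) := by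
    apply mul_lt_mul_of_pos_left _ hT
    linarith
  rcases le_total |T.im| T.re with hq | hq
  · have := mul_le_mul_of_nonneg_right hq (abs_nonneg w.im)
    linarith
  · have h5 : (|T.im| - T.re) * |w.im| ≤ (|T.im| - T.re) * 2 := by
      apply mul_le_mul_of_nonneg_left _ (by linarith)
      linarith
    have h6 : Complex.normSq T * S.re < 2 * T.re + 2 * |T.im| := by linarith
    have h7 := mul_lt_mul_of_pos_left h6 hT
    have h8 : Complex.normSq T = T.re * T.re + |T.im| * |T.im| := by
      rw [Complex.normSq_apply, abs_mul_abs_self]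
    have h9 : 2 * Complex.normSq T ≤ T.re * (Complex.normSq T * S.re) := by
      have := mul_le_mul_of_nonneg_left h1 (Complex.normSq_nonneg T)
      linarith
    rw [h8] at h9 h7
    nlinarith

section Core

variable {α : Type*} {g : α → Equiv.Perm Sphere} {D : α × Bool → Set Sphere} {x y : α × Bool}
  {τ σ : ℂ}

lemma PingPong.mem_closure_of_letter (hD : PingPong g D) {p : Sphere}
    (hp : IsParabolicAt (letter g x) p) : p ∈ closure (D x) :=
  hp.mem_closure (hD.isDisc _).nonempty (hD.letter_image_subset (linv_ne x).symm)

lemma PingPong.mem_closure_linv_of_letter (hD : PingPong g D) {p : Sphere}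
    (hp : IsParabolicAt (letter g x) p) : p ∈ closure (D (linv x)) :=
  hD.mem_closure_of_letter (by rw [letter_linv]; exact hp.inv)

lemma PingPong.letter_pow_image_subset (hD : PingPong g D) (hxy : y ≠ linv x) (N : ℕ) :
    ⇑(letter g x ^ (N + 1)) '' D y ⊆ D x := by
  induction N with
  | zero => simpa using hD.letter_image_subset hxy
  | succ N ih =>
    rw [pow_succ', Equiv.Perm.coe_mul, Set.image_comp]
    exact (Set.image_mono ih).trans (hD.letter_image_subset (linv_ne x).symm)

lemma ne_of_fst_ne {x y : α × Bool} (h : x.1 ≠ y.1) : x ≠ y := fun h' => h (by rw [h'])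

/-- The half-planes of a translation letter. -/
lemma PingPong.exists_halfPlanes (hD : PingPong g D) (hτ : τ ≠ 0) (hx : letter g x = transl τ) :
    ∃ (n : ℂ) (k k' : ℝ), ‖n‖ = 1 ∧ D x = halfPlane n k ∧ D (linv x) = halfPlane (-n) k' ∧
      k + k' ≤ dot n τ := by
  have hp : IsParabolicAt (letter g x) OnePoint.infty := hx ▸ isParabolicAt_transl hτ
  have c1 := hD.mem_closure_of_letter hp
  have c2 := hD.mem_closure_linv_of_letter hp
  have hdis := hD.disjoint x (linv x) (linv_ne x).symm
  obtain ⟨n, k, hn, h1⟩ := (hD.isDisc x).eq_halfPlane c1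
    (notMem_of_mem_closure (hD.isDisc x).isOpen hdis c2)
  obtain ⟨n', k', hn', h2⟩ := (hD.isDisc (linv x)).eq_halfPlane c2
    (notMem_of_mem_closure (hD.isDisc _).isOpen hdis.symm c1)
  obtain ⟨rfl, -⟩ := eq_neg_of_disjoint_halfPlane hn hn' (h1 ▸ h2 ▸ hdis)
  refine ⟨n, k, k', hn, h1, h2, add_le_dot_of_transl hn ?_⟩
  rw [← h1, ← h2, ← hx]
  exact hD.image x

lemma le_of_disjoint_halfPlane {E : Set Sphere} {n z : ℂ} {k : ℝ}
    (h : Disjoint E (halfPlane n k)) (hz : (z : Sphere) ∈ E) : dot n z ≤ k := by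
  by_contra hlt
  push Not at hlt
  exact Set.disjoint_left.1 h hz (coe_mem_halfPlane.2 hlt)

lemma nonneg_of_zero_notMem {n : ℂ} {k : ℝ} (h : ((0 : ℂ) : Sphere) ∉ halfPlane n k) : 0 ≤ k := by
  rw [coe_mem_halfPlane] at h
  simpa [dot] using h

lemma PingPong.parabola_of_letters (hD : PingPong g D) (hxy : x.1 ≠ y.1) (hτ : τ ≠ 0) (hσ : σ ≠ 0)
    (hx : letter g x = transl τ) (hy : letter g y = coTransl σ) :
    4 ≤ ‖τ * σ‖ + |(τ * σ).im| := by
  obtain ⟨n, k, k', hn, hA, hA', hP⟩ := hD.exists_halfPlanes hτ hx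
  have hq : IsParabolicAt (letter g y) ((0 : ℂ) : Sphere) := hy ▸ isParabolicAt_coTransl hσ
  have b1 := hD.mem_closure_of_letter hq
  have b2 := hD.mem_closure_linv_of_letter hq
  have hBB := hD.disjoint y (linv y) (linv_ne y).symm
  have hp : IsParabolicAt (letter g x) OnePoint.infty := hx ▸ isParabolicAt_transl hτ
  have a1 := hD.mem_closure_of_letter hp
  have hyA : ∀ z : α × Bool, z.1 ≠ y.1 → Disjoint (D y) (D z) :=
    fun z hz => hD.disjoint _ _ (ne_of_fst_ne hz.symm)
  have hyA' : ∀ z : α × Bool, z.1 ≠ y.1 → Disjoint (D (linv y)) (D z) :=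
    fun z hz => hD.disjoint _ _ (ne_of_fst_ne (y := z) (x := linv y) hz.symm)
  obtain ⟨m, l, hm, hl, hB⟩ := exists_swap_halfPlane (hD.isDisc y) b1
    (notMem_of_mem_closure (hD.isDisc y).isOpen hBB b2)
    (notMem_of_mem_closure (hD.isDisc y).isOpen (hyA x hxy) a1)
  obtain ⟨m', l', hm', hl', hB'⟩ := exists_swap_halfPlane (hD.isDisc (linv y)) b2
    (notMem_of_mem_closure (hD.isDisc _).isOpen hBB.symm b1)
    (notMem_of_mem_closure (hD.isDisc _).isOpen (hyA' x hxy) a1)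
  have hdis := (Set.disjoint_image_iff swap.injective).2 hBB
  rw [hB, hB'] at hdis
  obtain ⟨rfl, -⟩ := eq_neg_of_disjoint_halfPlane hm hm' hdis
  have hQ : l + l' ≤ dot m σ := by
    apply add_le_dot_of_transl hm
    rw [← hB, ← hB']
    apply image_swap_of_coTransl
    rw [← hy]
    exact hD.image y
  have hk : 0 ≤ k := nonneg_of_zero_notMem (n := n)
    (hA ▸ notMem_of_mem_closure (hD.isDisc x).isOpen (hyA x hxy).symm b1)
  have hk' : 0 ≤ k' := nonneg_of_zero_notMem (n := -n)
    (hA' ▸ notMem_of_mem_closure (hD.isDisc _).isOpen (hyA (linv x) hxy).symm b1)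
  have hn' : ‖-n‖ = 1 := by rwa [norm_neg]
  have i1 := one_add_re_le hB hl hm hn hk fun z => le_of_disjoint_halfPlane (hA ▸ hyA x hxy)
  have i2 := one_add_re_le hB hl hm hn' hk'
    fun z => le_of_disjoint_halfPlane (hA' ▸ hyA (linv x) hxy)
  have i3 := one_add_re_le hB' hl' hm' hn hk fun z => le_of_disjoint_halfPlane (hA ▸ hyA' x hxy)
  have i4 := one_add_re_le hB' hl' hm' hn' hk'
    fun z => le_of_disjoint_halfPlane (hA' ▸ hyA' (linv x) hxy)
  apply norm_add_abs_im_of_dot_mul_dot hn hm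
  have hPQ : (k + k') * (l + l') ≤ dot n τ * dot m σ :=
    mul_le_mul hP hQ (by positivity) (by linarith)
  simp only [neg_mul, mul_neg, neg_neg, Complex.neg_re] at i2 i3 i4
  set c := (n * m).re
  have amgm : ∀ {e p q r s : ℝ}, 0 ≤ p → 0 ≤ q → 0 ≤ r → 0 ≤ s → 0 ≤ e → e ≤ 2 * (p * q) →
      e ≤ 2 * (r * s) → 2 * e ≤ (p + r) * (q + s) := by
    intro e p q r s hp hq hr hs he h1 h2
    have h3 : e * e ≤ 2 * (p * q) * (2 * (r * s)) := by gcongr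
    have h4 : e ≤ p * s + r * q := by
      apply le_of_sq_le_sq _ (by positivity)
      nlinarith [sq_nonneg (p * s - r * q)]
    nlinarith
  have hc1 : |c| ≤ 1 := by
    have := Complex.abs_re_le_norm (n * m)
    rwa [norm_mul, hn, hm, one_mul] at this
  rcases abs_cases c with ⟨hc, -⟩ | ⟨hc, -⟩
  · have := amgm hk hl hk' hl' (e := 1 + c) (by rw [hc] at hc1; rw [← hc]; positivity)
      (by linarith) (by linarith)
    rw [hc]; linarith
  · have := amgm hk hl' hk' hl (e := 1 - c) (by rw [sub_eq_add_neg, ← hc]; positivity)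
      (by linarith) (by linarith)
    rw [hc]; linarith

/-- The words that remain when a parabolic element is a letter times a power of a translation. -/
lemma PingPong.zero_mem_closure (hD : PingPong g D) (hxy : x.1 ≠ y.1) {N : ℕ} {s : Equiv.Perm Sphere}
    {p : Sphere} (hs : IsParabolicAt s p) (hy : s = letter g y * letter g x ^ (N + 1)) :
    p ∈ closure (D y) ∧ p ∈ closure (D (linv x)) := by
  constructor
  · refine hs.mem_closure (hD.isDisc _).nonempty ?_
    rw [hy, Equiv.Perm.coe_mul, Set.image_comp]
    exact (Set.image_mono (hD.letter_pow_image_subset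
      (ne_of_fst_ne (y := linv x) hxy.symm) N)).trans (hD.letter_image_subset
      (ne_of_fst_ne (y := linv y) hxy))
  · refine hs.inv.mem_closure (hD.isDisc _).nonempty ?_
    rw [hy, mul_inv_rev, ← inv_pow, ← letter_linv, ← letter_linv, Equiv.Perm.coe_mul,
      Set.image_comp]
    exact (Set.image_mono (hD.letter_image_subset (by
      rw [linv_linv]; exact ne_of_fst_ne (x := linv x) hxy))).trans
      (hD.letter_pow_image_subset (ne_of_fst_ne (x := linv y) (y := linv (linv x)) hxy.symm) N)

lemma PingPong.exponent_lt_two (hD : PingPong g D) (hxy : x.1 ≠ y.1) (hτ : τ ≠ 0) (hσ : σ ≠ 0)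
    (hx : letter g x = transl τ) {N : ℕ} (hy : coTransl σ = letter g y * letter g x ^ (N + 2)) :
    False := by
  have hq := isParabolicAt_coTransl hσ
  have hp : IsParabolicAt (letter g x) OnePoint.infty := hx ▸ isParabolicAt_transl hτ
  have hconj : letter g x * coTransl σ * (letter g x)⁻¹ =
      letter g x * letter g y * letter g x ^ (N + 1) := by
    rw [hy, pow_succ (letter g x) (N + 1)]
    simp only [mul_assoc, mul_inv_cancel, mul_one]
  have hr := hq.conj (hD.letter_mem x)
  rw [hconj] at hr
  have e1 : letter g x ((0 : ℂ) : Sphere) ∈ closure (D x) := by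
    refine hr.mem_closure (hD.isDisc _).nonempty ?_
    rw [Equiv.Perm.coe_mul, Equiv.Perm.coe_mul, Set.image_comp, Set.image_comp]
    exact (Set.image_mono ((Set.image_mono (hD.letter_pow_image_subset
      (linv_ne x).symm N)).trans (hD.letter_image_subset (ne_of_fst_ne (y := linv y) hxy)))).trans
      (hD.letter_image_subset (ne_of_fst_ne (y := linv x) hxy.symm))
  have e2 : letter g x ((0 : ℂ) : Sphere) ∈ closure (D (linv x)) := by
    refine hr.inv.mem_closure (hD.isDisc _).nonempty ?_
    rw [mul_inv_rev, mul_inv_rev, ← inv_pow, ← letter_linv, ← letter_linv, Equiv.Perm.coe_mul,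
      Equiv.Perm.coe_mul, Set.image_comp, Set.image_comp]
    exact (Set.image_mono ((Set.image_mono (hD.letter_image_subset (by
      rw [linv_linv]; exact linv_ne x))).trans (hD.letter_image_subset (by
      rw [linv_linv]; exact ne_of_fst_ne (x := linv x) hxy)))).trans
      (hD.letter_pow_image_subset (ne_of_fst_ne (x := linv y) (y := linv (linv x)) hxy.symm) N)
  have := tangency_unique (hD.isDisc x) (hD.isDisc (linv x)) (hD.isDisc y).nonempty
    (hD.disjoint _ _ (linv_ne x).symm) (hD.disjoint _ _ (ne_of_fst_ne hxy))
    (hD.disjoint _ _ (ne_of_fst_ne (x := linv x) hxy)) (hD.isDisc y).isOpen e1 e2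
    (hD.mem_closure_of_letter hp) (hD.mem_closure_linv_of_letter hp)
  rw [hx, transl_coe] at this
  exact OnePoint.coe_ne_infty _ this

lemma PingPong.parabola_of_mul (hD : PingPong g D) (hxy : x.1 ≠ y.1) (hτ : τ ≠ 0) (hσ : σ ≠ 0)
    (hx : letter g x = transl τ) (hy : coTransl σ = letter g y * letter g x) :
    4 ≤ ‖τ * σ‖ + |(τ * σ).im| := by
  obtain ⟨n, k, k', hn, hA, hA', hP⟩ := hD.exists_halfPlanes hτ hx
  have hq := isParabolicAt_coTransl hσ
  have hp : IsParabolicAt (letter g x) OnePoint.infty := hx ▸ isParabolicAt_transl hτ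
  obtain ⟨b1, a1⟩ := hD.zero_mem_closure hxy (N := 0) hq (by simpa using hy)
  have hyA : Disjoint (D y) (D x) := hD.disjoint _ _ (ne_of_fst_ne hxy.symm)
  have hyA' : Disjoint (D y) (D (linv x)) :=
    hD.disjoint _ _ (ne_of_fst_ne (y := linv x) hxy.symm)
  set E : Set Sphere := ⇑(letter g (linv x)) '' D (linv y) with hEdef
  have hEA : E ⊆ D (linv x) := by
    rw [hEdef]
    exact hD.letter_image_subset (by
      rw [linv_linv]; exact ne_of_fst_ne (x := linv y) hxy.symm)
  have hEd : IsDisc E := (hD.isDisc _).image (hD.letter_mem _)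
  have hED : ⇑(letter g x) '' E = D (linv y) := by
    rw [hEdef, ← Set.image_comp]; simp
  have hEB : Disjoint (D y) E := hyA'.mono_right hEA
  have e0 : ((0 : ℂ) : Sphere) ∈ closure E := by
    refine hq.inv.mem_closure hEd.nonempty ?_
    rw [hy, mul_inv_rev, ← letter_linv, Equiv.Perm.coe_mul, Set.image_comp]
    refine Set.image_mono ((Set.image_mono hEA).trans ?_)
    rw [← letter_linv]
    exact hD.letter_image_subset (by
      rw [linv_linv]; exact ne_of_fst_ne (x := linv x) hxy)
  have hmap : coTransl σ '' (closure E)ᶜ = D y := by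
    rw [hEdef, ← image_closure_of_mem (hD.letter_mem _),
      ← Set.image_compl_eq (letter g (linv x)).bijective, ← Set.image_comp, hy, ← hD.image y]
    congr 1
    funext z
    simp
  have i1 : OnePoint.infty ∉ D y :=
    notMem_of_mem_closure (hD.isDisc y).isOpen hyA (hD.mem_closure_of_letter hp)
  have i2 : OnePoint.infty ∉ E := fun h => infty_notMem_halfPlane (hA' ▸ hEA h)
  obtain ⟨m, l, hm, hl, hB⟩ := exists_swap_halfPlane (hD.isDisc y) b1
    (notMem_of_mem_closure (hD.isDisc y).isOpen hEB e0) i1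
  obtain ⟨m', l', hm', hl', hE⟩ := exists_swap_halfPlane hEd e0
    (notMem_of_mem_closure hEd.isOpen hEB.symm b1) i2
  have hdis := (Set.disjoint_image_iff swap.injective).2 hEB
  rw [hB, hE] at hdis
  obtain ⟨rfl, -⟩ := eq_neg_of_disjoint_halfPlane hm hm' hdis
  have hQ : l + l' ≤ dot m σ := by
    apply add_le_dot_of_transl hm
    rw [← hB, ← hE]
    exact image_swap_of_coTransl hmap
  have hk' : k' = 0 := by
    apply le_antisymm
    · rcases closure_halfPlane_subset _ _ (hA' ▸ a1) with h | ⟨z, hz, hz'⟩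
      · exact absurd h (OnePoint.coe_ne_infty _)
      · rw [OnePoint.coe_eq_coe] at hz'
        rw [hz'] at hz
        simpa [dot] using hz
    · exact nonneg_of_zero_notMem (n := -n)
        (hA' ▸ notMem_of_mem_closure (hD.isDisc _).isOpen hyA'.symm b1)
  subst hk'
  have hk : 0 ≤ k := nonneg_of_zero_notMem (n := n)
    (hA ▸ notMem_of_mem_closure (hD.isDisc x).isOpen hyA.symm b1)
  have hn' : ‖-n‖ = 1 := by rwa [norm_neg]
  have j1 := one_add_re_le hB hl hm hn' le_rfl fun z => le_of_disjoint_halfPlane (hA' ▸ hyA')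
  have hc : (n * m).re = 1 := by
    have := Complex.re_le_norm (n * m)
    rw [norm_mul, hn, hm, one_mul] at this
    rw [neg_mul, Complex.neg_re] at j1
    linarith
  have hmn : m = starRingEnd ℂ n := by
    have hm2 : m.re * m.re + m.im * m.im = 1 := by
      rw [← Complex.normSq_apply, Complex.normSq_eq_norm_sq, hm]; norm_num
    have hn2 : n.re * n.re + n.im * n.im = 1 := by
      rw [← Complex.normSq_apply, Complex.normSq_eq_norm_sq, hn]; norm_num
    rw [Complex.mul_re] at hc
    have h0 : (m.re - n.re) ^ 2 + (m.im + n.im) ^ 2 = 0 := by linear_combination hm2 + hn2 - 2 * hc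
    have h1 : m.re - n.re = 0 := by nlinarith [sq_nonneg (m.re - n.re), sq_nonneg (m.im + n.im)]
    have h2 : m.im + n.im = 0 := by nlinarith [sq_nonneg (m.re - n.re), sq_nonneg (m.im + n.im)]
    apply Complex.ext
    · simp; linarith
    · simp; linarith
  have j2 := one_add_re_le hB hl hm hn hk fun z => le_of_disjoint_halfPlane (hA ▸ hyA)
  have j3 := one_add_re_le hE hl' hm' hn' (k := dot n τ) (by linarith) fun z hz => by
    have h1 : ((z + τ : ℂ) : Sphere) ∈ D (linv y) := by
      rw [← hED, ← transl_coe, ← hx]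
      exact Set.mem_image_of_mem _ hz
    have := le_of_disjoint_halfPlane (n := -n) (k := 0) (hA' ▸ hD.disjoint (linv y) (linv x)
      (ne_of_fst_ne (x := linv y) (y := linv x) hxy.symm)) h1
    rw [dot_neg_left, dot_add] at this
    rw [dot_neg_left]
    linarith
  rw [neg_mul_neg, hc] at j3
  rw [hc] at j2
  set P := dot n τ with hPdef
  have hP0 : 0 < P := by
    rcases (show 0 ≤ P by linarith).eq_or_lt with h | h
    · rw [← h] at j3; linarith
    · exact h
  have hl0 : 0 < l := by
    rcases hl.eq_or_lt with h | h
    · rw [← h] at j2; linarith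
    · exact h
  have hl0' : 0 < l' := by
    rcases hl'.eq_or_lt with h | h
    · rw [← h] at j3; linarith
    · exact h
  have hlP : 1 ≤ l * P := by
    have : l * k ≤ l * P := by gcongr; linarith
    linarith
  have hballs : Disjoint
      (Metric.ball (((1 / (2 * l) : ℝ) : ℂ) * starRingEnd ℂ m) (1 / (2 * l)))
      (Metric.ball (((1 / (2 * l') : ℝ) : ℂ) * starRingEnd ℂ (-m) + τ) (1 / (2 * l'))) := by
    rw [Set.disjoint_left]
    intro z hz hz'
    have h1 := ball_subset_of_swap hB hl0 hm ⟨z, hz, rfl⟩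
    have h2 : (z - τ) ∈ Metric.ball (((1 / (2 * l') : ℝ) : ℂ) * starRingEnd ℂ (-m)) (1 / (2 * l')) := by
      rw [Metric.mem_ball, dist_eq_norm] at hz' ⊢
      rwa [sub_sub, add_comm τ]
    have h3 := Set.mem_image_of_mem ⇑(letter g x) (ball_subset_of_swap hE hl0' hm' ⟨_, h2, rfl⟩)
    rw [hED, hx, transl_coe, sub_add_cancel] at h3
    exact Set.disjoint_left.1 (hD.disjoint _ _ (linv_ne y).symm) h1 h3
  rw [disjoint_ball_ball_iff (by positivity) (by positivity), dist_eq_norm] at hballs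
  have hn2 : n.re * n.re + n.im * n.im = 1 := by
    rw [← Complex.normSq_apply, Complex.normSq_eq_norm_sq, hn]; norm_num
  have hτn : P * (1 / l + 1 / l') ≤ Complex.normSq τ := by
    have h1 : (1 / (2 * l) + 1 / (2 * l')) ^ 2 ≤ ‖((1 / (2 * l) : ℝ) : ℂ) * starRingEnd ℂ m -
      (((1 / (2 * l') : ℝ) : ℂ) * starRingEnd ℂ (-m) + τ)‖ ^ 2 := by gcongr
    rw [← Complex.normSq_eq_norm_sq, hmn, map_neg, Complex.conj_conj, Complex.normSq_apply] at h1
    simp only [Complex.sub_re, Complex.sub_im, Complex.add_re, Complex.add_im,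
      Complex.re_ofReal_mul, Complex.im_ofReal_mul, Complex.neg_re, Complex.neg_im] at h1
    have h2 : P * (1 / l + 1 / l') = 2 * (1 / (2 * l) + 1 / (2 * l')) *
        (n.re * τ.re + n.im * τ.im) := by
      rw [hPdef, dot]; field_simp
    rw [h2, Complex.normSq_apply]
    linear_combination h1 + (1 / (2 * l) + 1 / (2 * l')) ^ 2 * hn2
  have hprod : starRingEnd ℂ n * τ * (n * σ) = τ * σ := by
    have : starRingEnd ℂ n * n = 1 := by
      rw [mul_comm, Complex.mul_conj, Complex.normSq_eq_norm_sq, hn]; simp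
    linear_combination τ * σ * this
  have r1 : (starRingEnd ℂ n * τ).re = P := by simp [hPdef, dot]
  have r2 : (n * σ).re = dot m σ := by simp [hmn, dot, sub_eq_add_neg]
  have r3 : Complex.normSq (starRingEnd ℂ n * τ) = Complex.normSq τ := by
    rw [map_mul, Complex.normSq_conj, Complex.normSq_eq_norm_sq, hn]; simp
  have hPQ : P * (l + l') ≤ P * dot m σ := by gcongr
  rw [← hprod]
  apply norm_add_abs_im_of_tangent
  · rwa [r1]
  · rw [r1, r2]; linarith
  · rw [r1, r2, r3]
    have h1 : P * (1 / l + 1 / l') * (l + l') ≤ Complex.normSq τ * dot m σ := by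
      apply mul_le_mul hτn hQ (by positivity) (Complex.normSq_nonneg _)
    have h2 : 4 ≤ (1 / l + 1 / l') * (l + l') := by
      have : (1 / l + 1 / l') * (l + l') = 4 + (l - l') ^ 2 / (l * l') := by field_simp; ring
      rw [this]
      have : 0 ≤ (l - l') ^ 2 / (l * l') := by positivity
      linarith
    have h3 := mul_le_mul_of_nonneg_left h2 hP0.le
    linarith

end Core

/-! ### Two-parabolic groups above the parabola -/

lemma letter_conj {α : Type*} (g : α → Equiv.Perm Sphere) (f : Equiv.Perm Sphere) (x : α × Bool) :
    letter (fun i => f * g i * f⁻¹) x = f * letter g x * f⁻¹ := by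
  obtain ⟨i, b⟩ := x
  cases b <;> simp [letter, mul_assoc]

lemma PingPong.conj {α : Type*} {g : α → Equiv.Perm Sphere} {D : α × Bool → Set Sphere}
    (hD : PingPong g D) {f : Equiv.Perm Sphere} (hf : f ∈ moebiusGroup) :
    PingPong (fun i => f * g i * f⁻¹) (fun x => f '' D x) where
  isDisc x := (hD.isDisc x).image hf
  disjoint x y h := (Set.disjoint_image_iff f.injective).2 (hD.disjoint x y h)
  mem i := mul_mem (mul_mem hf (hD.mem i)) (inv_mem hf)
  image x := by
    rw [letter_conj, ← image_closure_of_mem hf, ← Set.image_compl_eq f.bijective, ← hD.image x,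
      ← Set.image_comp, ← Set.image_comp]
    congr 1
    funext z
    simp

lemma PingPong.parabola_of_mul_zpow {α : Type*} {g : α → Equiv.Perm Sphere}
    {D : α × Bool → Set Sphere} {x y : α × Bool} {τ σ : ℂ} (hD : PingPong g D) (hxy : x.1 ≠ y.1)
    (hτ : τ ≠ 0) (hσ : σ ≠ 0) (hx : letter g x = transl τ) {N : ℤ}
    (hy : coTransl σ = letter g y * letter g x ^ N) : 4 ≤ ‖τ * σ‖ + |(τ * σ).im| := by
  have key : ∀ {x : α × Bool} {τ : ℂ} (N : ℕ), x.1 ≠ y.1 → τ ≠ 0 → letter g x = transl τ →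
      coTransl σ = letter g y * letter g x ^ N → 4 ≤ ‖τ * σ‖ + |(τ * σ).im| := by
    intro x τ N hxy hτ hx hy
    rcases N with _ | _ | N
    · exact hD.parabola_of_letters hxy hτ hσ hx (by rw [hy, pow_zero, mul_one])
    · exact hD.parabola_of_mul hxy hτ hσ hx (by simpa using hy)
    · exact (hD.exponent_lt_two hxy hτ hσ hx hy).elim
  obtain ⟨n, rfl | rfl⟩ := N.eq_nat_or_neg
  · exact key n hxy hτ hx (by simpa using hy)
  · have := key (x := linv x) (τ := -τ) n hxy (neg_ne_zero.2 hτ)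
      (by rw [letter_linv, hx, transl_inv]) (by rw [letter_linv, inv_pow]; simpa using hy)
    rwa [neg_mul, norm_neg, Complex.neg_im, abs_neg] at this

/-- The parabola inequality for a parabolic basis one of whose elements is conjugate to a letter. -/
lemma PingPong.parabola_of_conj_letter {g : Fin 2 → Equiv.Perm Sphere}
    {D : Fin 2 × Bool → Set Sphere} (hD : PingPong g D) {τ σ : ℂ} (hτ : τ ≠ 0) (hσ : σ ≠ 0)
    {f : Equiv.Perm Sphere} (hf : f ∈ moebiusGroup) {s t h : FreeGroup (Fin 2)}
    (hst : Subgroup.closure {s, t} = ⊤) {x : Fin 2 × Bool}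
    (hs : s = h * letter FreeGroup.of x * h⁻¹)
    (h1 : f * FreeGroup.lift g s * f⁻¹ = transl τ)
    (h2 : f * FreeGroup.lift g t * f⁻¹ = coTransl σ) : 4 ≤ ‖τ * σ‖ + |(τ * σ).im| := by
  have hof : (fun i => FreeGroup.lift g (FreeGroup.of i)) = g := by funext i; simp
  have hlm : ∀ u : FreeGroup (Fin 2), FreeGroup.lift g u ∈ moebiusGroup := by
    intro u
    have hle : (FreeGroup.lift g).range ≤ moebiusGroup := by
      rw [FreeGroup.range_lift_eq_closure, Subgroup.closure_le]
      rintro _ ⟨i, rfl⟩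
      exact hD.mem i
    exact hle ⟨u, rfl⟩
  obtain ⟨i, e⟩ := x
  obtain ⟨j, hij⟩ := exists_ne i
  set t' := h⁻¹ * t * h with ht'
  have htop : Subgroup.closure {FreeGroup.of i, t'} = ⊤ := by
    rw [eq_top_iff]
    have hmap : Subgroup.map (MulAut.conj h⁻¹).toMonoidHom (Subgroup.closure {s, t}) = ⊤ := by
      rw [hst, ← MonoidHom.range_eq_map, MonoidHom.range_eq_top]
      exact (MulAut.conj h⁻¹).surjective
    rw [← hmap, MonoidHom.map_closure, Set.image_pair, Subgroup.closure_le, Set.pair_subset_iff]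
    constructor
    · have : (MulAut.conj h⁻¹).toMonoidHom s = letter FreeGroup.of (i, e) := by
        simp [hs, mul_assoc]
      rw [this]
      have hi : FreeGroup.of i ∈ Subgroup.closure {FreeGroup.of i, t'} :=
        Subgroup.subset_closure (by simp)
      cases e
      · exact inv_mem hi
      · exact hi
    · have : (MulAut.conj h⁻¹).toMonoidHom t = t' := by simp [ht']
      rw [this]
      exact Subgroup.subset_closure (by simp)
  obtain ⟨m, n, b, htm⟩ := exists_eq_of_closure_eq_top hij.symm htop
  obtain ⟨M, N, htM⟩ : ∃ M N : ℤ, t' = letter FreeGroup.of (i, e) ^ M * letter FreeGroup.of (j, b) *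
      letter FreeGroup.of (i, e) ^ N := by
    cases e
    · exact ⟨-m, -n, by simpa [letter] using htm⟩
    · exact ⟨m, n, by simpa [letter] using htm⟩
  set k := FreeGroup.lift g (h * letter FreeGroup.of (i, e) ^ M) with hk
  have hD' := hD.conj (mul_mem hf (hlm (h * letter FreeGroup.of (i, e) ^ M)))
  refine hD'.parabola_of_mul_zpow (x := (i, e)) (y := (j, b)) (N := M + N) hij.symm hτ hσ ?_ ?_
  · rw [letter_conj, ← h1, hs]
    have : letter g (i, e) = FreeGroup.lift g (letter FreeGroup.of (i, e)) := by
      rw [map_letter, hof]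
    rw [this]
    simp only [map_mul, map_inv, mul_inv_rev, map_zpow]
    group
  · rw [letter_conj, letter_conj, ← h2]
    have e1 : letter g (i, e) = FreeGroup.lift g (letter FreeGroup.of (i, e)) := by
      rw [map_letter, hof]
    have e2 : letter g (j, b) = FreeGroup.lift g (letter FreeGroup.of (j, b)) := by
      rw [map_letter, hof]
    have e3 : t = h * t' * h⁻¹ := by rw [ht']; group
    rw [e1, e2, e3, htM, conj_zpow]
    simp only [map_mul, map_inv, mul_inv_rev, map_zpow]
    group

lemma moebius_matS : moebius (matS : GL (Fin 2) ℂ) = coTransl 1 := by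
  rw [coTransl]
  congr 1
  ext i j
  change (matS : Matrix (Fin 2) (Fin 2) ℂ) i j = _
  fin_cases i <;> fin_cases j <;> simp [matS, glMk]

lemma moebius_matT (l : ℂ) : moebius (matT l : GL (Fin 2) ℂ) = transl (2 * l) := by
  rw [transl]
  congr 1
  ext i j
  change (matT l : Matrix (Fin 2) (Fin 2) ℂ) i j = _
  fin_cases i <;> fin_cases j <;> simp [matT, affineGL, glMk]

/-- A classical T-Schottky group generated by two parabolic elements without common fixed point
satisfies the parabola inequality. -/
lemma IsClassicalTSchottky.parabola {σ τ : ℂ} (hσ : σ ≠ 0) (hτ : τ ≠ 0)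
    (h : IsClassicalTSchottky (Subgroup.closure {coTransl σ, transl τ})) :
    4 ≤ ‖τ * σ‖ + |(τ * σ).im| := by
  obtain ⟨n, g, hg, hcl⟩ := h
  obtain ⟨D, hD⟩ := hcl.exists_pingPong
  have hS : coTransl σ ∈ Subgroup.closure (Set.range g) := by
    rw [hg]; exact Subgroup.subset_closure (by simp)
  have hT : transl τ ∈ Subgroup.closure (Set.range g) := by
    rw [hg]; exact Subgroup.subset_closure (by simp)
  have hn2 : 1 < n := by
    by_contra hn
    push Not at hn
    have hsub : Subsingleton (Fin n) := Fin.subsingleton_iff_le_one.2 hn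
    have hcomm : coTransl σ * transl τ = transl τ * coTransl σ := by
      have : IsMulCommutative (Subgroup.closure (Set.range g)) :=
        Subgroup.isMulCommutative_closure (by
          rintro _ ⟨i, rfl⟩ _ ⟨j, rfl⟩
          rw [Subsingleton.elim i j])
      exact congrArg Subtype.val (this.is_comm.comm ⟨_, hS⟩ ⟨_, hT⟩)
    have := congrArg (fun f : Equiv.Perm Sphere => f OnePoint.infty) hcomm
    simp only [Equiv.Perm.mul_apply, transl_infty] at this
    rw [coTransl, glMk_infty, if_neg hσ, transl_coe, OnePoint.coe_eq_coe] at this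
    exact hτ (by simpa using this.symm)
  have : Nontrivial (Fin n) := Fin.nontrivial_iff_two_le.2 hn2
  have hinj := hD.lift_injective
  have hrange : (FreeGroup.lift g).range = Subgroup.closure (Set.range g) :=
    FreeGroup.range_lift_eq_closure
  obtain ⟨s, hs⟩ : coTransl σ ∈ (FreeGroup.lift g).range := by rwa [hrange]
  obtain ⟨t, ht⟩ : transl τ ∈ (FreeGroup.lift g).range := by rwa [hrange]
  have hst : Subgroup.closure {s, t} = ⊤ := by
    apply Subgroup.map_injective hinj
    rw [MonoidHom.map_closure, Set.image_pair, ← MonoidHom.range_eq_map, hs, ht, hrange, hg]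
  obtain rfl : n = 2 := le_antisymm (rank_le_two hst) hn2
  have pS := isParabolicAt_coTransl hσ
  have pT := isParabolicAt_transl hτ
  have ne1 : ∀ {f : Equiv.Perm Sphere} {p : Sphere}, IsParabolicAt f p → f ≠ 1 := by
    rintro f p hf rfl
    have h0 : ∀ z, z = p := fun z => tendsto_nhds_unique (by simp) (hf.1 z)
    exact OnePoint.coe_ne_infty (0 : ℂ) ((h0 _).trans (h0 _).symm)
  have hof : (fun i => FreeGroup.lift g (FreeGroup.of i)) = g := by funext i; simp
  have hlm : ∀ u : FreeGroup (Fin 2), FreeGroup.lift g u ∈ moebiusGroup := by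
    intro u
    have hle : (FreeGroup.lift g).range ≤ moebiusGroup := by
      rw [hrange, Subgroup.closure_le]
      rintro _ ⟨i, rfl⟩
      exact hD.mem i
    exact hle ⟨u, rfl⟩
  have itin : ∀ {u : FreeGroup (Fin 2)} {p : Sphere}, IsParabolicAt (FreeGroup.lift g u) p →
      ∃ (h : FreeGroup (Fin 2)) (k : ℕ) (x : ℤ → Fin 2 × Bool) (q : ℤ → Sphere),
        u = h * window FreeGroup.of x 0 k * h⁻¹ ∧ Itinerary g D k x q ∧
          ∀ a, (expo u).toAdd a = wexp x a 0 k := by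
    intro u p hu
    obtain ⟨h, k, x, hk, hx, hper, rfl⟩ := exists_conj_window u (fun h1 => ne1 hu (by simp [h1]))
    have hw := hu.conj (inv_mem (hlm h))
    rw [map_mul, map_mul, map_inv, map_window, hof, inv_inv,
      show (FreeGroup.lift g h)⁻¹ * (FreeGroup.lift g h * window g x 0 k * (FreeGroup.lift g h)⁻¹) *
        FreeGroup.lift g h = window g x 0 k by group] at hw
    obtain ⟨q, -, hq⟩ := hD.exists_itinerary hk hx hper hw
    exact ⟨h, k, x, q, rfl, hq, fun a => by rw [expo_conj, expo_window]⟩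
  obtain ⟨h₁, k₁, x₁, q₁, e₁, i₁, w₁⟩ := itin (hs.symm ▸ pS)
  obtain ⟨h₂, k₂, x₂, q₂, e₂, i₂, w₂⟩ := itin (ht.symm ▸ pT)
  obtain ⟨d, hd⟩ := exists_det_mul_eq_one hst
  rw [w₁, w₁, w₂, w₂] at hd
  rcases i₁.length_eq_one hD i₂ hd with rfl | rfl
  · rw [mul_comm]
    refine hD.parabola_of_conj_letter hσ hτ swap_mem hst (by simpa [window] using e₁) ?_ ?_
    · rw [hs, transl_eq]
    · rw [ht, coTransl_eq]
  · rw [Set.pair_comm] at hst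
    refine hD.parabola_of_conj_letter hτ hσ (one_mem _) hst (by simpa [window] using e₂) ?_ ?_
    · simpa using ht
    · simpa using hs

lemma not_isClassicalTSchottky_groupG {l : ℂ} (hl : l ≠ 0) (h : ‖l‖ + |l.im| < 2) :
    ¬ IsClassicalTSchottky (groupG l) := by
  intro hcl
  rw [groupG, twoGenerator, moebius_matS, moebius_matT] at hcl
  have := hcl.parabola one_ne_zero (mul_ne_zero two_ne_zero hl)
  have h2 : (2 * l).im = 2 * l.im := by simp
  have h3 : ‖(2 : ℂ)‖ = 2 := by simp
  rw [mul_one, norm_mul, h2, h3, abs_mul, abs_two] at this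
  linarith

lemma norm_add_im_lt {l : ℂ} (him : 0 ≤ l.im) (h : l.im < 1 - l.re ^ 2 / 4) :
    ‖l‖ + |l.im| < 2 := by
  have h1 : ‖l‖ < 2 - l.im := by
    apply lt_of_pow_lt_pow_left₀ 2 (by nlinarith [sq_nonneg l.re])
    rw [← Complex.normSq_eq_norm_sq, Complex.normSq_apply]
    nlinarith
  rw [abs_of_nonneg him]
  linarith

end TSchottky

end
theorem theorem7p2 :
    (∀ l : ℂ, 0 ≤ l.re → 0 ≤ l.im → l.im < 1 - l.re ^ 2 / 4 →
      l ∉ interior TSchottky.regionK →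
      TSchottky.IsNonClassicalTSchottky (TSchottky.groupG l)) ∧
    (∀ S T : Matrix.SpecialLinearGroup (Fin 2) ℂ,
      (S : Matrix (Fin 2) (Fin 2) ℂ).trace = 2 → (T : Matrix (Fin 2) (Fin 2) ℂ).trace = 2 →
      ∀ w : ℂ, w = ((S * T : Matrix.SpecialLinearGroup (Fin 2) ℂ) :
          Matrix (Fin 2) (Fin 2) ℂ).trace - 2 →
      ((2 ≤ ‖w‖ ∧ Real.pi / 3 ≤ w.arg ∧ w.arg ≤ Real.pi / 2) ∨
        (2 ≤ (w * Complex.exp (-(Real.pi / 3 * Complex.I))).re ∧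
          0 ≤ w.arg ∧ w.arg ≤ Real.pi / 3)) →
      TSchottky.IsTSchottky (TSchottky.twoGenerator S T)) := by
  refine ⟨fun l hre him hpar hK => ⟨TSchottky.isTSchottky_groupG hre him hK, ?_⟩,
    fun S T hS hT w hw h => TSchottky.isTSchottky_twoGenerator S T hS hT hw h⟩
  refine TSchottky.not_isClassicalTSchottky_groupG ?_ (TSchottky.norm_add_im_lt him hpar)
  rintro rfl
  exact hK (TSchottky.mem_interior_regionK_of_norm_lt (by simp))
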